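/- Let $B\ge 0$, $A=B+1$, and let $\alpha_1,\dots,\alpha_A,c_1,\dots,c_A,\beta_1,\dots,\beta_B,d_1,\dots,d_B$ be complex numbers with $\alpha_1=-1$, $c_1=0$ and $\alpha_i\neq 0$ for all $i$. For $n\in\mathbb N$ put $a_i=\alpha_i n+c_i$ (so $a_1=-n$) and $b_j=\beta_j n+d_j+1$. Call $n$ admissible if no $b_j$ is a nonpositive integer, and for such $n$ let $$p_n(z)=\sum_{k=0}^{n}\frac{\prod_{i=1}^{A}(a_i)_k}{\prod_{j=1}^{B}(b_j)_k}\,\frac{z^k}{k!}$$ be the (terminating) hypergeometric polynomial ${}_{A}F_{B}$ with these parameters, where $(x)_k=x(x+1)\cdots(x+k-1)$. For $n\ge 1$ let $\mu_n=\frac1n\sum_{\zeta}\delta_\zeta$ be its root-counting measure, the sum running over the zeros $\zeta$ of $p_n$ with multiplicity. For a finite measure $\mu$ on $\mathbb C$ let $C_\mu(z)=\int\frac{d\mu(\zeta)}{z-\zeta}$ be its Cauchy transform. Let $n_1<n_2<\cdots$ be admissible and suppose that $\mu_{n_k}$ converges weakly to a finite measure $\mu$ (it suffices that $\int f\,d\mu_{n_k}\to\int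 f\,d\mu$ for every continuous compactly supported $f$). Then: (i) for almost every $z\in\mathbb C$ (Lebesgue measure) the integral defining $C_\mu(z)$ converges absolutely and $C_{\mu_{n_k}}(z)\to C_\mu(z)$; (ii) for almost every $z\in\mathbb C$ the number $w=C_\mu(z)$ satisfies $$\prod_{i=1}^{A}(zw+\alpha_i)-w\prod_{j=1}^{B}(zw+\beta_j)=0.$$ Suppose moreover that the parameters are of general type, that is, $\alpha_2,\dots,\alpha_A$ are pairwise distinct and different from $-1$, and no $-\alpha_i$ with $i\ge 2$ lies in the real half-line $(-\infty,1]$. Then there is a compact set $K\subset\mathbb C$ that contains all zeros of $p_n$ for every admissible $n$, and every sequence $n_1<n_2<\cdots$ of admissible indices has a subsequence along which $\mu_n$ converges weakly (against all bounded continuous functions) to a probability measure carried by $K$. -/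

import Mathlib

open MeasureTheory Filter Topology Polynomial
open scoped ENNReal BoundedContinuousFunction CompactlySupported

noncomputable section

/-- The coefficient of `z ^ k` in the generalized hypergeometric series with numerator parameters
`a` and denominator parameters `b`; `ascPochhammer` gives `(x)_k = x (x + 1) ⋯ (x + k - 1)`. -/
def hypergeomCoeff {A B : ℕ} (a : Fin A → ℂ) (b : Fin B → ℂ) (k : ℕ) : ℂ :=
  (∏ i, (ascPochhammer ℂ k).eval (a i)) / (∏ j, (ascPochhammer ℂ k).eval (b j)) /
    (k.factorial : ℂ)

/-- The generalized hypergeometric series cut off after the term `z ^ n`. If some numerator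
parameter equals `-n`, this is the whole series, see `hasSum_hypergeomPoly`. -/
def hypergeomPoly {A B : ℕ} (a : Fin A → ℂ) (b : Fin B → ℂ) (n : ℕ) : ℂ[X] :=
  ∑ k ∈ Finset.range (n + 1), C (hypergeomCoeff a b k) * X ^ k

theorem hypergeomCoeff_eq_zero {A B : ℕ} (a : Fin A → ℂ) (b : Fin B → ℂ) (n k : ℕ)
    (i : Fin A) (hi : a i = -(n : ℂ)) (hk : n < k) : hypergeomCoeff a b k = 0 := by
  have h : (ascPochhammer ℂ k).eval (a i) = 0 := by
    rw [hi]; exact ascPochhammer_eval_neg_coe_nat_of_lt hk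
  unfold hypergeomCoeff
  rw [Finset.prod_eq_zero (Finset.mem_univ i) h]
  simp

theorem hasSum_hypergeomPoly {A B : ℕ} (a : Fin A → ℂ) (b : Fin B → ℂ) (n : ℕ)
    (i : Fin A) (hi : a i = -(n : ℂ)) (z : ℂ) :
    HasSum (fun k : ℕ => hypergeomCoeff a b k * z ^ k) ((hypergeomPoly a b n).eval z) := by
  have h := hasSum_sum_of_ne_finset_zero (L := SummationFilter.unconditional ℕ) (f := fun k : ℕ => hypergeomCoeff a b k * z ^ k)
    (s := Finset.range (n + 1)) (fun k hk => by
      rw [hypergeomCoeff_eq_zero a b n k i hi (by simpa using hk), zero_mul])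
  simpa [hypergeomPoly, eval_finsetSum] using h

/-- The hypergeometric polynomial `p_n` with `a_i = α_i n + c_i` and `b_j = β_j n + d_j + 1`. -/
def hyperP {B : ℕ} (α c : Fin (B + 1) → ℂ) (β d : Fin B → ℂ) (n : ℕ) : ℂ[X] :=
  hypergeomPoly (fun i => α i * n + c i) (fun j => β j * n + d j + 1) n

/-- `p_n` is defined: no denominator parameter `β_j n + d_j + 1` is a nonpositive integer. -/
def IsDefinedAt {B : ℕ} (β d : Fin B → ℂ) (n : ℕ) : Prop :=
  ∀ j, ∀ m : ℕ, β j * n + d j + 1 ≠ -(m : ℂ)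

/-- The root-counting measure `(1 / n) ∑ δ_ζ`, summed over the zeros `ζ` of `p` with
multiplicity. -/
def rootMeasure (n : ℕ) (p : ℂ[X]) : Measure ℂ :=
  (n : ℝ≥0∞)⁻¹ • (p.roots.map Measure.dirac).sum

/-- The Cauchy transform `C_μ(z) = ∫ dμ(ζ) / (z - ζ)`. -/
def cauchyTransform (μ : Measure ℂ) (z : ℂ) : ℂ :=
  ∫ ζ, (z - ζ)⁻¹ ∂μ

/-- Weak convergence tested against compactly supported continuous functions. Convergence
against all bounded continuous functions implies it. -/
def ConvergesWeakly (ν : ℕ → Measure ℂ) (μ : Measure ℂ) : Prop :=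
  ∀ f : C_c(ℂ, ℝ), Tendsto (fun k => ∫ z, f z ∂(ν k)) atTop (𝓝 (∫ z, f z ∂μ))

/-- Weak convergence tested against all bounded continuous functions. -/
def ConvergesNarrowly (ν : ℕ → Measure ℂ) (μ : Measure ℂ) : Prop :=
  ∀ f : ℂ →ᵇ ℝ, Tendsto (fun k => ∫ z, f z ∂(ν k)) atTop (𝓝 (∫ z, f z ∂μ))

/-- General type, for `α 0 = -1`: the numbers `α_i` are pairwise distinct (so those with `i ≠ 0`
differ from each other and from `-1`), and for `i ≠ 0` the number `-α_i` does not lie on the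
real half-line `(-∞, 1]`. -/
def IsGeneralType {B : ℕ} (α : Fin (B + 1) → ℂ) : Prop :=
  Function.Injective α ∧ ∀ i, i ≠ 0 → ∀ t : ℝ, t ≤ 1 → -α i ≠ (t : ℂ)

end

/-!
The polynomial `p = p_n` solves the hypergeometric equation. In the coordinate `t`, `z = z₀ exp t`,
and after the factor `exp (-n s t)` has been split off, this equation has the form
`∑ j, Q_j n ^ (-j) g⁽ʲ⁾ = 0`, where, up to errors of order `1 / n`, the `Q_j` at `t = 0` are the
coefficients of `z₀ ∏ (X + s + α_i) - (X + s) ∏ (X + s + β_j)` (`hyperP_ode`). The whole local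
analysis takes place at one Lebesgue point `z₀ ≠ 0` of the limiting Cauchy transform `C_μ`, with
`s = z₀ C_μ(z₀)`, so that the algebraic equation in question is `Q_0 = 0`.

*Slow growth.* Weak convergence gives convergence of the Cauchy transforms in `L¹` on bounded sets
(`ConvergesWeakly.tendsto_lintegral_cauchyTransform`). Hence near a Lebesgue point the logarithmic
derivative of `g(t) = p(z₀ exp t) exp (-n s t)` is `o(n)` in mean, and `g` grows at most like
`exp (ε n R)` on a disc of radius `R`: five lines on which the mean is small bound a rectangle joined
to its centre, and the maximum principle applies (`exists_norm_le_exp_mul_norm`).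

*Weighted estimate.* If the coefficients of order below `m` are dominated by the one of order `m`,
then `g` is controlled, in a weighted sup norm, by its derivatives of order below `m` at the centre.
Derivatives of order above `m` are absorbed by Cauchy estimates on circles of radius comparable to
`1 / n`, and slow growth makes the boundary of the disc irrelevant (`weighted_jet_bound`).
With `m = 0` the function `g` would vanish, so `Q_0 = 0` (`limitCoeff_zero_eq_zero`). If `s` is a
simple zero, `m = 1` yields `|g'(0)| ≤ C R n |g(0)|` for every small `R`, which is convergence of the
Cauchy transforms at `z₀` (`tendsto_cauchyTransform_of_simple`). Outside a finite set of points `z₀`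
the only other case is that `s` is a common zero of the two products
(`exists_finite_exceptional`). Then the estimate is uniform in `n`, the number of zeros of `p_n` near
`z₀` is bounded (`exists_card_roots_le_of_common_zero`), and the Borel–Cantelli lemma gives convergence
almost everywhere near `z₀` (`ConvergesWeakly.ae_tendsto_cauchyTransform_of_card_le`).

*General type.* Read from the top coefficient downwards, `p_n` is a constant multiple of `z ^ n` times
`∑ C(n, m) y ^ m ∏ v_j(m) / u_j(m)` with `y = -1 / z`, in which `v_j` and `u_j` are falling factorials
of numbers of order at most `n`, and those in the denominators keep a distance of order `n` from
`0, …, n`. By Schur–Szegő composition (`eval_binomPoly_mul_ne_zero`) it suffices to treat one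
multiplier at a time, and contiguity relations show that a factor in the numerator has its zeros at
distance at least of the order `1 / n` from the origin, one in the denominator at least of the order
`n`. There are equally many of both, so the zeros of `p_n` stay bounded
(`exists_bound_roots_hyperP`), and Prokhorov's theorem applies.
-/

/-! ### Slowly growing solutions of linear differential equations with a large parameter -/

/-- If `G 0` is entire with successive derivatives `G 1, G 2, …`, then Cauchy's estimate on a circle
bounds `G (m + i)` by `G m`. -/
theorem norm_derivSeq_le_of_sphere {G : ℕ → ℂ → ℂ} (hG : ∀ k t, HasDerivAt (G k) (G (k + 1) t) t)
    (m i : ℕ) {t : ℂ} {ρ S : ℝ} (hρ : 0 < ρ) (hS : ∀ u, ‖u - t‖ = ρ → ‖G m u‖ ≤ S) :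
    ‖G (m + i) t‖ ≤ i.factorial * S / ρ ^ i := by
  have h : ∀ i, iteratedDeriv i (G m) = G (m + i) := by
    intro i
    induction i with
    | zero => simp
    | succ i ih =>
      rw [iteratedDeriv_succ, ih]
      funext u
      exact (hG _ u).deriv
  rw [← h]
  refine Complex.norm_iteratedDeriv_le_of_forall_mem_sphere_norm_le i hρ ?_ ?_
  · exact Differentiable.diffContOnCl fun u => (hG m u).differentiableAt
  · intro u hu
    exact hS u (by simpa [dist_eq_norm] using hu)

/-- Integrating an exponential bound on `G (k + 1)` along the segment from `0` to `t`: the integral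
of `exp (w + a * (x - ‖t‖))` over `x` in `[0, ‖t‖]` is at most `exp w / a`. -/
theorem norm_derivSeq_le_of_segment {G : ℕ → ℂ → ℂ} (hG : ∀ k t, HasDerivAt (G k) (G (k + 1) t) t)
    (k : ℕ) {t : ℂ} {a w S : ℝ} (ha : 0 < a) (hS : 0 ≤ S)
    (h : ∀ s ∈ Set.Icc (0 : ℝ) 1, ‖G (k + 1) (s * t)‖ ≤ S * Real.exp (w - a * ‖t‖ * (1 - s))) :
    ‖G k t‖ ≤ ‖G k 0‖ + S / a * Real.exp w := by
  have key := image_norm_le_of_norm_deriv_right_le_deriv_boundary (a := 0) (b := 1)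
    (f := fun s : ℝ => G k (s * t)) (f' := fun s : ℝ => G (k + 1) (s * t) * t)
    (B := fun s : ℝ => ‖G k 0‖ + S / a * Real.exp (w - a * ‖t‖ * (1 - s)))
    (B' := fun s : ℝ => S * Real.exp (w - a * ‖t‖ * (1 - s)) * ‖t‖)
    (by
      have : Continuous (G k) := continuous_iff_continuousAt.2 fun u => (hG k u).continuousAt
      fun_prop)
    (by
      intro s _
      have h1 : HasDerivAt (fun s : ℝ => (s : ℂ) * t) t s := by
        simpa using (Complex.ofRealCLM.hasDerivAt (x := s)).mul_const t
      exact ((hG k (s * t)).comp s h1).hasDerivWithinAt)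
    (by
      simp only [Complex.ofReal_zero, zero_mul]
      have : 0 ≤ S / a * Real.exp (w - a * ‖t‖ * (1 - 0)) := by positivity
      linarith)
    (by
      intro s
      have h1 : HasDerivAt (fun s : ℝ => w - a * ‖t‖ * (1 - s)) (a * ‖t‖) s := by
        have := (((hasDerivAt_id s).const_sub 1).const_mul (a * ‖t‖)).const_sub w
        simpa using this
      have h2 := (h1.exp.const_mul (S / a)).const_add (‖G k 0‖)
      refine h2.congr_deriv ?_
      field_simp)
    (by
      intro s hs
      rw [norm_mul]
      exact mul_le_mul_of_nonneg_right (h s ⟨hs.1, hs.2.le⟩) (norm_nonneg _))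
  have := key (x := 1) (by simp)
  simpa using this

/-- The weight `exp (ω ‖t‖)` that measures solutions: slope `a` near the centre, slope `a + b`
outside the disc of radius `R / 2`. -/
noncomputable def radialWeight (a b R x : ℝ) : ℝ := a * x + b * max (x - R / 2) 0

theorem continuous_radialWeight (a b R : ℝ) : Continuous (radialWeight a b R) := by
  unfold radialWeight; fun_prop

theorem radialWeight_add_le {a b R x y : ℝ} (hb : 0 ≤ b) (hxy : x ≤ y) :
    radialWeight a b R y ≤ radialWeight a b R x + (a + b) * (y - x) := by
  unfold radialWeight
  have : max (y - R / 2) 0 ≤ max (x - R / 2) 0 + (y - x) := by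
    rcases le_total (y - R / 2) 0 with h | h
    · rw [max_eq_right h]; have := le_max_right (x - R / 2) 0; linarith
    · rw [max_eq_left h]; have := le_max_left (x - R / 2) 0; linarith
  nlinarith

theorem radialWeight_mono {a b R x y : ℝ} (ha : 0 ≤ a) (hb : 0 ≤ b) (hxy : x ≤ y) :
    radialWeight a b R x ≤ radialWeight a b R y := by
  unfold radialWeight
  gcongr

theorem radialWeight_le_sub {a b R x y : ℝ} (hb : 0 ≤ b) (hxy : x ≤ y) :
    radialWeight a b R x ≤ radialWeight a b R y - a * (y - x) := by
  unfold radialWeight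
  have : b * max (x - R / 2) 0 ≤ b * max (y - R / 2) 0 := by gcongr
  linarith

theorem exists_weighted_sup {g : ℂ → ℂ} (hg : Continuous g) {ω : ℝ → ℝ} (hω : Continuous ω)
    {R : ℝ} (hR : 0 ≤ R) :
    ∃ W, 0 ≤ W ∧ (∀ t, ‖t‖ ≤ R → ‖g t‖ ≤ W * Real.exp (ω ‖t‖)) ∧
      ∃ t, ‖t‖ ≤ R ∧ ‖g t‖ = W * Real.exp (ω ‖t‖) := by
  obtain ⟨u, hu, hmax⟩ := (isCompact_closedBall (0 : ℂ) R).exists_isMaxOn ⟨0, by simpa using hR⟩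
    (f := fun t => ‖g t‖ * Real.exp (-ω ‖t‖)) (by fun_prop)
  have e : ∀ x : ℝ, Real.exp (-x) * Real.exp x = 1 := fun x => by
    rw [← Real.exp_add]; simp
  refine ⟨‖g u‖ * Real.exp (-ω ‖u‖), by positivity, ?_, u, by simpa using hu, ?_⟩
  · intro t ht
    have h := hmax (show t ∈ Metric.closedBall 0 R by simpa using ht)
    simp only [Set.mem_ofPred_eq] at h
    calc ‖g t‖ = ‖g t‖ * Real.exp (-ω ‖t‖) * Real.exp (ω ‖t‖) := by rw [mul_assoc, e, mul_one]
      _ ≤ _ := by gcongr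
  · rw [mul_assoc, e, mul_one]

/-- The constant that beats all sums of Cauchy estimates in an equation of order `A` with
coefficients bounded by `C`. -/
noncomputable def cauchyScale (A : ℕ) (C : ℝ) : ℝ := 6 * (A + 1) * C * A.factorial

theorem one_le_cauchyScale (A : ℕ) {C : ℝ} (hC : 1 ≤ C) : 1 ≤ cauchyScale A C := by
  unfold cauchyScale
  have h1 : (1 : ℝ) ≤ A.factorial := by exact_mod_cast A.factorial_pos
  have h2 : (1 : ℝ) ≤ (A : ℝ) + 1 := by have : (0 : ℝ) ≤ A := by positivity
                                        linarith
  have h3 : (1 : ℝ) ≤ 6 * (A + 1) := by linarith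
  have h4 : (1 : ℝ) ≤ 6 * (A + 1) * C := one_le_mul_of_one_le_of_one_le h3 hC
  exact one_le_mul_of_one_le_of_one_le h4 h1

/-- Terms of order above `m`, at a point whose circle of radius `K / n` lies in the disc where
`G m` is bounded by `W` times the weight. -/
theorem tail_term_le_of_interior {G : ℕ → ℂ → ℂ} (hG : ∀ k t, HasDerivAt (G k) (G (k + 1) t) t)
    {A m i : ℕ} (hi : i ≤ A) (hi1 : 1 ≤ i) {C n a b R W : ℝ} (hC : 1 ≤ C) (hn : 0 < n)
    (ha : 0 ≤ a) (hb : 0 ≤ b) (hab : (a + b) * (cauchyScale A C / n) ≤ 1) (hW : 0 ≤ W)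
    (hWm : ∀ t, ‖t‖ ≤ R → ‖G m t‖ ≤ W * Real.exp (radialWeight a b R ‖t‖))
    {t : ℂ} (ht : ‖t‖ + cauchyScale A C / n ≤ R) :
    C / n ^ i * ‖G (m + i) t‖ ≤ W * Real.exp (radialWeight a b R ‖t‖) / (2 * (A + 1)) := by
  set K := cauchyScale A C with hK
  have hK1 : 1 ≤ K := one_le_cauchyScale A hC
  have hKn : 0 < K / n := by positivity
  set E := Real.exp (radialWeight a b R ‖t‖) with hE
  have h1 : ‖G (m + i) t‖ ≤ i.factorial * (W * (E * 3)) / (K / n) ^ i := by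
    refine norm_derivSeq_le_of_sphere hG m i hKn fun u hu => ?_
    have hu1 : ‖u‖ ≤ ‖t‖ + K / n := by
      calc ‖u‖ = ‖t + (u - t)‖ := by ring_nf
        _ ≤ _ := (norm_add_le _ _).trans (by rw [hu])
    refine (hWm u (hu1.trans ht)).trans ?_
    gcongr
    have h2 : radialWeight a b R ‖u‖ ≤ radialWeight a b R ‖t‖ + 1 :=
      (radialWeight_mono ha hb hu1).trans
        ((radialWeight_add_le (x := ‖t‖) hb (by linarith)).trans (by
          rw [add_sub_cancel_left]; linarith))
    calc Real.exp (radialWeight a b R ‖u‖) ≤ Real.exp (radialWeight a b R ‖t‖ + 1) := by gcongr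
      _ = E * Real.exp 1 := by rw [Real.exp_add]
      _ ≤ E * 3 := by
          gcongr
          linarith [Real.exp_one_lt_d9]
  have hfac : (i.factorial : ℝ) ≤ A.factorial := by exact_mod_cast Nat.factorial_le hi
  have hKi : K ≤ K ^ i := le_self_pow₀ hK1 (by omega)
  calc C / n ^ i * ‖G (m + i) t‖ ≤ C / n ^ i * (i.factorial * (W * (E * 3)) / (K / n) ^ i) := by
        gcongr
    _ = C * (i.factorial * (W * (E * 3))) / K ^ i := by
        rw [div_pow]; field_simp
    _ ≤ C * (A.factorial * (W * (E * 3))) / K := by gcongr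
    _ = W * E / (2 * (A + 1)) := by
        have : (A.factorial : ℝ) ≠ 0 := by positivity
        rw [hK, cauchyScale]
        have hC0 : C ≠ 0 := by positivity
        field_simp
        ring

/-- The algebra behind the weighted estimate: `W k` bounds `G k` in the weighted norm, `J k` is
the value of `G k` at the centre, and the constant `(4 * C + 4) * l` is the slope of the weight. -/
theorem le_of_jet_recursion {C l : ℝ} (hC : 1 ≤ C) (hl : 1 ≤ l) {m : ℕ} (hmpos : 0 < m)
    {W J : ℕ → ℝ} (hW0 : ∀ k, 0 ≤ W k) (hstep : ∀ k, W k ≤ J k + W (k + 1) / ((4 * C + 4) * l))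
    (hWm : W m ≤ 2 * C * ∑ k ∈ Finset.range m, l ^ (m - k) * W k + W 0 / 2) :
    W 0 ≤ 2 * ∑ k ∈ Finset.range m, J k / l ^ k := by
  have hl0 : 0 < l := by linarith
  set X := ∑ k ∈ Finset.range m, W k / l ^ k with hX
  have hX0 : W 0 ≤ X := by
    have := Finset.single_le_sum (f := fun k => W k / l ^ k) (s := Finset.range m)
      (fun k _ => div_nonneg (hW0 k) (by positivity)) (Finset.mem_range.2 hmpos)
    simpa using this
  have hXm : W m / l ^ m ≤ (2 * C + 1) * X := by
    rw [div_le_iff₀ (by positivity)]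
    have h1 : ∑ k ∈ Finset.range m, l ^ (m - k) * W k = X * l ^ m := by
      rw [hX, Finset.sum_mul]
      refine Finset.sum_congr rfl fun k hk => ?_
      have h3 : l ^ m = l ^ (m - k) * l ^ k := by
        rw [← pow_add, Nat.sub_add_cancel (Finset.mem_range.1 hk).le]
      rw [h3]
      field_simp
    rw [h1] at hWm
    have h2 : X ≤ X * l ^ m :=
      le_mul_of_one_le_right ((hW0 0).trans hX0) (one_le_pow₀ hl)
    nlinarith [hW0 0]
  have hsum : X ≤ ∑ k ∈ Finset.range m, J k / l ^ k +
      (∑ k ∈ Finset.range m, W (k + 1) / l ^ (k + 1)) / (4 * C + 4) := by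
    rw [hX, Finset.sum_div, ← Finset.sum_add_distrib]
    refine Finset.sum_le_sum fun k _ => ?_
    calc W k / l ^ k ≤ (J k + W (k + 1) / ((4 * C + 4) * l)) / l ^ k := by gcongr; exact hstep k
      _ = _ := by rw [pow_succ]; field_simp
  have hshift : ∑ k ∈ Finset.range m, W (k + 1) / l ^ (k + 1) ≤ X + W m / l ^ m := by
    have h1 := Finset.sum_range_succ' (fun k => W k / l ^ k) m
    have h2 := Finset.sum_range_succ (fun k => W k / l ^ k) m
    have h3 : 0 ≤ W 0 / l ^ 0 := div_nonneg (hW0 0) (by positivity)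
    linarith
  have hL0 : 0 < 4 * C + 4 := by linarith
  have h4 : (∑ k ∈ Finset.range m, W (k + 1) / l ^ (k + 1)) / (4 * C + 4) ≤ X / 2 := by
    rw [div_le_iff₀ hL0]
    linarith
  linarith

set_option maxHeartbeats 1000000 in
/-- A solution of an equation whose coefficients are dominated by the term of order `m` is
controlled, in the weighted sup norm, by its derivatives of order below `m` at the centre. The
hypothesis `hslow` says that the solution grows more slowly than the weight, which makes the
boundary of the disc irrelevant. -/
theorem weighted_jet_bound (A : ℕ) (C : ℝ) (hC : 1 ≤ C) :
    ∃ κ > 0, ∃ L ≥ 1, ∀ R, 0 < R → R ≤ 1 → ∃ n₀ : ℝ, ∀ n ≥ n₀, ∀ l, 1 ≤ l → L * l ≤ κ * n →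
      ∀ m ≤ A, ∀ (G c : ℕ → ℂ → ℂ), (∀ k t, HasDerivAt (G k) (G (k + 1) t) t) →
      (∀ t, ‖t‖ ≤ R → ∑ k ∈ Finset.range (A + 1), c k t * G k t = 0) →
      (∀ t, ‖t‖ ≤ R → ∀ k < m, ‖c k t‖ ≤ C * l ^ (m - k)) →
      (∀ t, ‖t‖ ≤ R → 1 ≤ ‖c m t‖) →
      (∀ t, ‖t‖ ≤ R → ∀ k, m < k → k ≤ A → ‖c k t‖ ≤ C / n ^ (k - m)) →
      ∀ M t₁, (∀ t, ‖t‖ ≤ 2 * R → ‖G 0 t‖ ≤ M) → ‖t₁‖ ≤ R / 4 →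
      M ≤ Real.exp (κ * n * R / 4) * ‖G 0 t₁‖ →
      (∀ t, ‖t‖ ≤ R / 2 → ‖G 0 t‖ ≤
        2 * (∑ k ∈ Finset.range m, ‖G k 0‖ / l ^ k) * Real.exp (L * l * ‖t‖)) ∧
      (m = 1 → ‖G 1 0‖ ≤ 2 * (2 * C + 1) * l * ‖G 0 0‖) := by
  set K := cauchyScale A C with hK
  have hK1 : 1 ≤ K := one_le_cauchyScale A hC
  set κ : ℝ := 1 / (2 * K) with hκ
  have hκ0 : 0 < κ := by positivity
  set L : ℝ := 4 * C + 4 with hL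
  refine ⟨κ, hκ0, L, by linarith, fun R hR hR1 => ?_⟩
  set D : ℝ := C * A * A.factorial / R ^ A with hD
  have hD0 : 0 ≤ D := by positivity
  refine ⟨max 1 (max (4 * K / R) (64 * D / (κ * R))), ?_⟩
  intro n hn l hl hLl m hm G c hG hode hc_lt hc_m hc_gt M t₁ hM ht₁ hslow
  have hn1 : 1 ≤ n := (le_max_left _ _).trans hn
  have hn2 : 4 * K / R ≤ n := ((le_max_left _ _).trans (le_max_right _ _)).trans hn
  have hn3 : 64 * D / (κ * R) ≤ n := ((le_max_right _ _).trans (le_max_right _ _)).trans hn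
  have hn0 : 0 < n := by linarith
  have hKn : K / n ≤ R / 4 := by
    rw [div_le_iff₀ hR] at hn2
    rw [div_le_iff₀ hn0]; linarith
  have hl0 : 0 < l := by linarith
  set a := L * l with ha_def
  set b := κ * n with hb_def
  have ha : 0 < a := by positivity
  have hb : 0 < b := by positivity
  have hab : (a + b) * (K / n) ≤ 1 := by
    calc (a + b) * (K / n) ≤ (b + b) * (K / n) := by gcongr
      _ = 1 := by rw [hb_def, hκ]; field_simp; norm_num
  set ω := radialWeight a b R with hω
  have hcont : ∀ k, Continuous (G k) := fun k =>
    continuous_iff_continuousAt.2 fun u => (hG k u).continuousAt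
  choose W hW0 hW hWmax using fun k => exists_weighted_sup (hcont k)
    (continuous_radialWeight a b R) hR.le
  have hM0 : 0 ≤ M := (norm_nonneg _).trans (hM 0 (by simpa using hR.le))
  -- the contribution of points within `K / n` of the boundary
  set Bd := D * M * Real.exp (-ω (R - K / n)) with hBd
  -- slow growth: near the boundary `M` is small against `W 0` times the weight, whose slope
  -- there is `a + b`
  have hBdW : Bd ≤ W 0 / 4 := by
    have h1 : a * (R / 4) + b * R / 2 - 1 ≤ ω (R - K / n) := by
      have h2 : b * (R - K / n - R / 2) ≤ b * max (R - K / n - R / 2) 0 := by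
        gcongr; exact le_max_left _ _
      have h3 : a * (R / 4) ≤ a * (R - K / n) := by gcongr; linarith
      have h4 : b * (K / n) ≤ 1 := by
        refine le_trans ?_ hab
        gcongr; linarith
      simp only [hω, radialWeight]
      nlinarith
    have h2 : ‖G 0 t₁‖ ≤ W 0 * Real.exp (a * (R / 4)) := by
      refine (hW 0 t₁ (by linarith)).trans ?_
      gcongr
      · exact hW0 0
      · rw [radialWeight, max_eq_right (by linarith)]
        have : a * ‖t₁‖ ≤ a * (R / 4) := by gcongr
        linarith
    have h3 : 16 * D ≤ b * R / 4 := by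
      rw [div_le_iff₀ (by positivity)] at hn3
      rw [hb_def]; nlinarith
    have h4 : 16 * D * Real.exp (1 - b * R / 4) ≤ Real.exp 1 := by
      have : b * R / 4 ≤ Real.exp (b * R / 4) := by linarith [Real.add_one_le_exp (b * R / 4)]
      rw [Real.exp_sub, mul_div_assoc', div_le_iff₀ (Real.exp_pos _)]
      have h5 := h3.trans this
      have := Real.exp_pos 1
      nlinarith
    have hexp : Real.exp (b * R / 4) * Real.exp (a * (R / 4)) * Real.exp (-ω (R - K / n))
        ≤ Real.exp (1 - b * R / 4) := by
      rw [← Real.exp_add, ← Real.exp_add]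
      gcongr; linarith
    have h6 : Bd ≤ D * (W 0 * Real.exp (1 - b * R / 4)) := by
      calc Bd ≤ D * (Real.exp (b * R / 4) * (W 0 * Real.exp (a * (R / 4)))) *
            Real.exp (-ω (R - K / n)) := by
            rw [hBd]
            gcongr
            exact hslow.trans (by gcongr)
        _ = D * (W 0 * (Real.exp (b * R / 4) * Real.exp (a * (R / 4)) *
              Real.exp (-ω (R - K / n)))) := by ring
        _ ≤ _ := by
            have := hW0 0
            gcongr
    have h7 : D * Real.exp (1 - b * R / 4) ≤ 1 / 4 := by linarith [Real.exp_one_lt_d9]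
    calc Bd ≤ W 0 * (D * Real.exp (1 - b * R / 4)) := h6.trans (le_of_eq (by ring))
      _ ≤ W 0 * (1 / 4) := by
          have := hW0 0
          gcongr
      _ = W 0 / 4 := by ring
  -- integration from the centre gains the slope `a` of the weight
  have hstep : ∀ k, W k ≤ ‖G k 0‖ + W (k + 1) / a := by
    intro k
    obtain ⟨t, ht, hmax⟩ := hWmax k
    have h1 := norm_derivSeq_le_of_segment hG k (t := t) (w := ω ‖t‖) ha (hW0 (k + 1)) (by
      intro s hs
      have hst : ‖(s : ℂ) * t‖ = s * ‖t‖ := by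
        rw [norm_mul, Complex.norm_real, Real.norm_of_nonneg hs.1]
      have hst' : s * ‖t‖ ≤ ‖t‖ := mul_le_of_le_one_left (norm_nonneg _) hs.2
      refine (hW (k + 1) _ (by rw [hst]; linarith)).trans ?_
      gcongr
      · exact hW0 _
      · rw [hst]
        refine (radialWeight_le_sub hb.le hst').trans (le_of_eq ?_)
        rw [hω]; ring)
    have hω0 : 0 ≤ ω ‖t‖ := by
      rw [hω, radialWeight]; positivity
    have h2 : 1 ≤ Real.exp (ω ‖t‖) := Real.one_le_exp hω0
    rw [hmax] at h1
    have h3 : W k * Real.exp (ω ‖t‖) ≤ (‖G k 0‖ + W (k + 1) / a) * Real.exp (ω ‖t‖) := by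
      refine h1.trans ?_
      have := norm_nonneg (G k 0)
      nlinarith
    exact le_of_mul_le_mul_right h3 (by positivity)
  -- the equation is solved for its term of order `m` at the point where `W m` is attained
  have hWm : W m ≤ 2 * C * ∑ k ∈ Finset.range m, l ^ (m - k) * W k + W 0 / 2 := by
    obtain ⟨t, ht, hmax⟩ := hWmax m
    have hsplit : ‖G m t‖ ≤ ∑ k ∈ Finset.range m, C * l ^ (m - k) * ‖G k t‖ +
        ∑ k ∈ Finset.Ioc m A, C / n ^ (k - m) * ‖G k t‖ := by
      have hset : Finset.range (A + 1) = insert m (Finset.range m ∪ Finset.Ioc m A) := by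
        ext x; simp; omega
      have h0 := hode t ht
      rw [hset, Finset.sum_insert (by simp), Finset.sum_union (by
        rw [Finset.disjoint_left]; intro x; simp; omega)] at h0
      have h1 : c m t * G m t = -(∑ k ∈ Finset.range m, c k t * G k t +
          ∑ k ∈ Finset.Ioc m A, c k t * G k t) := by
        linear_combination h0
      calc ‖G m t‖ ≤ ‖c m t‖ * ‖G m t‖ := le_mul_of_one_le_left (norm_nonneg _) (hc_m t ht)
        _ = ‖c m t * G m t‖ := (norm_mul _ _).symm
        _ ≤ _ := by
          rw [h1, norm_neg]
          refine (norm_add_le _ _).trans (add_le_add ?_ ?_)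
          · refine (norm_sum_le _ _).trans (Finset.sum_le_sum fun k hk => ?_)
            rw [norm_mul]
            gcongr
            exact hc_lt t ht k (by simpa using hk)
          · refine (norm_sum_le _ _).trans (Finset.sum_le_sum fun k hk => ?_)
            rw [norm_mul]
            simp only [Finset.mem_Ioc] at hk
            gcongr
            exact hc_gt t ht k hk.1 hk.2
    set E := Real.exp (ω ‖t‖) with hE
    have hE0 : 0 < E := Real.exp_pos _
    have hlow : ∑ k ∈ Finset.range m, C * l ^ (m - k) * ‖G k t‖ ≤
        C * (∑ k ∈ Finset.range m, l ^ (m - k) * W k) * E := by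
      rw [Finset.mul_sum, Finset.sum_mul]
      refine Finset.sum_le_sum fun k _ => ?_
      have := hW k t ht
      calc C * l ^ (m - k) * ‖G k t‖ ≤ C * l ^ (m - k) * (W k * E) := by gcongr
        _ = _ := by ring
    have hcard : ((Finset.Ioc m A).card : ℝ) ≤ A := by
      rw [Nat.card_Ioc]; exact_mod_cast Nat.sub_le _ _
    have hhigh : ∑ k ∈ Finset.Ioc m A, C / n ^ (k - m) * ‖G k t‖ ≤ W m * E / 2 + Bd * E := by
      -- inside, Cauchy estimates on circles of radius `K / n` cost at most half of `W m`;
      -- near the boundary, Cauchy estimates on the circle of radius `R` are enough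
      by_cases hin : ‖t‖ + K / n ≤ R
      · have h1 : ∀ k ∈ Finset.Ioc m A, C / n ^ (k - m) * ‖G k t‖ ≤
            W m * E / (2 * (A + 1)) := by
          intro k hk
          simp only [Finset.mem_Ioc] at hk
          have := tail_term_le_of_interior hG (A := A) (m := m) (i := k - m) (by omega) (by omega)
            hC hn0 ha.le hb.le hab (hW0 m) (hW m) hin
          rwa [Nat.add_sub_cancel' hk.1.le] at this
        refine (Finset.sum_le_card_nsmul _ _ _ h1).trans ?_
        rw [nsmul_eq_mul]
        have h2 : 0 ≤ W m * E := mul_nonneg (hW0 m) hE0.le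
        have h3 : 0 ≤ Bd * E := by positivity
        calc ((Finset.Ioc m A).card : ℝ) * (W m * E / (2 * (A + 1)))
            ≤ (A + 1) * (W m * E / (2 * (A + 1))) := by gcongr; linarith
          _ = W m * E / 2 := by field_simp
          _ ≤ _ := by linarith
      · have h1 : ∀ k ∈ Finset.Ioc m A, C / n ^ (k - m) * ‖G k t‖ ≤
            C * (A.factorial * M / R ^ A) := by
          intro k hk
          simp only [Finset.mem_Ioc] at hk
          have h2 := norm_derivSeq_le_of_sphere hG 0 k (t := t) hR (S := M) (by
            intro u hu
            refine hM u ?_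
            calc ‖u‖ = ‖t + (u - t)‖ := by ring_nf
              _ ≤ ‖t‖ + ‖u - t‖ := norm_add_le _ _
              _ ≤ _ := by rw [hu]; linarith)
          rw [zero_add] at h2
          have hfac : (k.factorial : ℝ) ≤ A.factorial := by exact_mod_cast Nat.factorial_le hk.2
          have hRk : R ^ A ≤ R ^ k := pow_le_pow_of_le_one hR.le hR1 hk.2
          have h3 : C / n ^ (k - m) ≤ C := div_le_self (by linarith) (one_le_pow₀ hn1)
          calc C / n ^ (k - m) * ‖G k t‖ ≤ C * (k.factorial * M / R ^ k) := by gcongr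
            _ ≤ _ := by gcongr
        refine (Finset.sum_le_card_nsmul _ _ _ h1).trans ?_
        rw [nsmul_eq_mul]
        have h2 : 0 ≤ W m * E := mul_nonneg (hW0 m) hE0.le
        have h3 : 1 ≤ Real.exp (-ω (R - K / n)) * E := by
          rw [hE, ← Real.exp_add]
          refine Real.one_le_exp ?_
          have := radialWeight_mono (R := R) ha.le hb.le (x := R - K / n) (y := ‖t‖) (by linarith)
          linarith
        calc ((Finset.Ioc m A).card : ℝ) * (C * (A.factorial * M / R ^ A))
            ≤ A * (C * (A.factorial * M / R ^ A)) := by gcongr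
          _ = D * M * 1 := by rw [hD]; ring
          _ ≤ D * M * (Real.exp (-ω (R - K / n)) * E) := by gcongr
          _ = Bd * E := by rw [hBd]; ring
          _ ≤ _ := by linarith
    have hfin : W m * E ≤ (C * (∑ k ∈ Finset.range m, l ^ (m - k) * W k) + W m / 2 + Bd) * E := by
      rw [← hmax]
      refine hsplit.trans ((add_le_add hlow hhigh).trans (le_of_eq ?_))
      ring
    have := le_of_mul_le_mul_right hfin hE0
    linarith
  have hbound : W 0 ≤ 2 * ∑ k ∈ Finset.range m, ‖G k 0‖ / l ^ k := by
    rcases Nat.eq_zero_or_pos m with rfl | hmpos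
    · simp at hWm ⊢; linarith
    exact le_of_jet_recursion hC hl hmpos hW0 hstep hWm
  refine ⟨fun t ht => ?_, ?_⟩
  · refine (hW 0 t (by linarith)).trans ?_
    gcongr
    rw [radialWeight, max_eq_right (by linarith)]
    linarith
  · rintro rfl
    simp at hWm hbound
    have h1 : ‖G 1 0‖ ≤ W 1 := by
      have := hW 1 0 (by simpa using hR.le)
      have h2 : radialWeight a b R 0 = 0 := by
        rw [radialWeight, max_eq_right (by linarith)]; simp
      simpa [h2] using this
    have h3 : W 0 ≤ l * W 0 := le_mul_of_one_le_left (hW0 0) hl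
    have h4 : W 1 ≤ (2 * C + 1) * (l * W 0) := by nlinarith [hW0 0]
    calc ‖G 1 0‖ ≤ (2 * C + 1) * (l * W 0) := h1.trans h4
      _ ≤ (2 * C + 1) * (l * (2 * ‖G 0 0‖)) := by gcongr
      _ = _ := by ring

/-! ### Weak convergence and Cauchy transforms -/

/-- The Cauchy kernel `x⁻¹`, made continuous by truncating it inside the disc of radius `ρ`. -/
noncomputable def truncKernel (ρ : ℝ) (x : ℂ) : ℂ :=
  (starRingEnd ℂ) x * (((max ‖x‖ ρ) ^ 2 : ℝ) : ℂ)⁻¹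

theorem truncKernel_eq_inv {ρ : ℝ} {x : ℂ} (h : ρ ≤ ‖x‖) : truncKernel ρ x = x⁻¹ := by
  rw [truncKernel, max_eq_left h, Complex.inv_def x, Complex.normSq_eq_norm_sq]
  push_cast
  rfl

theorem norm_truncKernel (ρ : ℝ) (x : ℂ) : ‖truncKernel ρ x‖ = ‖x‖ / (max ‖x‖ ρ) ^ 2 := by
  rw [truncKernel, norm_mul, norm_inv, Complex.norm_real, RCLike.norm_conj, Real.norm_eq_abs,
    abs_of_nonneg (by positivity), div_eq_mul_inv]

theorem norm_truncKernel_le {ρ : ℝ} (hρ : 0 < ρ) (x : ℂ) : ‖truncKernel ρ x‖ ≤ ρ⁻¹ := by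
  rw [norm_truncKernel]
  have h1 : 0 < max ‖x‖ ρ := lt_max_of_lt_right hρ
  rw [div_le_iff₀ (by positivity), pow_two]
  have h2 : 1 ≤ ρ⁻¹ * max ‖x‖ ρ := by
    rw [← inv_mul_cancel₀ hρ.ne']
    gcongr
    exact le_max_right _ _
  calc ‖x‖ ≤ 1 * max ‖x‖ ρ := by rw [one_mul]; exact le_max_left _ _
    _ ≤ _ := by rw [← mul_assoc]; gcongr

theorem norm_truncKernel_le_inv {ρ : ℝ} (hρ : 0 < ρ) (x : ℂ) : ‖truncKernel ρ x‖ ≤ ‖x⁻¹‖ := by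
  rcases eq_or_ne x 0 with rfl | hx
  · simp [truncKernel]
  rw [norm_truncKernel, norm_inv]
  have h1 : 0 < max ‖x‖ ρ := lt_max_of_lt_right hρ
  have h2 : 0 < ‖x‖ := norm_pos_iff.2 hx
  rw [div_le_iff₀ (by positivity), ← div_eq_inv_mul, le_div_iff₀ h2, ← pow_two]
  gcongr
  exact le_max_left _ _

theorem continuous_truncKernel {ρ : ℝ} (hρ : 0 < ρ) : Continuous (truncKernel ρ) := by
  unfold truncKernel
  refine Complex.continuous_conj.mul (Continuous.inv₀ (by fun_prop) fun x => ?_)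
  have h1 : 0 < max ‖x‖ ρ := lt_max_of_lt_right hρ
  exact_mod_cast (pow_pos h1 2).ne'

theorem tendsto_truncKernel_cocompact {ρ : ℝ} (hρ : 0 < ρ) (z : ℂ) :
    Tendsto (fun ζ => truncKernel ρ (z - ζ)) (cocompact ℂ) (𝓝 0) := by
  have h1 : Tendsto (fun ζ : ℂ => ‖(z - ζ)⁻¹‖) (cocompact ℂ) (𝓝 0) := by
    have h2 : Tendsto (fun ζ : ℂ => z - ζ) (cocompact ℂ) (cocompact ℂ) :=
      (Homeomorph.subLeft z).isClosedEmbedding.tendsto_cocompact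
    have h3 := (tendsto_inv₀_cobounded (α := ℂ)).norm
    rw [Metric.cobounded_eq_cocompact, norm_zero] at h3
    exact h3.comp h2
  exact squeeze_zero_norm (fun ζ => norm_truncKernel_le_inv hρ _) h1

/-- The error of the truncation is at most `2 ‖x⁻¹‖` on the disc of radius `ρ`, and zero outside. -/
theorem enorm_inv_sub_truncKernel_le {ρ : ℝ} (hρ : 0 < ρ) (x : ℂ) :
    ‖x⁻¹ - truncKernel ρ x‖ₑ ≤ (Metric.ball 0 ρ).indicator (fun x : ℂ => 2 * ‖x⁻¹‖ₑ) x := by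
  by_cases hx : x ∈ Metric.ball (0 : ℂ) ρ
  · rw [Set.indicator_of_mem hx, two_mul]
    refine (enorm_sub_le).trans (add_le_add le_rfl ?_)
    rw [enorm_le_iff_norm_le]
    exact norm_truncKernel_le_inv hρ x
  · rw [Set.indicator_of_notMem hx, truncKernel_eq_inv (by simpa using hx)]
    simp

theorem locallyIntegrable_inv : LocallyIntegrable (fun x : ℂ => x⁻¹) := by
  refine locallyIntegrable_of_norm_le_rpow (C := 1) (α := 1) ?_ ?_ ?_ ?_
  · simp [Complex.finrank_real_complex]
  · rw [Complex.finrank_real_complex]; norm_num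
  · refine Eventually.of_forall fun x => ?_
    rw [norm_inv, Real.rpow_neg_one, one_mul]
  · exact (measurable_inv).aestronglyMeasurable

/-- `∫ ‖x⁻¹‖` over the disc of radius `ρ`, doubled: the size of the truncation error. -/
noncomputable def truncError (ρ : ℝ) : ℝ≥0∞ := ∫⁻ x in Metric.ball (0 : ℂ) ρ, 2 * ‖x⁻¹‖ₑ

theorem truncError_lt_top (ρ : ℝ) : truncError ρ < ∞ := by
  have h := (locallyIntegrable_inv.integrableOn_isCompact (isCompact_closedBall (0 : ℂ) ρ)).mono_set
    Metric.ball_subset_closedBall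
  rw [truncError, lintegral_const_mul _ (by fun_prop)]
  exact ENNReal.mul_lt_top (by simp) h.2

theorem tendsto_truncError : Tendsto truncError (𝓝[>] 0) (𝓝 0) := by
  have h1 : Tendsto (fun ρ : ℝ => (volume.restrict (Metric.ball (0 : ℂ) 1))
      (Metric.ball (0 : ℂ) ρ)) (𝓝[>] 0) (𝓝 0) := by
    have h2 : Tendsto (fun ρ : ℝ => volume (Metric.ball (0 : ℂ) ρ)) (𝓝[>] 0) (𝓝 0) := by
      simp only [Complex.volume_ball]
      have h3 : Tendsto (fun ρ : ℝ => ENNReal.ofReal ρ ^ 2 * NNReal.pi) (𝓝 0)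
          (𝓝 (ENNReal.ofReal 0 ^ 2 * NNReal.pi)) := by
        refine ENNReal.Tendsto.mul_const ?_ (by simp)
        exact (ENNReal.continuous_pow 2).continuousAt.tendsto.comp
          (ENNReal.continuous_ofReal.tendsto 0)
      simpa using h3.mono_left nhdsWithin_le_nhds
    exact tendsto_of_tendsto_of_tendsto_of_le_of_le tendsto_const_nhds h2 (fun _ => zero_le)
      fun ρ => Measure.restrict_apply_le _ _
  have h4 := tendsto_setLIntegral_zero (μ := volume.restrict (Metric.ball (0 : ℂ) 1))
    (f := fun x : ℂ => 2 * ‖x⁻¹‖ₑ) (truncError_lt_top 1).ne h1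
  refine h4.congr' ?_
  have h5 : ∀ᶠ ρ : ℝ in 𝓝[>] 0, ρ ≤ 1 :=
    (eventually_le_nhds (by norm_num)).filter_mono nhdsWithin_le_nhds
  filter_upwards [h5] with ρ hρ
  rw [truncError, Measure.restrict_restrict Metric.isOpen_ball.measurableSet,
    Set.inter_eq_left.2 (Metric.ball_subset_ball hρ)]

/-- By Tonelli's theorem, the total truncation error is at most the mass of `ν` times
`truncError ρ`. -/
theorem lintegral_lintegral_inv_sub_truncKernel_le {ρ : ℝ} (hρ : 0 < ρ) (ν : Measure ℂ)
    [IsFiniteMeasure ν] :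
    ∫⁻ z, ∫⁻ ζ, ‖(z - ζ)⁻¹ - truncKernel ρ (z - ζ)‖ₑ ∂ν ≤ ν Set.univ * truncError ρ := by
  have hm := (continuous_truncKernel hρ).measurable
  have hmeas : Measurable fun x : ℂ => ‖x⁻¹ - truncKernel ρ x‖ₑ := by fun_prop
  rw [lintegral_lintegral_swap (by
    exact (hmeas.comp (measurable_fst.sub measurable_snd)).aemeasurable)]
  have h1 : ∀ ζ : ℂ, ∫⁻ z, ‖(z - ζ)⁻¹ - truncKernel ρ (z - ζ)‖ₑ ≤ truncError ρ := by
    intro ζ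
    rw [lintegral_sub_right_eq_self (fun x : ℂ => ‖x⁻¹ - truncKernel ρ x‖ₑ) ζ, truncError,
      ← lintegral_indicator Metric.isOpen_ball.measurableSet]
    exact lintegral_mono fun x => enorm_inv_sub_truncKernel_le hρ x
  calc _ ≤ ∫⁻ _, truncError ρ ∂ν := lintegral_mono h1
    _ = _ := by rw [lintegral_const, mul_comm]

theorem integrable_truncKernel {ρ : ℝ} (hρ : 0 < ρ) (ν : Measure ℂ) [IsFiniteMeasure ν] (z : ℂ) :
    Integrable (fun ζ => truncKernel ρ (z - ζ)) ν := by
  refine Integrable.of_bound ?_ ρ⁻¹ (Eventually.of_forall fun ζ => norm_truncKernel_le hρ _)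
  exact ((continuous_truncKernel hρ).comp (by fun_prop)).aestronglyMeasurable

theorem ae_integrable_cauchyKernel (ν : Measure ℂ) [IsFiniteMeasure ν] :
    ∀ᵐ z : ℂ, Integrable (fun ζ : ℂ => (z - ζ)⁻¹) ν := by
  have h1 := lintegral_lintegral_inv_sub_truncKernel_le one_pos ν
  have hm := (continuous_truncKernel one_pos).measurable
  have hmeas : Measurable fun x : ℂ => ‖x⁻¹ - truncKernel 1 x‖ₑ := by fun_prop
  have h2 : ∀ᵐ z : ℂ, ∫⁻ ζ, ‖(z - ζ)⁻¹ - truncKernel 1 (z - ζ)‖ₑ ∂ν < ∞ := by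
    refine ae_lt_top ?_ (h1.trans_lt
      (ENNReal.mul_lt_top (measure_lt_top _ _) (truncError_lt_top 1))).ne
    exact Measurable.lintegral_prod_right' (f := fun q : ℂ × ℂ =>
      ‖(q.1 - q.2)⁻¹ - truncKernel 1 (q.1 - q.2)‖ₑ)
      (hmeas.comp (measurable_fst.sub measurable_snd))
  filter_upwards [h2] with z hz
  have h3 : Integrable (fun ζ => (z - ζ)⁻¹ - truncKernel 1 (z - ζ)) ν :=
    ⟨(by fun_prop : Measurable fun ζ => (z - ζ)⁻¹ - truncKernel 1 (z - ζ)).aestronglyMeasurable, hz⟩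
  have := h3.add (integrable_truncKernel one_pos ν z)
  refine this.congr (Eventually.of_forall fun ζ => ?_)
  simp

theorem stronglyMeasurable_truncTransform {ρ : ℝ} (hρ : 0 < ρ) (ν : Measure ℂ)
    [IsFiniteMeasure ν] : StronglyMeasurable fun z => ∫ ζ, truncKernel ρ (z - ζ) ∂ν := by
  have hm := (continuous_truncKernel hρ).measurable
  exact StronglyMeasurable.integral_prod_right' (f := fun q : ℂ × ℂ => truncKernel ρ (q.1 - q.2))
    (hm.comp (measurable_fst.sub measurable_snd)).stronglyMeasurable

theorem stronglyMeasurable_cauchyTransform (ν : Measure ℂ) [IsFiniteMeasure ν] :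
    StronglyMeasurable (cauchyTransform ν) := by
  exact StronglyMeasurable.integral_prod_right' (f := fun q : ℂ × ℂ => (q.1 - q.2)⁻¹)
    ((measurable_fst.sub measurable_snd).inv).stronglyMeasurable

theorem ae_enorm_cauchyTransform_sub_le {ρ : ℝ} (hρ : 0 < ρ) (ν : Measure ℂ) [IsFiniteMeasure ν] :
    ∀ᵐ z : ℂ, ‖cauchyTransform ν z - ∫ ζ, truncKernel ρ (z - ζ) ∂ν‖ₑ ≤
      ∫⁻ ζ, ‖(z - ζ)⁻¹ - truncKernel ρ (z - ζ)‖ₑ ∂ν := by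
  filter_upwards [ae_integrable_cauchyKernel ν] with z hz
  rw [cauchyTransform, ← integral_sub hz (integrable_truncKernel hρ ν z)]
  exact enorm_integral_le_lintegral_enorm _

theorem lintegral_cauchyTransform_sub_le {ρ : ℝ} (hρ : 0 < ρ) (ν : Measure ℂ) [IsFiniteMeasure ν] :
    ∫⁻ z, ‖cauchyTransform ν z - ∫ ζ, truncKernel ρ (z - ζ) ∂ν‖ₑ ≤ ν Set.univ * truncError ρ :=
  (lintegral_mono_ae (ae_enorm_cauchyTransform_sub_le hρ ν)).trans
    (lintegral_lintegral_inv_sub_truncKernel_le hρ ν)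

theorem norm_truncTransform_le {ρ : ℝ} (hρ : 0 < ρ) (ν : Measure ℂ) [IsFiniteMeasure ν] (z : ℂ) :
    ‖∫ ζ, truncKernel ρ (z - ζ) ∂ν‖ ≤ ρ⁻¹ * ν.real Set.univ :=
  norm_integral_le_of_norm_le_const (Eventually.of_forall fun _ => norm_truncKernel_le hρ _)

theorem locallyIntegrable_cauchyTransform (ν : Measure ℂ) [IsFiniteMeasure ν] :
    LocallyIntegrable (cauchyTransform ν) := by
  have h1 : Integrable fun z => cauchyTransform ν z - ∫ ζ, truncKernel 1 (z - ζ) ∂ν := by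
    refine ⟨((stronglyMeasurable_cauchyTransform ν).sub
      (stronglyMeasurable_truncTransform one_pos ν)).aestronglyMeasurable, ?_⟩
    exact (lintegral_cauchyTransform_sub_le one_pos ν).trans_lt
      (ENNReal.mul_lt_top (measure_lt_top _ _) (truncError_lt_top 1))
  have h2 : LocallyIntegrable fun z => ∫ ζ, truncKernel 1 (z - ζ) ∂ν := by
    rw [locallyIntegrable_iff]
    intro K hK
    refine Measure.integrableOn_of_bounded hK.measure_lt_top.ne
      (stronglyMeasurable_truncTransform one_pos ν).aestronglyMeasurable
      (M := 1⁻¹ * ν.real Set.univ) (Eventually.of_forall fun z => norm_truncTransform_le one_pos ν z)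
  refine (h1.locallyIntegrable.add h2).congr ?_
  exact Eventually.of_forall fun z => by simp

/-- Weak convergence of measures of mass at most one, tested against a continuous function that
vanishes at infinity. -/
theorem ConvergesWeakly.tendsto_integral_real {ν : ℕ → Measure ℂ} {μ : Measure ℂ}
    [IsFiniteMeasure μ] (hν : ∀ k, ν k Set.univ ≤ 1) (h : ConvergesWeakly ν μ) {F : ℂ → ℝ}
    (hF : Continuous F) (hF0 : Tendsto F (cocompact ℂ) (𝓝 0)) :
    Tendsto (fun k => ∫ z, F z ∂(ν k)) atTop (𝓝 (∫ z, F z ∂μ)) := by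
  have hfin : ∀ k, IsFiniteMeasure (ν k) := fun k => ⟨(hν k).trans_lt (by simp)⟩
  rw [Metric.tendsto_atTop]
  intro ε hε
  set m := μ.real Set.univ with hm
  have hm0 : 0 ≤ m := measureReal_nonneg
  set δ := ε / (4 * (m + 1)) with hδ
  have hδ0 : 0 < δ := by positivity
  obtain ⟨R, hR⟩ : ∃ R : ℝ, ∀ z : ℂ, R < ‖z‖ → |F z| ≤ δ := by
    have h1 := hF0 (Metric.closedBall_mem_nhds 0 hδ0)
    rw [mem_map, ← Metric.cobounded_eq_cocompact, ← comap_norm_atTop, mem_comap] at h1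
    obtain ⟨s, hs, hs'⟩ := h1
    obtain ⟨R, hR⟩ := mem_atTop_sets.1 hs
    refine ⟨R, fun z hz => ?_⟩
    have := hs' (show z ∈ norm ⁻¹' s from hR _ hz.le)
    simpa [dist_eq_norm] using this
  -- a cut-off function that equals `1` on the disc of radius `R`
  set χ : ℂ → ℝ := fun z => max 0 (min 1 (R + 1 - ‖z‖)) with hχ
  have hχ0 : ∀ z, 0 ≤ χ z := fun z => le_max_left _ _
  have hχ1 : ∀ z, χ z ≤ 1 := fun z => max_le zero_le_one (min_le_left _ _)
  have hχR : ∀ z, ‖z‖ ≤ R → χ z = 1 := fun z hz => by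
    simp only [hχ]
    rw [min_eq_left (by linarith), max_eq_right zero_le_one]
  have hχc : Continuous χ := by fun_prop
  let f : C_c(ℂ, ℝ) := ⟨⟨fun z => F z * χ z, by fun_prop⟩, by
    refine HasCompactSupport.of_support_subset_isCompact (isCompact_closedBall (0 : ℂ) (R + 1)) ?_
    intro z hz
    by_contra hcon
    apply hz
    have : R + 1 < ‖z‖ := by simpa using hcon
    have h2 : χ z = 0 := by
      simp only [hχ]
      exact max_eq_left ((min_le_right _ _).trans (by linarith))
    simp [h2]⟩
  have hf : ∀ z, f z = F z * χ z := fun z => rfl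
  have hdiff : ∀ z, |F z - f z| ≤ δ := by
    intro z
    rw [hf]
    rcases le_or_gt ‖z‖ R with hz | hz
    · rw [hχR z hz]; simp [hδ0.le]
    · have : F z - F z * χ z = F z * (1 - χ z) := by ring
      rw [this, abs_mul, abs_of_nonneg (by linarith [hχ1 z] : (0:ℝ) ≤ 1 - χ z)]
      calc |F z| * (1 - χ z) ≤ |F z| * 1 := by
            gcongr; linarith [hχ0 z]
        _ ≤ δ := by rw [mul_one]; exact hR z hz
  obtain ⟨B, hB⟩ : ∃ B, ∀ z, ‖F z‖ ≤ B := by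
    obtain ⟨B, hB⟩ := (isCompact_closedBall (0 : ℂ) R).exists_bound_of_continuousOn
      (f := F) hF.continuousOn
    refine ⟨max B δ, fun z => ?_⟩
    rcases le_or_gt ‖z‖ R with hz | hz
    · exact (hB z (by simpa using hz)).trans (le_max_left _ _)
    · exact (hR z hz).trans (le_max_right _ _)
  have happrox : ∀ (σ : Measure ℂ) [IsFiniteMeasure σ],
      |∫ z, F z ∂σ - ∫ z, f z ∂σ| ≤ δ * σ.real Set.univ := by
    intro σ _
    have hFi : Integrable F σ := Integrable.of_bound hF.aestronglyMeasurable B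
      (Eventually.of_forall hB)
    have hfi : Integrable f σ := f.continuous.integrable_of_hasCompactSupport f.hasCompactSupport
    rw [← integral_sub hFi hfi, ← Real.norm_eq_abs]
    exact norm_integral_le_of_norm_le_const (Eventually.of_forall fun z => by
      rw [Real.norm_eq_abs]; exact hdiff z)
  obtain ⟨N, hN⟩ := Metric.tendsto_atTop.1 (h f) (ε / 2) (by positivity)
  refine ⟨N, fun k hk => ?_⟩
  have h1 := happrox (ν k)
  have h2 := happrox μ
  have h3 := hN k hk
  rw [Real.dist_eq] at h3 ⊢
  have h4 : (ν k).real Set.univ ≤ 1 := ENNReal.toReal_le_of_le_ofReal zero_le_one (by simpa using hν k)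
  have h5 : δ * (ν k).real Set.univ ≤ δ := mul_le_of_le_one_right hδ0.le h4
  have h6 : δ + δ * m ≤ ε / 4 := by
    rw [hδ]; field_simp; linarith
  rw [abs_lt] at h3 ⊢
  rw [abs_le] at h1 h2
  constructor <;> linarith [h1.1, h1.2, h2.1, h2.2, h3.1, h3.2]

theorem ConvergesWeakly.tendsto_truncTransform {ν : ℕ → Measure ℂ} {μ : Measure ℂ}
    [IsFiniteMeasure μ] (hν : ∀ k, ν k Set.univ ≤ 1) (h : ConvergesWeakly ν μ) {ρ : ℝ}
    (hρ : 0 < ρ) (z : ℂ) :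
    Tendsto (fun k => ∫ ζ, truncKernel ρ (z - ζ) ∂(ν k)) atTop
      (𝓝 (∫ ζ, truncKernel ρ (z - ζ) ∂μ)) := by
  have hfin : ∀ k, IsFiniteMeasure (ν k) := fun k => ⟨(hν k).trans_lt (by simp)⟩
  have hc : Continuous fun ζ => truncKernel ρ (z - ζ) :=
    (continuous_truncKernel hρ).comp (by fun_prop)
  have h0 := tendsto_truncKernel_cocompact hρ z
  have hre := h.tendsto_integral_real hν (Complex.continuous_re.comp hc)
    (by simpa using (Complex.continuous_re.tendsto 0).comp h0)
  have him := h.tendsto_integral_real hν (Complex.continuous_im.comp hc)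
    (by simpa using (Complex.continuous_im.tendsto 0).comp h0)
  have key : ∀ (σ : Measure ℂ) [IsFiniteMeasure σ], ∫ ζ, truncKernel ρ (z - ζ) ∂σ =
      ((∫ ζ, (truncKernel ρ (z - ζ)).re ∂σ : ℝ) : ℂ) +
      ((∫ ζ, (truncKernel ρ (z - ζ)).im ∂σ : ℝ) : ℂ) * Complex.I := by
    intro σ _
    have hi := integrable_truncKernel hρ σ z
    exact (integral_re_add_im hi).symm
  rw [key μ]
  simp_rw [fun k => key (ν k)]
  exact ((Complex.continuous_ofReal.tendsto _).comp hre).add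
    (((Complex.continuous_ofReal.tendsto _).comp him).mul_const _)

/-- Under weak convergence the Cauchy transforms converge in `L¹` on sets of finite measure. -/
theorem ConvergesWeakly.tendsto_lintegral_cauchyTransform {ν : ℕ → Measure ℂ} {μ : Measure ℂ}
    [IsFiniteMeasure μ] (hν : ∀ k, ν k Set.univ ≤ 1) (h : ConvergesWeakly ν μ) {S : Set ℂ}
    (hS : volume S ≠ ∞) :
    Tendsto (fun k => ∫⁻ z in S, ‖cauchyTransform (ν k) z - cauchyTransform μ z‖ₑ) atTop (𝓝 0) := by
  have hfin : ∀ k, IsFiniteMeasure (ν k) := fun k => ⟨(hν k).trans_lt (by simp)⟩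
  have hmid : ∀ ρ : ℝ, 0 < ρ → Tendsto (fun k => ∫⁻ z in S,
      ‖∫ ζ, truncKernel ρ (z - ζ) ∂(ν k) - ∫ ζ, truncKernel ρ (z - ζ) ∂μ‖ₑ) atTop (𝓝 0) := by
    intro ρ hρ
    have := tendsto_lintegral_of_dominated_convergence (μ := volume.restrict S)
      (F := fun k z => ‖∫ ζ, truncKernel ρ (z - ζ) ∂(ν k) - ∫ ζ, truncKernel ρ (z - ζ) ∂μ‖ₑ)
      (f := fun _ => 0) (fun _ => ENNReal.ofReal (ρ⁻¹ * 1 + ρ⁻¹ * μ.real Set.univ))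
      (fun k => ((stronglyMeasurable_truncTransform hρ (ν k)).sub
        (stronglyMeasurable_truncTransform hρ μ)).measurable.enorm)
      (fun k => Eventually.of_forall fun z => by
        simp only [← ofReal_norm]
        refine ENNReal.ofReal_le_ofReal ((norm_sub_le _ _).trans ?_)
        refine add_le_add ((norm_truncTransform_le hρ (ν k) z).trans ?_)
          (norm_truncTransform_le hρ μ z)
        gcongr
        exact ENNReal.toReal_le_of_le_ofReal zero_le_one (by simpa using hν k))
      (by
        rw [lintegral_const, Measure.restrict_apply_univ]
        exact ENNReal.mul_ne_top (by simp) hS)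
      (Eventually.of_forall fun z => by
        have h1 := (h.tendsto_truncTransform hν hρ z).sub_const (∫ ζ, truncKernel ρ (z - ζ) ∂μ)
        rw [sub_self] at h1
        simpa using h1.enorm)
    simpa using this
  rw [ENNReal.tendsto_nhds_zero]
  intro ε hε
  obtain ⟨ρ, hρerr, hρ⟩ : ∃ ρ : ℝ, (1 + μ Set.univ) * truncError ρ ≤ ε / 2 ∧ 0 < ρ := by
    have h1 : Tendsto (fun ρ => (1 + μ Set.univ) * truncError ρ) (𝓝[>] 0) (𝓝 0) := by
      have := ENNReal.Tendsto.const_mul tendsto_truncError (a := 1 + μ Set.univ)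
        (Or.inr (by simp))
      simpa using this
    have h2 := (ENNReal.tendsto_nhds_zero.1 h1) (ε / 2) (ENNReal.half_pos hε.ne')
    exact (h2.and self_mem_nhdsWithin).exists
  have hev := (ENNReal.tendsto_nhds_zero.1 (hmid ρ hρ)) (ε / 2) (ENNReal.half_pos hε.ne')
  filter_upwards [hev] with k hk
  set f : ℂ → ℝ≥0∞ := fun z => ‖cauchyTransform (ν k) z - ∫ ζ, truncKernel ρ (z - ζ) ∂(ν k)‖ₑ
  set g : ℂ → ℝ≥0∞ := fun z => ‖cauchyTransform μ z - ∫ ζ, truncKernel ρ (z - ζ) ∂μ‖ₑ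
  set e : ℂ → ℝ≥0∞ := fun z =>
    ‖∫ ζ, truncKernel ρ (z - ζ) ∂(ν k) - ∫ ζ, truncKernel ρ (z - ζ) ∂μ‖ₑ with he
  have hf : Measurable f := ((stronglyMeasurable_cauchyTransform (ν k)).sub
    (stronglyMeasurable_truncTransform hρ (ν k))).measurable.enorm
  have hg : Measurable g := ((stronglyMeasurable_cauchyTransform μ).sub
    (stronglyMeasurable_truncTransform hρ μ)).measurable.enorm
  have hpt : ∀ z, ‖cauchyTransform (ν k) z - cauchyTransform μ z‖ₑ ≤ f z + g z + e z := by
    intro z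
    have : cauchyTransform (ν k) z - cauchyTransform μ z =
      (cauchyTransform (ν k) z - ∫ ζ, truncKernel ρ (z - ζ) ∂(ν k)) -
      (cauchyTransform μ z - ∫ ζ, truncKernel ρ (z - ζ) ∂μ) +
      (∫ ζ, truncKernel ρ (z - ζ) ∂(ν k) - ∫ ζ, truncKernel ρ (z - ζ) ∂μ) := by ring
    rw [this]
    exact (enorm_add_le _ _).trans (add_le_add enorm_sub_le le_rfl)
  calc ∫⁻ z in S, ‖cauchyTransform (ν k) z - cauchyTransform μ z‖ₑ
      ≤ ∫⁻ z in S, (f z + g z + e z) := lintegral_mono hpt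
    _ = (∫⁻ z in S, f z) + (∫⁻ z in S, g z) + ∫⁻ z in S, e z := by
        rw [← lintegral_add_left hf]
        exact lintegral_add_left (hf.add hg) e
    _ ≤ ν k Set.univ * truncError ρ + μ Set.univ * truncError ρ + ε / 2 := by
        gcongr
        · exact (setLIntegral_le_lintegral _ _).trans (lintegral_cauchyTransform_sub_le hρ (ν k))
        · exact (setLIntegral_le_lintegral _ _).trans (lintegral_cauchyTransform_sub_le hρ μ)
    _ ≤ 1 * truncError ρ + μ Set.univ * truncError ρ + ε / 2 := by gcongr; exact hν k
    _ = (1 + μ Set.univ) * truncError ρ + ε / 2 := by rw [add_mul]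
    _ ≤ ε / 2 + ε / 2 := by gcongr
    _ = ε := ENNReal.add_halves ε

/-! ### Growth of a holomorphic function with small logarithmic derivative -/

/-- Along a segment without zeros, the logarithm of `‖h‖` varies by at most the integral of the
logarithmic derivative `n * F`. -/
theorem norm_le_exp_mul_norm_of_line {h F : ℂ → ℂ} (hh : Differentiable ℂ h) {n : ℝ} (hn : 0 ≤ n)
    {a v : ℂ} (hv : ‖v‖ = 1) {S T I : ℝ}
    (hne : ∀ s ∈ Set.Icc S T, h (a + s * v) ≠ 0)
    (hF : ∀ s ∈ Set.Icc S T, deriv h (a + s * v) = n * F (a + s * v) * h (a + s * v))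
    (hI0 : 0 ≤ I) (hI : ∫⁻ s in Set.Icc S T, ‖F (a + s * v)‖ₑ ≤ ENNReal.ofReal I)
    {s t : ℝ} (hs : s ∈ Set.Icc S T) (ht : t ∈ Set.Icc S T) :
    ‖h (a + s * v)‖ ≤ Real.exp (n * I) * ‖h (a + t * v)‖ := by
  set y : ℝ → ℂ := fun s => h (a + s * v) with hy
  set y' : ℝ → ℂ := fun s => deriv h (a + s * v) * v with hy'
  have hder : ∀ s : ℝ, HasDerivAt y (y' s) s := by
    intro s
    have h1 : HasDerivAt (fun s : ℝ => a + (s : ℂ) * v) v s := by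
      simpa using ((Complex.ofRealCLM.hasDerivAt (x := s)).mul_const v).const_add a
    exact (hh (a + s * v)).hasDerivAt.comp s h1
  have hyc : Continuous y := continuous_iff_continuousAt.2 fun s => (hder s).continuousAt
  have hd : Continuous (deriv h) := (hh.contDiff (n := 1)).continuous_deriv le_rfl
  have hy'c : Continuous y' := by fun_prop
  have hsub : Set.uIcc t s ⊆ Set.Icc S T := Set.uIcc_subset_Icc ht hs
  have hlog : ∀ x ∈ Set.uIcc t s, HasDerivAt (fun x => Real.log (‖y x‖ ^ 2))
      (2 * inner ℝ (y x) (y' x) / ‖y x‖ ^ 2) x := by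
    intro x hx
    exact (hder x).norm_sq.log (by simpa using hne x (hsub hx))
  have hcont : ContinuousOn (fun x => 2 * inner ℝ (y x) (y' x) / ‖y x‖ ^ 2) (Set.uIcc t s) := by
    refine ContinuousOn.div ?_ (by fun_prop) fun x hx => by simpa using hne x (hsub hx)
    exact (continuous_const.mul (hyc.inner hy'c)).continuousOn
  have hftc := intervalIntegral.integral_eq_sub_of_hasDerivAt hlog hcont.intervalIntegrable
  have hle : ‖∫ x in t..s, 2 * inner ℝ (y x) (y' x) / ‖y x‖ ^ 2‖ₑ ≤ ENNReal.ofReal (2 * n * I) := by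
    rw [← ofReal_norm, intervalIntegral.norm_intervalIntegral_eq, ofReal_norm]
    refine (enorm_integral_le_lintegral_enorm _).trans ?_
    calc ∫⁻ x in Set.uIoc t s, ‖2 * inner ℝ (y x) (y' x) / ‖y x‖ ^ 2‖ₑ
        ≤ ∫⁻ x in Set.uIoc t s, ENNReal.ofReal (2 * n) * ‖F (a + x * v)‖ₑ := by
          refine setLIntegral_mono' measurableSet_uIoc fun x hx => ?_
          have hx' : x ∈ Set.Icc S T := hsub (Set.uIoc_subset_uIcc hx)
          have hpos : 0 < ‖y x‖ := norm_pos_iff.2 (hne x hx')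
          rw [← ofReal_norm, ← ofReal_norm, ← ENNReal.ofReal_mul (by positivity)]
          refine ENNReal.ofReal_le_ofReal ?_
          rw [norm_div, norm_mul, norm_pow, norm_norm, div_le_iff₀ (by positivity)]
          have h1 : ‖inner ℝ (y x) (y' x)‖ ≤ ‖y x‖ * ‖y' x‖ := norm_inner_le_norm _ _
          have h2 : ‖y' x‖ = n * ‖F (a + x * v)‖ * ‖y x‖ := by
            simp only [hy', hy]
            rw [norm_mul, hv, mul_one, hF x hx', norm_mul, norm_mul, Complex.norm_real,
              Real.norm_of_nonneg hn]
          rw [h2] at h1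
          rw [Real.norm_ofNat]
          nlinarith
      _ ≤ ∫⁻ x in Set.Icc S T, ENNReal.ofReal (2 * n) * ‖F (a + x * v)‖ₑ :=
          lintegral_mono_set (Set.uIoc_subset_uIcc.trans hsub)
      _ = ENNReal.ofReal (2 * n) * ∫⁻ x in Set.Icc S T, ‖F (a + x * v)‖ₑ :=
          lintegral_const_mul' _ _ ENNReal.ofReal_ne_top
      _ ≤ ENNReal.ofReal (2 * n) * ENNReal.ofReal I := by gcongr
      _ = ENNReal.ofReal (2 * n * I) := (ENNReal.ofReal_mul (by positivity)).symm
  rw [hftc, ← ofReal_norm, ENNReal.ofReal_le_ofReal_iff (by positivity), Real.norm_eq_abs] at hle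
  have h1 := (abs_le.1 hle).2
  have hs0 : 0 < ‖y s‖ := norm_pos_iff.2 (hne s hs)
  have ht0 : 0 < ‖y t‖ := norm_pos_iff.2 (hne t ht)
  rw [Real.log_pow, Real.log_pow] at h1
  push_cast at h1
  have h2 : Real.log ‖y s‖ ≤ n * I + Real.log ‖y t‖ := by linarith
  calc ‖y s‖ = Real.exp (Real.log ‖y s‖) := (Real.exp_log hs0).symm
    _ ≤ Real.exp (n * I + Real.log ‖y t‖) := by gcongr
    _ = _ := by rw [Real.exp_add, Real.exp_log ht0]

/-- An interval of positive length contains a parameter outside a given finite set for which the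
inner integral is at most its average. -/
theorem exists_good_line {Φ : ℝ → ℝ → ℝ≥0∞} (hΦ : Measurable (Function.uncurry Φ)) {N : Set ℝ}
    (hN : N.Finite) {a b l c r e : ℝ} (hl : 0 < l) (hab : a + l ≤ b)
    (ha : -c ≤ a) (hb : b ≤ c)
    (h : ∫⁻ x in Set.Icc (-c) c, ∫⁻ y in Set.Icc (-r) r, Φ x y ≤ ENNReal.ofReal e) :
    ∃ x ∈ Set.Icc a b, x ∉ N ∧ ∫⁻ y in Set.Icc (-r) r, Φ x y ≤ ENNReal.ofReal (e / l) := by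
  set f : ℝ → ℝ≥0∞ := fun x => ∫⁻ y in Set.Icc (-r) r, Φ x y with hf
  have hfm : Measurable f := Measurable.lintegral_prod_right' (f := Function.uncurry Φ) hΦ
  set ν := volume.restrict (Set.Icc a b) with hν
  have hvol : ν Set.univ = ENNReal.ofReal (b - a) := by
    rw [hν, Measure.restrict_apply_univ, Real.volume_Icc]
  have hν0 : ν ≠ 0 := by
    intro h0
    rw [h0] at hvol
    simp only [Measure.coe_zero, Pi.zero_apply] at hvol
    have := ENNReal.ofReal_eq_zero.1 hvol.symm
    linarith
  have hnull : ν ((Set.Icc a b)ᶜ ∪ N) = 0 := by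
    refine measure_union_null ?_ ?_
    · rw [hν, Measure.restrict_apply measurableSet_Icc.compl]; simp
    · exact Measure.absolutelyContinuous_of_le Measure.restrict_le_self (hN.measure_zero _)
  obtain ⟨x, hx, hle⟩ := exists_notMem_null_le_laverage hν0 hfm.aemeasurable hnull
  simp only [Set.mem_union, Set.mem_compl_iff, not_or, not_not] at hx
  refine ⟨x, hx.1, hx.2, hle.trans ?_⟩
  rw [laverage_eq, hvol, ENNReal.ofReal_div_of_pos hl]
  refine ENNReal.div_le_div ?_ (ENNReal.ofReal_le_ofReal (by linarith))
  exact (lintegral_mono_set (Set.Icc_subset_Icc ha hb)).trans h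

theorem setLIntegral_square {Φ : ℂ → ℝ≥0∞} (hΦ : Measurable Φ) (r : ℝ) :
    ∫⁻ z in Set.Icc (-r) r ×ℂ Set.Icc (-r) r, Φ z =
      ∫⁻ x in Set.Icc (-r) r, ∫⁻ y in Set.Icc (-r) r, Φ (x + y * Complex.I) := by
  have h1 := (Complex.volume_preserving_equiv_real_prod.symm).setLIntegral_comp_preimage_emb
    Complex.measurableEquivRealProd.symm.measurableEmbedding Φ (Set.Icc (-r) r ×ℂ Set.Icc (-r) r)
  have h2 : Complex.measurableEquivRealProd.symm ⁻¹' (Set.Icc (-r) r ×ℂ Set.Icc (-r) r) =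
      Set.Icc (-r) r ×ˢ Set.Icc (-r) r := by
    ext ⟨x, y⟩
    simp only [Set.mem_preimage, Complex.mem_reProdIm, Set.mem_prod]
    rfl
  rw [h2] at h1
  have h3 : ∀ q : ℝ × ℝ, Complex.measurableEquivRealProd.symm q = q.1 + q.2 * Complex.I := by
    intro q
    apply Complex.ext <;> simp
  simp only [h3] at h1
  rw [← h1, Measure.volume_eq_prod, ← Measure.prod_restrict, lintegral_prod]
  exact (hΦ.comp (by fun_prop)).aemeasurable

theorem setLIntegral_square_swap {Φ : ℂ → ℝ≥0∞} (hΦ : Measurable Φ) (r : ℝ) :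
    ∫⁻ z in Set.Icc (-r) r ×ℂ Set.Icc (-r) r, Φ z =
      ∫⁻ y in Set.Icc (-r) r, ∫⁻ x in Set.Icc (-r) r, Φ (x + y * Complex.I) := by
  rw [setLIntegral_square hΦ, lintegral_lintegral_swap]
  exact (hΦ.comp (by fun_prop)).aemeasurable

/-- If the logarithmic derivative `n * F` of `h` is small in mean on a square, then `h` grows slowly:
its maximum on the concentric square of half the size is attained, up to a small exponential
factor, near the centre. Five lines on which the mean of `F` is small and `h` has no zero form a
rectangle joined to the centre; the maximum principle does the rest. -/
theorem exists_norm_le_exp_mul_norm {h F : ℂ → ℂ} (hh : Differentiable ℂ h) (hFm : Measurable F)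
    {Z : Set ℂ} (hZ : Z.Finite) {n : ℝ} (hn : 0 ≤ n) (hne : ∀ z ∉ Z, h z ≠ 0)
    (hF : ∀ z ∉ Z, deriv h z = n * F z * h z) {r η e : ℝ} (hr : 0 < r) (hη : 0 < η) (hη1 : η ≤ 1)
    (he : 0 ≤ e)
    (hint : ∫⁻ z in Set.Icc (-(2 * r)) (2 * r) ×ℂ Set.Icc (-(2 * r)) (2 * r), ‖F z‖ₑ ≤
      ENNReal.ofReal (e * r ^ 2)) :
    ∃ x, ‖x‖ ≤ η * r ∧ ∀ z : ℂ, |z.re| ≤ r → |z.im| ≤ r →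
      ‖h z‖ ≤ Real.exp (n * (3 * (e * r / η))) * ‖h x‖ := by
  have hl : 0 < η * r := by positivity
  have hηr : η * r ≤ r := mul_le_of_le_one_left hr.le hη1
  have hdiv : e * r ^ 2 / (η * r) = e * r / η := by field_simp
  set I := e * r / η with hI
  have hI0 : 0 ≤ I := by positivity
  have hv := hint
  rw [setLIntegral_square (by fun_prop)] at hv
  have hw := hint
  rw [setLIntegral_square_swap (by fun_prop)] at hw
  have hmv : Measurable (Function.uncurry fun x y : ℝ => ‖F (x + y * Complex.I)‖ₑ) :=
    (hFm.comp (by fun_prop : Measurable fun q : ℝ × ℝ => (q.1 + q.2 * Complex.I : ℂ))).enorm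
  have hmw : Measurable (Function.uncurry fun y x : ℝ => ‖F (x + y * Complex.I)‖ₑ) :=
    (hFm.comp (by fun_prop : Measurable fun q : ℝ × ℝ => (q.2 + q.1 * Complex.I : ℂ))).enorm
  obtain ⟨x₁, hx₁, hx₁N, hx₁I⟩ := exists_good_line hmv (hZ.image Complex.re) (a := -(2 * r))
    (b := -r) hl (by linarith) (by linarith) (by linarith) hv
  obtain ⟨x₂, hx₂, hx₂N, hx₂I⟩ := exists_good_line hmv (hZ.image Complex.re) (a := r)
    (b := 2 * r) hl (by linarith) (by linarith) (by linarith) hv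
  obtain ⟨x₃, hx₃, hx₃N, hx₃I⟩ := exists_good_line hmv (hZ.image Complex.re) (a := -(η * r / 2))
    (b := η * r / 2) hl (by linarith) (by linarith) (by linarith) hv
  obtain ⟨y₁, hy₁, hy₁N, hy₁I⟩ := exists_good_line hmw (hZ.image Complex.im) (a := -(2 * r))
    (b := -r) hl (by linarith) (by linarith) (by linarith) hw
  obtain ⟨y₂, hy₂, hy₂N, hy₂I⟩ := exists_good_line hmw (hZ.image Complex.im) (a := r)
    (b := 2 * r) hl (by linarith) (by linarith) (by linarith) hw
  rw [hdiv] at hx₁I hx₂I hx₃I hy₁I hy₂I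
  have vert : ∀ x : ℝ, x ∉ Complex.re '' Z →
      ∫⁻ y in Set.Icc (-(2 * r)) (2 * r), ‖F (x + y * Complex.I)‖ₑ ≤ ENNReal.ofReal I →
      ∀ s ∈ Set.Icc (-(2 * r)) (2 * r), ∀ t ∈ Set.Icc (-(2 * r)) (2 * r),
        ‖h (x + s * Complex.I)‖ ≤ Real.exp (n * I) * ‖h (x + t * Complex.I)‖ := by
    intro x hx hxI s hs t ht
    have hnot : ∀ s : ℝ, (x + s * Complex.I : ℂ) ∉ Z := fun s hmem => hx ⟨_, hmem, by simp⟩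
    exact norm_le_exp_mul_norm_of_line hh hn Complex.norm_I (fun s _ => hne _ (hnot s))
      (fun s _ => hF _ (hnot s)) hI0 hxI hs ht
  have horiz : ∀ y : ℝ, y ∉ Complex.im '' Z →
      ∫⁻ x in Set.Icc (-(2 * r)) (2 * r), ‖F (x + y * Complex.I)‖ₑ ≤ ENNReal.ofReal I →
      ∀ s ∈ Set.Icc (-(2 * r)) (2 * r), ∀ t ∈ Set.Icc (-(2 * r)) (2 * r),
        ‖h (s + y * Complex.I)‖ ≤ Real.exp (n * I) * ‖h (t + y * Complex.I)‖ := by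
    intro y hy hyI s hs t ht
    have hnot : ∀ s : ℝ, (y * Complex.I + s * 1 : ℂ) ∉ Z := fun s hmem => hy ⟨_, hmem, by simp⟩
    have := norm_le_exp_mul_norm_of_line hh hn (a := y * Complex.I) (v := 1) norm_one
      (fun s _ => hne _ (hnot s)) (fun s _ => hF _ (hnot s)) hI0
      (by simpa [add_comm] using hyI) hs ht
    simpa [add_comm] using this
  have hE : 1 ≤ Real.exp (n * I) := Real.one_le_exp (by positivity)
  set E := Real.exp (n * I) with hEdef
  have hE3 : Real.exp (n * (3 * I)) = E ^ 3 := by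
    rw [hEdef, ← Real.exp_nat_mul]; congr 1; push_cast; ring
  have mem0 : (0 : ℝ) ∈ Set.Icc (-(2 * r)) (2 * r) := ⟨by linarith, by linarith⟩
  have memx₃ : x₃ ∈ Set.Icc (-(2 * r)) (2 * r) := ⟨by linarith [hx₃.1], by linarith [hx₃.2]⟩
  have memy₁ : y₁ ∈ Set.Icc (-(2 * r)) (2 * r) := ⟨hy₁.1, by linarith [hy₁.2]⟩
  have memy₂ : y₂ ∈ Set.Icc (-(2 * r)) (2 * r) := ⟨by linarith [hy₂.1], hy₂.2⟩
  have memx₁ : x₁ ∈ Set.Icc (-(2 * r)) (2 * r) := ⟨hx₁.1, by linarith [hx₁.2]⟩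
  have memx₂ : x₂ ∈ Set.Icc (-(2 * r)) (2 * r) := ⟨by linarith [hx₂.1], hx₂.2⟩
  set q : ℂ := x₃ + (0 : ℝ) * Complex.I with hq
  have hrow : ∀ y : ℝ, y ∉ Complex.im '' Z → y ∈ Set.Icc (-(2 * r)) (2 * r) →
      ∫⁻ x in Set.Icc (-(2 * r)) (2 * r), ‖F (x + y * Complex.I)‖ₑ ≤ ENNReal.ofReal I →
      ∀ s ∈ Set.Icc (-(2 * r)) (2 * r), ‖h (s + y * Complex.I)‖ ≤ E ^ 2 * ‖h q‖ := by
    intro y hy hymem hyI s hs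
    calc ‖h (s + y * Complex.I)‖ ≤ E * ‖h (x₃ + y * Complex.I)‖ := horiz y hy hyI s hs x₃ memx₃
      _ ≤ E * (E * ‖h q‖) := by gcongr; exact vert x₃ hx₃N hx₃I y hymem 0 mem0
      _ = _ := by ring
  have hcol : ∀ x : ℝ, x ∉ Complex.re '' Z → x ∈ Set.Icc (-(2 * r)) (2 * r) →
      ∫⁻ y in Set.Icc (-(2 * r)) (2 * r), ‖F (x + y * Complex.I)‖ₑ ≤ ENNReal.ofReal I →
      ∀ s ∈ Set.Icc (-(2 * r)) (2 * r), ‖h (x + s * Complex.I)‖ ≤ E ^ 3 * ‖h q‖ := by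
    intro x hx hxmem hxI s hs
    calc ‖h (x + s * Complex.I)‖ ≤ E * ‖h (x + y₁ * Complex.I)‖ := vert x hx hxI s hs y₁ memy₁
      _ ≤ E * (E ^ 2 * ‖h q‖) := by gcongr; exact hrow y₁ hy₁N memy₁ hy₁I x hxmem
      _ = _ := by ring
  have hE23 : E ^ 2 * ‖h q‖ ≤ E ^ 3 * ‖h q‖ := by
    gcongr
    norm_num
  refine ⟨q, ?_, ?_⟩
  · have h1 : q = (x₃ : ℂ) := by simp [hq]
    rw [h1, Complex.norm_real, Real.norm_eq_abs, abs_le]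
    exact ⟨by linarith [hx₃.1], by linarith [hx₃.2]⟩
  · intro z hzr hzi
    rw [hE3]
    have hx12 : x₁ < x₂ := by linarith [hx₁.2, hx₂.1]
    have hy12 : y₁ < y₂ := by linarith [hy₁.2, hy₂.1]
    rw [abs_le] at hzr hzi
    refine Complex.norm_le_of_forall_mem_frontier_norm_le (U := Set.Ioo x₁ x₂ ×ℂ Set.Ioo y₁ y₂)
      ((Metric.isBounded_Ioo _ _).reProdIm (Metric.isBounded_Ioo _ _)) hh.diffContOnCl ?_ ?_
    · intro u hu
      rw [Complex.frontier_reProdIm, closure_Ioo hx12.ne, closure_Ioo hy12.ne,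
        frontier_Ioo hx12, frontier_Ioo hy12] at hu
      have hu' : u = u.re + u.im * Complex.I := (Complex.re_add_im u).symm
      rcases hu with hu | hu
      · rw [Complex.mem_reProdIm] at hu
        have hre : u.re ∈ Set.Icc (-(2 * r)) (2 * r) :=
          ⟨memx₁.1.trans hu.1.1, hu.1.2.trans memx₂.2⟩
        rw [hu']
        rcases hu.2 with h1 | h1
        · rw [h1]; exact (hrow y₁ hy₁N memy₁ hy₁I _ hre).trans hE23
        · rw [Set.mem_singleton_iff.1 h1]; exact (hrow y₂ hy₂N memy₂ hy₂I _ hre).trans hE23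
      · rw [Complex.mem_reProdIm] at hu
        have him : u.im ∈ Set.Icc (-(2 * r)) (2 * r) :=
          ⟨memy₁.1.trans hu.2.1, hu.2.2.trans memy₂.2⟩
        rw [hu']
        rcases hu.1 with h1 | h1
        · rw [h1]; exact hcol x₁ hx₁N memx₁ hx₁I _ him
        · rw [Set.mem_singleton_iff.1 h1]; exact hcol x₂ hx₂N memx₂ hx₂I _ him
    · rw [Complex.closure_reProdIm, closure_Ioo hx12.ne, closure_Ioo hy12.ne, Complex.mem_reProdIm]
      exact ⟨⟨by linarith [hx₁.2], by linarith [hx₂.1]⟩, ⟨by linarith [hy₁.2], by linarith [hy₂.1]⟩⟩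

/-! ### Root-counting measures -/

theorem integrable_multiset_sum_dirac (s : Multiset ℂ) (f : ℂ → ℂ) :
    Integrable f (s.map Measure.dirac).sum ∧
      ∫ z, f z ∂(s.map Measure.dirac).sum = (s.map f).sum := by
  induction s using Multiset.induction_on with
  | empty => simp
  | cons a s ih =>
    have ha : Integrable f (Measure.dirac a) := integrable_dirac (by simp)
    rw [Multiset.map_cons, Multiset.sum_cons, Multiset.map_cons, Multiset.sum_cons]
    exact ⟨ha.add_measure ih.1, by rw [integral_add_measure ha ih.1, ih.2, integral_dirac]⟩

theorem multiset_sum_dirac_univ (s : Multiset ℂ) :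
    (s.map Measure.dirac).sum Set.univ = (s.card : ℝ≥0∞) := by
  induction s using Multiset.induction_on with
  | empty => simp
  | cons a s ih =>
    rw [Multiset.map_cons, Multiset.sum_cons, Measure.add_apply, ih]
    simp [add_comm]

theorem integral_rootMeasure (n : ℕ) (p : ℂ[X]) (f : ℂ → ℂ) :
    ∫ z, f z ∂(rootMeasure n p) = (n : ℂ)⁻¹ * (p.roots.map f).sum := by
  rw [rootMeasure, integral_smul_measure, (integrable_multiset_sum_dirac _ _).2]
  simp [Complex.real_smul]

theorem rootMeasure_univ (n : ℕ) (p : ℂ[X]) :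
    rootMeasure n p Set.univ = (n : ℝ≥0∞)⁻¹ * (p.natDegree : ℝ≥0∞) := by
  rw [rootMeasure, Measure.smul_apply, multiset_sum_dirac_univ, smul_eq_mul,
    (IsAlgClosed.splits p).natDegree_eq_card_roots]

theorem rootMeasure_univ_le_one {n : ℕ} {p : ℂ[X]} (hp : p.natDegree ≤ n) :
    rootMeasure n p Set.univ ≤ 1 := by
  rw [rootMeasure_univ]
  calc (n : ℝ≥0∞)⁻¹ * (p.natDegree : ℝ≥0∞) ≤ (n : ℝ≥0∞)⁻¹ * n := by gcongr
    _ ≤ 1 := ENNReal.inv_mul_le_one _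

theorem cauchyTransform_rootMeasure (n : ℕ) (p : ℂ[X]) (z : ℂ) :
    cauchyTransform (rootMeasure n p) z = (n : ℂ)⁻¹ * (p.roots.map fun ζ => (z - ζ)⁻¹).sum :=
  integral_rootMeasure n p _

theorem eval_derivative_eq_cauchyTransform_mul {n : ℕ} (hn : n ≠ 0) {p : ℂ[X]} {z : ℂ}
    (hz : p.eval z ≠ 0) :
    p.derivative.eval z = n * cauchyTransform (rootMeasure n p) z * p.eval z := by
  have h := (IsAlgClosed.splits p).eval_derivative_eq_eval_mul_sum hz
  rw [h, cauchyTransform_rootMeasure, ← mul_assoc, mul_inv_cancel₀ (by exact_mod_cast hn)]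
  simp only [one_div, one_mul]
  ring

/-! ### Slow growth at Lebesgue points -/

/-- `z₀` is a Lebesgue point of `f`, in the form of a bound for the integral over a disc. -/
def IsLebesguePoint (f : ℂ → ℂ) (z₀ : ℂ) : Prop :=
  ∀ ε : ℝ, 0 < ε → ∃ r₀ : ℝ, 0 < r₀ ∧ ∀ r : ℝ, 0 < r → r ≤ r₀ →
    ∫⁻ z in Metric.closedBall z₀ r, ‖f z - f z₀‖ₑ ≤ ENNReal.ofReal (ε * r ^ 2)

theorem ae_isLebesguePoint {f : ℂ → ℂ} (hf : LocallyIntegrable f) :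
    ∀ᵐ z : ℂ, IsLebesguePoint f z := by
  filter_upwards [(Besicovitch.vitaliFamily (volume : Measure ℂ)).ae_tendsto_lintegral_enorm_sub_div
    hf] with z hz
  intro ε hε
  have h1 := hz.comp (Besicovitch.tendsto_filterAt volume z)
  have h2 := (ENNReal.tendsto_nhds_zero.1 h1) (ENNReal.ofReal (ε / Real.pi))
    (by rw [gt_iff_lt, ENNReal.ofReal_pos]; positivity)
  obtain ⟨u, hu, hu'⟩ := mem_nhdsGT_iff_exists_Ioc_subset.1 h2
  refine ⟨u, hu, fun r hr hru => ?_⟩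
  have h3 : (∫⁻ y in Metric.closedBall z r, ‖f y - f z‖ₑ) / volume (Metric.closedBall z r) ≤
      ENNReal.ofReal (ε / Real.pi) := hu' ⟨hr, hru⟩
  have hvol : volume (Metric.closedBall z r) = ENNReal.ofReal (r ^ 2 * Real.pi) := by
    rw [Complex.volume_closedBall, ENNReal.ofReal_mul (by positivity), ENNReal.ofReal_pow hr.le]
    congr 1
    rw [← NNReal.coe_real_pi, ENNReal.ofReal_coe_nnreal]
  rw [hvol, ENNReal.div_le_iff (by rw [Ne, ENNReal.ofReal_eq_zero, not_le]; positivity)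
    ENNReal.ofReal_ne_top, ← ENNReal.ofReal_mul (by positivity)] at h3
  refine h3.trans (le_of_eq ?_)
  congr 1
  field_simp

theorem square_subset_closedBall {r : ℝ} (hr : 0 ≤ r) :
    Set.Icc (-(2 * r)) (2 * r) ×ℂ Set.Icc (-(2 * r)) (2 * r) ⊆
      Metric.closedBall (0 : ℂ) (3 * r) := by
  intro z hz
  rw [Complex.mem_reProdIm] at hz
  rw [mem_closedBall_zero_iff, ← abs_of_nonneg (by positivity : (0 : ℝ) ≤ 3 * r),
    ← abs_of_nonneg (norm_nonneg z), ← sq_le_sq, ← Complex.normSq_eq_norm_sq, Complex.normSq_apply]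
  have h1 : z.re * z.re ≤ (2 * r) * (2 * r) := by nlinarith [hz.1.1, hz.1.2]
  have h2 : z.im * z.im ≤ (2 * r) * (2 * r) := by nlinarith [hz.2.1, hz.2.2]
  nlinarith

/-- At a Lebesgue point `z₀` of `C_μ` the polynomials `p_k`, divided by the exponential
`exp (N_k C_μ(z₀) z)`, grow slowly on small squares around `z₀`. -/
theorem ConvergesWeakly.exists_slow_growth {N : ℕ → ℕ} {p : ℕ → ℂ[X]} {μ : Measure ℂ}
    [IsFiniteMeasure μ] (hN : Tendsto N atTop atTop) (hp : ∀ k, p k ≠ 0)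
    (hdeg : ∀ k, (p k).natDegree ≤ N k)
    (hw : ConvergesWeakly (fun k => rootMeasure (N k) (p k)) μ) {z₀ : ℂ}
    (hz₀ : IsLebesguePoint (cauchyTransform μ) z₀) {ε η : ℝ} (hε : 0 < ε) (hη : 0 < η)
    (hη1 : η ≤ 1) :
    ∃ r₀ > 0, ∀ r, 0 < r → r ≤ r₀ → ∀ᶠ k in atTop, ∃ x, ‖x‖ ≤ η * r ∧
      ∀ z : ℂ, |z.re| ≤ r → |z.im| ≤ r →
        ‖(p k).eval (z₀ + z) * Complex.exp (-(N k * cauchyTransform μ z₀ * z))‖ ≤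
          Real.exp (N k * (ε * r)) *
            ‖(p k).eval (z₀ + x) * Complex.exp (-(N k * cauchyTransform μ z₀ * x))‖ := by
  set w₀ := cauchyTransform μ z₀ with hw₀
  have hmass : ∀ k, rootMeasure (N k) (p k) Set.univ ≤ 1 := fun k =>
    rootMeasure_univ_le_one (hdeg k)
  have hfin : ∀ k, IsFiniteMeasure (rootMeasure (N k) (p k)) := fun k =>
    ⟨(hmass k).trans_lt (by simp)⟩
  set ε' := ε * η / 6 with hε'
  have hε'0 : 0 < ε' := by positivity
  obtain ⟨r₀, hr₀, hleb⟩ := hz₀ (ε' / 9) (by positivity)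
  refine ⟨r₀ / 3, by positivity, fun r hr hrr => ?_⟩
  have hL := hleb (3 * r) (by positivity) (by linarith)
  have hconv := hw.tendsto_lintegral_cauchyTransform hmass
    (S := Metric.closedBall z₀ (3 * r)) measure_closedBall_lt_top.ne
  have hev := (ENNReal.tendsto_nhds_zero.1 hconv) (ENNReal.ofReal (ε' * r ^ 2))
    (by rw [gt_iff_lt, ENNReal.ofReal_pos]; positivity)
  filter_upwards [hev, hN.eventually_ge_atTop 1] with k hk hNk
  have hN0 : N k ≠ 0 := by omega
  set C := cauchyTransform (rootMeasure (N k) (p k)) with hC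
  have hCm : Measurable C := (stronglyMeasurable_cauchyTransform _).measurable
  have hμm : Measurable (cauchyTransform μ) := (stronglyMeasurable_cauchyTransform _).measurable
  set h : ℂ → ℂ := fun z => (p k).eval (z₀ + z) * Complex.exp (-(N k * w₀ * z)) with hh
  have hder : ∀ z, HasDerivAt h (((p k).derivative.eval (z₀ + z) - N k * w₀ * (p k).eval (z₀ + z)) *
      Complex.exp (-(N k * w₀ * z))) z := by
    intro z
    have h1 : HasDerivAt (fun z => (p k).eval (z₀ + z)) ((p k).derivative.eval (z₀ + z)) z :=
      ((p k).hasDerivAt (z₀ + z)).comp_const_add z₀ z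
    have h2 : HasDerivAt (fun z : ℂ => -(N k * w₀ * z)) (-(N k * w₀)) z := by
      have := ((hasDerivAt_id z).const_mul (N k * w₀)).neg
      rw [mul_one] at this
      exact this
    refine (h1.mul h2.cexp).congr_deriv ?_
    ring
  have hZ : {z : ℂ | (p k).eval (z₀ + z) = 0}.Finite := by
    refine Set.Finite.subset (((p k).roots.toFinset.finite_toSet).image fun ζ => ζ - z₀) ?_
    intro z hz
    refine ⟨z₀ + z, ?_, by ring⟩
    simp only [Finset.mem_coe, Multiset.mem_toFinset]
    exact (mem_roots (hp k)).2 hz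
  have hint : ∫⁻ z in Set.Icc (-(2 * r)) (2 * r) ×ℂ Set.Icc (-(2 * r)) (2 * r),
      ‖C (z₀ + z) - w₀‖ₑ ≤ ENNReal.ofReal (ε * η / 3 * r ^ 2) := by
    calc ∫⁻ z in Set.Icc (-(2 * r)) (2 * r) ×ℂ Set.Icc (-(2 * r)) (2 * r), ‖C (z₀ + z) - w₀‖ₑ
        ≤ ∫⁻ z in Metric.closedBall (0 : ℂ) (3 * r), ‖C (z₀ + z) - w₀‖ₑ :=
          lintegral_mono_set (square_subset_closedBall hr.le)
      _ = ∫⁻ z in Metric.closedBall z₀ (3 * r), ‖C z - w₀‖ₑ := by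
          have h1 := (measurePreserving_add_left (volume : Measure ℂ) z₀).setLIntegral_comp_preimage_emb
            (measurableEmbedding_addLeft z₀) (fun z => ‖C z - w₀‖ₑ) (Metric.closedBall z₀ (3 * r))
          rw [← h1]
          congr 2
          ext z
          simp
      _ ≤ ∫⁻ z in Metric.closedBall z₀ (3 * r), (‖C z - cauchyTransform μ z‖ₑ +
            ‖cauchyTransform μ z - w₀‖ₑ) := by
          refine lintegral_mono fun z => ?_
          rw [← sub_add_sub_cancel (C z) (cauchyTransform μ z) w₀]
          exact enorm_add_le _ _
      _ = (∫⁻ z in Metric.closedBall z₀ (3 * r), ‖C z - cauchyTransform μ z‖ₑ) +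
            ∫⁻ z in Metric.closedBall z₀ (3 * r), ‖cauchyTransform μ z - w₀‖ₑ :=
          lintegral_add_left (hCm.sub hμm).enorm _
      _ ≤ ENNReal.ofReal (ε' * r ^ 2) + ENNReal.ofReal (ε' / 9 * (3 * r) ^ 2) := by gcongr
      _ = ENNReal.ofReal (ε * η / 3 * r ^ 2) := by
          rw [← ENNReal.ofReal_add (by positivity) (by positivity), hε']
          congr 1
          ring
  obtain ⟨x, hx, hxz⟩ := exists_norm_le_exp_mul_norm (h := h) (F := fun z => C (z₀ + z) - w₀)
    (fun z => (hder z).differentiableAt) ((hCm.comp (measurable_const_add z₀)).sub_const w₀) hZ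
    (n := N k) (by positivity)
    (fun z hz => mul_ne_zero hz (Complex.exp_ne_zero _))
    (fun z hz => by
      rw [(hder z).deriv, eval_derivative_eq_cauchyTransform_mul hN0 hz]
      simp only [hh, Complex.ofReal_natCast]
      ring)
    hr hη hη1 (by positivity) hint
  refine ⟨x, hx, fun z hzr hzi => (hxz z hzr hzi).trans (le_of_eq ?_)⟩
  congr 3
  field_simp

/-- Slow growth in the logarithmic coordinate `z = z₀ exp t`. -/
theorem ConvergesWeakly.exists_slow_growth_log {N : ℕ → ℕ} {p : ℕ → ℂ[X]} {μ : Measure ℂ}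
    [IsFiniteMeasure μ] (hN : Tendsto N atTop atTop) (hp : ∀ k, p k ≠ 0)
    (hdeg : ∀ k, (p k).natDegree ≤ N k)
    (hw : ConvergesWeakly (fun k => rootMeasure (N k) (p k)) μ) {z₀ : ℂ} (hz0 : z₀ ≠ 0)
    (hz₀ : IsLebesguePoint (cauchyTransform μ) z₀) {κ : ℝ} (hκ : 0 < κ) :
    ∃ R₀ > 0, ∀ R, 0 < R → R ≤ R₀ → ∀ᶠ k in atTop, ∃ M t₁,
      (∀ t, ‖t‖ ≤ 2 * R → ‖(p k).eval (z₀ * Complex.exp t) *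
        Complex.exp (-(N k * (z₀ * cauchyTransform μ z₀) * t))‖ ≤ M) ∧ ‖t₁‖ ≤ R / 4 ∧
      M ≤ Real.exp (κ * N k * R / 4) * ‖(p k).eval (z₀ * Complex.exp t₁) *
        Complex.exp (-(N k * (z₀ * cauchyTransform μ z₀) * t₁))‖ := by
  set w₀ := cauchyTransform μ z₀ with hw₀
  have hz0' : 0 < ‖z₀‖ := norm_pos_iff.2 hz0
  obtain ⟨r₀, hr₀, hslow⟩ := hw.exists_slow_growth hN hp hdeg hz₀ (ε := κ / (32 * ‖z₀‖))
    (η := 1 / 24) (by positivity) (by norm_num) (by norm_num)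
  set σ := ‖z₀ * w₀‖ with hσ
  refine ⟨min (1 / 2) (min (r₀ / (4 * ‖z₀‖)) (κ / (40 * (σ + 1)))), by positivity,
    fun R hR hRle => ?_⟩
  have hR1 : R ≤ 1 / 2 := hRle.trans (min_le_left _ _)
  have hR2 : R ≤ r₀ / (4 * ‖z₀‖) := hRle.trans ((min_le_right _ _).trans (min_le_left _ _))
  have hR3 : R ≤ κ / (40 * (σ + 1)) := hRle.trans ((min_le_right _ _).trans (min_le_right _ _))
  rw [le_div_iff₀ (by positivity)] at hR2 hR3
  have hcmp : ∀ t : ℂ, ‖t‖ ≤ 1 → ∀ n : ℕ, |(-(n * w₀ * (z₀ * (Complex.exp t - 1)))).re -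
      (-(n * (z₀ * w₀) * t)).re| ≤ n * (σ * ‖t‖ ^ 2) := by
    intro t ht n
    rw [← Complex.sub_re]
    refine (Complex.abs_re_le_norm _).trans ?_
    have : -(n * w₀ * (z₀ * (Complex.exp t - 1))) - -(n * (z₀ * w₀) * t) =
        -(n * ((z₀ * w₀) * (Complex.exp t - 1 - t))) := by ring
    rw [this, norm_neg, norm_mul, norm_mul, Complex.norm_natCast]
    gcongr
    exact Complex.norm_exp_sub_one_sub_id_le ht
  filter_upwards [hslow (4 * ‖z₀‖ * R) (by positivity) (by linarith)] with k ⟨x, hx, hxz⟩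
  set n := N k with hn
  set h : ℂ → ℂ := fun z => (p k).eval (z₀ + z) * Complex.exp (-(n * w₀ * z)) with hh
  set g : ℂ → ℂ := fun t => (p k).eval (z₀ * Complex.exp t) *
    Complex.exp (-(n * (z₀ * w₀) * t)) with hg
  have hnorm : ∀ t : ℂ, ‖t‖ ≤ 1 →
      ‖g t‖ ≤ ‖h (z₀ * (Complex.exp t - 1))‖ * Real.exp (n * (σ * ‖t‖ ^ 2)) ∧
      ‖h (z₀ * (Complex.exp t - 1))‖ ≤ ‖g t‖ * Real.exp (n * (σ * ‖t‖ ^ 2)) := by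
    intro t ht
    have h1 := abs_le.1 (hcmp t ht n)
    have h2 : z₀ + z₀ * (Complex.exp t - 1) = z₀ * Complex.exp t := by ring
    simp only [hh, hg, h2, norm_mul ((p k).eval _), Complex.norm_exp, mul_assoc ‖(p k).eval _‖,
      ← Real.exp_add]
    constructor
    · gcongr; linarith
    · gcongr; linarith
  obtain ⟨t₁, ht₁, ht₁x⟩ : ∃ t₁ : ℂ, ‖t₁‖ ≤ R / 4 ∧ z₀ * (Complex.exp t₁ - 1) = x := by
    have h1 : ‖x / z₀‖ ≤ R / 6 := by
      rw [norm_div, div_le_iff₀ hz0']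
      linarith
    have h2 := Complex.norm_log_one_add_half_le_self (z := x / z₀) (by linarith)
    refine ⟨Complex.log (1 + x / z₀), by linarith, ?_⟩
    rw [Complex.exp_log, add_sub_cancel_left, mul_div_cancel₀ _ hz0]
    intro h0
    have : x / z₀ = -1 := by linear_combination h0
    rw [this] at h1
    norm_num at h1
    linarith
  refine ⟨Real.exp (n * (κ / (32 * ‖z₀‖) * (4 * ‖z₀‖ * R))) * ‖h x‖ *
    Real.exp (n * (σ * (2 * R) ^ 2)), t₁, fun t ht => ?_, ht₁, ?_⟩
  · refine (hnorm t (by linarith)).1.trans ?_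
    have h1 : ‖z₀ * (Complex.exp t - 1)‖ ≤ 4 * ‖z₀‖ * R := by
      rw [norm_mul]
      have := Complex.norm_exp_sub_one_le (x := t) (by linarith)
      nlinarith
    gcongr
    exact hxz _ ((Complex.abs_re_le_norm _).trans h1) ((Complex.abs_im_le_norm _).trans h1)
  · have h1 := (hnorm t₁ (by linarith)).2
    rw [ht₁x] at h1
    have h2 : Real.exp (n * (σ * ‖t₁‖ ^ 2)) ≤ Real.exp (n * (σ * (R / 4) ^ 2)) := by gcongr
    have h3 : Real.exp (n * (κ / (32 * ‖z₀‖) * (4 * ‖z₀‖ * R))) *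
        Real.exp (n * (σ * (R / 4) ^ 2)) * Real.exp (n * (σ * (2 * R) ^ 2)) ≤
        Real.exp (κ * n * R / 4) := by
      rw [← Real.exp_add, ← Real.exp_add]
      gcongr
      have h4 : κ / (32 * ‖z₀‖) * (4 * ‖z₀‖ * R) = κ * R / 8 := by field_simp; norm_num
      have h5 : σ * (R / 4) ^ 2 + σ * (2 * R) ^ 2 ≤ κ * R / 8 := by
        have : R * (R * (40 * (σ + 1))) ≤ R * κ := by gcongr
        nlinarith [norm_nonneg (z₀ * w₀), sq_nonneg R]
      rw [h4, ← mul_add, ← mul_add]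
      calc n * (κ * R / 8 + σ * (R / 4) ^ 2 + σ * (2 * R) ^ 2) ≤ n * (κ * R / 8 + κ * R / 8) := by
            rw [add_assoc]; gcongr
        _ = κ * n * R / 4 := by ring
    calc _ ≤ Real.exp (n * (κ / (32 * ‖z₀‖) * (4 * ‖z₀‖ * R))) *
          (‖g t₁‖ * Real.exp (n * (σ * (R / 4) ^ 2))) * Real.exp (n * (σ * (2 * R) ^ 2)) := by
          gcongr
          exact h1.trans (by gcongr)
      _ = Real.exp (n * (κ / (32 * ‖z₀‖) * (4 * ‖z₀‖ * R))) *
        Real.exp (n * (σ * (R / 4) ^ 2)) * Real.exp (n * (σ * (2 * R) ^ 2)) * ‖g t₁‖ := by ring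
      _ ≤ _ := by gcongr

/-! ### The hypergeometric differential equation -/

theorem hypergeomCoeff_succ {A B : ℕ} (a : Fin A → ℂ) (b : Fin B → ℂ)
    (hb : ∀ j, ∀ m : ℕ, b j ≠ -(m : ℂ)) (k : ℕ) :
    hypergeomCoeff a b (k + 1) * ((k + 1) * ∏ j, (b j + k)) =
      hypergeomCoeff a b k * ∏ i, (a i + k) := by
  unfold hypergeomCoeff
  have h1 : ∀ x : ℂ, (ascPochhammer ℂ (k + 1)).eval x = (ascPochhammer ℂ k).eval x * (x + k) := by
    intro x
    rw [ascPochhammer_succ_right]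
    simp
  simp only [h1, Finset.prod_mul_distrib, Nat.factorial_succ]
  have h2 : ∏ j, (b j + k) ≠ 0 := Finset.prod_ne_zero_iff.2 fun j _ h => hb j k (by
    linear_combination h)
  have h3 : ((k : ℂ) + 1) ≠ 0 := by exact_mod_cast k.succ_ne_zero
  have h4 : ((k.factorial : ℕ) : ℂ) ≠ 0 := by exact_mod_cast k.factorial_ne_zero
  push_cast
  by_cases h5 : ∏ j, (ascPochhammer ℂ k).eval (b j) = 0
  · simp [h5]
  · field_simp

theorem eval_hypergeomPoly {A B : ℕ} (a : Fin A → ℂ) (b : Fin B → ℂ) (n : ℕ) (z : ℂ) :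
    (hypergeomPoly a b n).eval z = ∑ k ∈ Finset.range (n + 1), hypergeomCoeff a b k * z ^ k := by
  simp [hypergeomPoly, eval_finsetSum]

theorem natDegree_hypergeomPoly_le {A B : ℕ} (a : Fin A → ℂ) (b : Fin B → ℂ) (n : ℕ) :
    (hypergeomPoly a b n).natDegree ≤ n := by
  refine natDegree_sum_le_of_forall_le _ _ fun k hk => ?_
  exact (natDegree_C_mul_X_pow_le _ _).trans (by simpa [Nat.lt_succ_iff] using hk)

theorem hypergeomPoly_ne_zero {A B : ℕ} (a : Fin A → ℂ) (b : Fin B → ℂ) (n : ℕ) :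
    hypergeomPoly a b n ≠ 0 := by
  intro h
  have h1 := eval_hypergeomPoly a b n 0
  rw [h, Finset.sum_range_succ'] at h1
  simp [hypergeomCoeff] at h1

/-- `p(z₀ exp t) exp (-v t)` and its derivatives in `t`, for the polynomial `p` with the
coefficients `h`, as a sum of exponentials. -/
noncomputable def expSum (h : ℕ → ℂ) (n : ℕ) (z₀ v : ℂ) (j : ℕ) (t : ℂ) : ℂ :=
  ∑ k ∈ Finset.range (n + 1), h k * z₀ ^ k * (k - v) ^ j * Complex.exp ((k - v) * t)

theorem hasDerivAt_expSum (h : ℕ → ℂ) (n : ℕ) (z₀ v : ℂ) (j : ℕ) (t : ℂ) :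
    HasDerivAt (expSum h n z₀ v j) (expSum h n z₀ v (j + 1) t) t := by
  unfold expSum
  refine HasDerivAt.fun_sum fun k _ => ?_
  have h1 : HasDerivAt (fun t : ℂ => ((k : ℂ) - v) * t) (k - v) t := by
    simpa using (hasDerivAt_id t).const_mul ((k : ℂ) - v)
  refine (h1.cexp.const_mul (h k * z₀ ^ k * (k - v) ^ j)).congr_deriv ?_
  ring

theorem expSum_zero_eq {A B : ℕ} (a : Fin A → ℂ) (b : Fin B → ℂ) (n : ℕ) (z₀ v t : ℂ) :
    expSum (hypergeomCoeff a b) n z₀ v 0 t =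
      (hypergeomPoly a b n).eval (z₀ * Complex.exp t) * Complex.exp (-(v * t)) := by
  rw [eval_hypergeomPoly, expSum, Finset.sum_mul]
  refine Finset.sum_congr rfl fun k _ => ?_
  have h1 : Complex.exp ((k - v) * t) = Complex.exp (k * t) * Complex.exp (-(v * t)) := by
    rw [← Complex.exp_add]; congr 1; ring
  rw [h1, mul_pow, ← Complex.exp_nat_mul]
  ring

/-- The characteristic factor `∏ (X + s + α_i + c_i / n)`, shifted to the point `s` and with the
correction of order `1 / n`. -/
noncomputable def charFactor {A : ℕ} (s : ℂ) (α c : Fin A → ℂ) (n : ℕ) : ℂ[X] :=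
  ∏ i, (X + C (s + α i + c i / n))

theorem natDegree_charFactor {A : ℕ} (s : ℂ) (α c : Fin A → ℂ) (n : ℕ) :
    (charFactor s α c n).natDegree = A := by
  rw [charFactor, natDegree_prod_of_monic _ _ fun i _ => monic_X_add_C _]
  simp only [natDegree_X_add_C]
  simp

theorem eval_charFactor {A : ℕ} (s : ℂ) (α c : Fin A → ℂ) {n : ℕ} (hn : n ≠ 0) (k : ℕ) :
    (n : ℂ) ^ A * (charFactor s α c n).eval ((k - n * s) / n) = ∏ i, (α i * n + c i + k) := by
  have hn' : (n : ℂ) ≠ 0 := by exact_mod_cast hn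
  rw [charFactor, eval_prod]
  have : (n : ℂ) ^ A = ∏ _i : Fin A, (n : ℂ) := by simp
  rw [this, ← Finset.prod_mul_distrib]
  refine Finset.prod_congr rfl fun i _ => ?_
  simp only [eval_add, eval_X, eval_C]
  field_simp
  ring

/-- A polynomial in `d / dt` with leading coefficients scaled by `n` acts on each exponential of
`expSum` by evaluation. -/
theorem sum_coeff_mul_expSum {A : ℕ} {P : ℂ[X]} (hP : P.natDegree ≤ A) (h : ℕ → ℂ) {n : ℕ}
    (z₀ v t : ℂ) :
    ∑ j ∈ Finset.range (A + 1), P.coeff j / n ^ j * expSum h n z₀ v j t =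
      ∑ k ∈ Finset.range (n + 1), h k * z₀ ^ k * P.eval ((k - v) / n) *
        Complex.exp ((k - v) * t) := by
  unfold expSum
  simp_rw [Finset.mul_sum]
  rw [Finset.sum_comm]
  refine Finset.sum_congr rfl fun k _ => ?_
  rw [eval_eq_sum_range' (Nat.lt_succ_of_le hP), Finset.mul_sum, Finset.sum_mul]
  refine Finset.sum_congr rfl fun j _ => ?_
  rw [div_pow]
  ring

/-- The hypergeometric equation in the coordinate `t`, after the exponential factor
`exp (-n s t)` has been split off. -/
theorem hyperP_ode {B : ℕ} {α c : Fin (B + 1) → ℂ} {β d : Fin B → ℂ} (hα₀ : α 0 = -1)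
    (hc₀ : c 0 = 0) {n : ℕ} (hn : n ≠ 0) (hdef : IsDefinedAt β d n) (z₀ s t : ℂ) :
    ∑ j ∈ Finset.range (B + 2),
      (z₀ * Complex.exp t * (charFactor s α c n).coeff j -
        (charFactor s (Fin.cons 0 β) (Fin.cons 0 d) n).coeff j) / n ^ j *
      expSum (hypergeomCoeff (fun i => α i * n + c i) (fun j => β j * n + d j + 1)) n z₀ (n * s)
        j t = 0 := by
  set a : Fin (B + 1) → ℂ := fun i => α i * n + c i with ha
  set b : Fin B → ℂ := fun j => β j * n + d j + 1 with hb
  set h := hypergeomCoeff a b with hh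
  have hn' : (n : ℂ) ≠ 0 := by exact_mod_cast hn
  have h1 := sum_coeff_mul_expSum (natDegree_charFactor s α c n).le h (n := n) z₀ (n * s) t
  have h2 := sum_coeff_mul_expSum
    (natDegree_charFactor s (Fin.cons 0 β) (Fin.cons 0 d) n).le h (n := n) z₀ (n * s) t
  have h3 : ∑ j ∈ Finset.range (B + 2),
      (z₀ * Complex.exp t * (charFactor s α c n).coeff j -
        (charFactor s (Fin.cons 0 β) (Fin.cons 0 d) n).coeff j) / n ^ j * expSum h n z₀ (n * s) j t
      = z₀ * Complex.exp t * (∑ j ∈ Finset.range (B + 1 + 1),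
          (charFactor s α c n).coeff j / n ^ j * expSum h n z₀ (n * s) j t) -
        ∑ j ∈ Finset.range (B + 1 + 1), (charFactor s (Fin.cons 0 β) (Fin.cons 0 d) n).coeff j /
          n ^ j * expSum h n z₀ (n * s) j t := by
    rw [Finset.mul_sum, ← Finset.sum_sub_distrib]
    refine Finset.sum_congr rfl fun j _ => ?_
    ring
  rw [h3, h1, h2]
  have hM : ∀ k : ℕ, (n : ℂ) ^ (B + 1) *
      (charFactor s (Fin.cons 0 β) (Fin.cons 0 d) n).eval ((k - n * s) / n) =
      k * ∏ j, (b j + k - 1) := by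
    intro k
    rw [eval_charFactor s _ _ hn k, Fin.prod_univ_succ]
    simp only [Fin.cons_zero, Fin.cons_succ, zero_mul, zero_add]
    congr 1
    refine Finset.prod_congr rfl fun j _ => ?_
    simp only [hb]; ring
  have hrec : ∀ k : ℕ, h (k + 1) * (((k + 1 : ℕ) : ℂ) * ∏ j, (b j + (k + 1 : ℕ) - 1)) =
      h k * ∏ i, (a i + k) := by
    intro k
    rw [← hypergeomCoeff_succ a b hdef k]
    push_cast
    congr 2
    refine Finset.prod_congr rfl fun j _ => ?_
    ring
  have hlast : ∏ i, (a i + (n : ℂ)) = 0 := by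
    refine Finset.prod_eq_zero (Finset.mem_univ 0) ?_
    simp only [ha, hα₀, hc₀]; ring
  have hpow : (n : ℂ) ^ (B + 1) ≠ 0 := pow_ne_zero _ hn'
  refine (mul_eq_zero.1 ?_).resolve_left hpow
  rw [mul_sub, mul_left_comm, Finset.mul_sum, Finset.mul_sum, Finset.mul_sum]
  rw [Finset.sum_range_succ, Finset.sum_range_succ' (n := n)]
  have e1 : z₀ * Complex.exp t * ((n : ℂ) ^ (B + 1) * (h n * z₀ ^ n *
      (charFactor s α c n).eval ((n - n * s) / n) * Complex.exp ((n - n * s) * t))) = 0 := by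
    have := eval_charFactor s α c hn n
    rw [hlast] at this
    linear_combination z₀ * Complex.exp t * h n * z₀ ^ n * Complex.exp ((n - n * s) * t) * this
  have e2 : (n : ℂ) ^ (B + 1) * (h 0 * z₀ ^ 0 *
      (charFactor s (Fin.cons 0 β) (Fin.cons 0 d) n).eval (((0 : ℕ) - n * s) / n) *
      Complex.exp (((0 : ℕ) - n * s) * t)) = 0 := by
    have := hM 0
    rw [Nat.cast_zero, zero_mul] at this
    rw [Nat.cast_zero]
    linear_combination h 0 * z₀ ^ 0 * Complex.exp ((0 - n * s) * t) * this
  rw [e1, e2, add_zero, add_zero, sub_eq_zero]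
  refine Finset.sum_congr rfl fun k _ => ?_
  have hexp : Complex.exp (((k + 1 : ℕ) - n * s) * t) =
      Complex.exp t * Complex.exp ((k - n * s) * t) := by
    rw [← Complex.exp_add]; congr 1; push_cast; ring
  have e3 := eval_charFactor s α c hn k
  have e4 := hM (k + 1)
  have e5 := hrec k
  rw [hexp]
  set E := Complex.exp t
  set E' := Complex.exp ((k - n * s) * t)
  set u := (charFactor s α c n).eval ((k - n * s) / n)
  set v := (charFactor s (Fin.cons 0 β) (Fin.cons 0 d) n).eval (((k + 1 : ℕ) - n * s) / n)
  rw [← e3, ← e4] at e5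
  linear_combination -z₀ ^ (k + 1) * E * E' * e5

/-! ### Coefficients of the characteristic factors -/

open Classical in
/-- If the constants `u i` with `i ∈ J` are of size `1 / n`, then the coefficients of
`∏ (X + u i)` of order `k < #J` are of size `n ^ (k - #J)`. -/
theorem norm_coeff_prod_X_add_C_le {ι : Type*} (u : ι → ℂ) {n U : ℝ} (hn : 1 ≤ n) (hU : 0 ≤ U)
    (J : ι → Prop) (hu : ∀ i, ‖u i‖ ≤ U) (huJ : ∀ i, J i → ‖u i‖ ≤ U / n) (I : Finset ι) (k : ℕ) :
    n ^ ((I.filter J).card - k) * ‖(∏ i ∈ I, (X + C (u i))).coeff k‖ ≤ (1 + U) ^ I.card := by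
  induction I using Finset.induction_on generalizing k with
  | empty =>
    rcases k with _ | k
    · simp
    · simp [coeff_one]
  | insert i I hi ih =>
    have hn0 : 0 < n := by linarith
    set Q := ∏ i ∈ I, (X + C (u i)) with hQ
    set m := (I.filter J).card with hm
    set V := (1 + U) ^ I.card with hV
    have hV0 : 0 ≤ V := by positivity
    rw [Finset.prod_insert hi, Finset.card_insert_of_notMem hi, Finset.filter_insert, pow_succ,
      ← hQ, ← hV]
    -- the coefficient of order `k - 1` of the product over `I`
    set q : ℂ := (X * Q).coeff k with hq
    have hcoeff : ((X + C (u i)) * Q).coeff k = q + u i * Q.coeff k := by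
      rw [add_mul, coeff_add, coeff_C_mul]
    have hq1 : n ^ (m + 1 - k) * ‖q‖ ≤ V := by
      rcases k with _ | k
      · simp [hq, hV0]
      · rw [hq, coeff_X_mul, Nat.add_sub_add_right]
        exact ih k
    rw [hcoeff]
    by_cases hJ : J i
    · rw [if_pos hJ, Finset.card_insert_of_notMem (by simp [hi]), ← hm]
      have hpow : n ^ (m + 1 - k) ≤ n * n ^ (m - k) := by
        rw [← pow_succ']
        exact pow_le_pow_right₀ hn (by omega)
      have h1 : n ^ (m + 1 - k) * (‖u i‖ * ‖Q.coeff k‖) ≤ V * U := by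
        calc n ^ (m + 1 - k) * (‖u i‖ * ‖Q.coeff k‖)
            ≤ (n * n ^ (m - k)) * (U / n * ‖Q.coeff k‖) := by
              gcongr; exact huJ i hJ
          _ = n ^ (m - k) * ‖Q.coeff k‖ * U := by field_simp
          _ ≤ V * U := by gcongr; exact ih k
      calc n ^ (m + 1 - k) * ‖q + u i * Q.coeff k‖
          ≤ n ^ (m + 1 - k) * (‖q‖ + ‖u i‖ * ‖Q.coeff k‖) := by
            gcongr; exact (norm_add_le _ _).trans (by rw [norm_mul])
        _ ≤ V * (1 + U) := by rw [mul_add]; linarith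
    · rw [if_neg hJ, ← hm]
      have h1 : n ^ (m - k) * (‖u i‖ * ‖Q.coeff k‖) ≤ V * U := by
        calc n ^ (m - k) * (‖u i‖ * ‖Q.coeff k‖) ≤ n ^ (m - k) * (U * ‖Q.coeff k‖) := by
              gcongr; exact hu i
          _ = n ^ (m - k) * ‖Q.coeff k‖ * U := by ring
          _ ≤ V * U := by gcongr; exact ih k
      have h2 : n ^ (m - k) * ‖q‖ ≤ V := by
        refine le_trans ?_ hq1
        gcongr
        omega
      calc n ^ (m - k) * ‖q + u i * Q.coeff k‖
          ≤ n ^ (m - k) * (‖q‖ + ‖u i‖ * ‖Q.coeff k‖) := by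
            gcongr; exact (norm_add_le _ _).trans (by rw [norm_mul])
        _ ≤ V * (1 + U) := by rw [mul_add]; linarith

open Classical in
/-- The number of indices `i` with `s + α i = 0`, which is the multiplicity of `s` as a zero of
`∏ (X + α i)`. -/
noncomputable def zeroMult {A : ℕ} (s : ℂ) (α : Fin A → ℂ) : ℕ :=
  (Finset.univ.filter fun i => s + α i = 0).card

theorem zeroMult_le {A : ℕ} (s : ℂ) (α : Fin A → ℂ) : zeroMult s α ≤ A := by
  classical
  exact (Finset.card_filter_le _ _).trans (by simp)

/-- At a zero `s` of multiplicity at least `m`, the coefficients of order `k < m` are only of size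
`n ^ (k - m)`, although the factors carry corrections of order `1 / n`. -/
theorem exists_bound_coeff_charFactor {A : ℕ} (s : ℂ) (α c : Fin A → ℂ) :
    ∃ U, ∀ n : ℕ, n ≠ 0 → ∀ m ≤ zeroMult s α, ∀ k,
      (n : ℝ) ^ (m - k) * ‖(charFactor s α c n).coeff k‖ ≤ U := by
  classical
  set V := ∑ i, (‖s + α i‖ + ‖c i‖) with hV
  have hVi : ∀ i, ‖s + α i‖ + ‖c i‖ ≤ V := fun i =>
    Finset.single_le_sum (f := fun i => ‖s + α i‖ + ‖c i‖) (fun i _ => by positivity)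
      (Finset.mem_univ i)
  have hV0 : 0 ≤ V := Finset.sum_nonneg fun i _ => by positivity
  refine ⟨(1 + V) ^ (Finset.univ : Finset (Fin A)).card, fun n hn m hm k => ?_⟩
  have hn1 : (1 : ℝ) ≤ n := by exact_mod_cast Nat.one_le_iff_ne_zero.2 hn
  have hcn : ∀ i, ‖c i / (n : ℂ)‖ = ‖c i‖ / n := fun i => by rw [norm_div, Complex.norm_natCast]
  have h1 := norm_coeff_prod_X_add_C_le (fun i => s + α i + c i / n) hn1 hV0
    (fun i => s + α i = 0) (fun i => by
      refine (norm_add_le _ _).trans (le_trans ?_ (hVi i))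
      rw [hcn]
      gcongr
      exact div_le_self (norm_nonneg _) hn1) (fun i hi => by
      simp only [hi, zero_add, hcn]
      gcongr
      exact (le_add_of_nonneg_left (norm_nonneg _)).trans (hVi i)) Finset.univ k
  refine le_trans ?_ h1
  rw [charFactor]
  gcongr
  exact hm

theorem tendsto_coeff_prod {ι : Type*} (I : Finset ι) (u : ℕ → ι → ℂ) (v : ι → ℂ)
    (h : ∀ i, Tendsto (fun n => u n i) atTop (𝓝 (v i))) (k : ℕ) :
    Tendsto (fun n => (∏ i ∈ I, (X + C (u n i))).coeff k) atTop
      (𝓝 ((∏ i ∈ I, (X + C (v i))).coeff k)) := by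
  classical
  induction I using Finset.induction_on generalizing k with
  | empty => simp
  | insert i I hi ih =>
    simp only [Finset.prod_insert hi, add_mul, coeff_add, coeff_C_mul]
    refine Tendsto.add ?_ ((h i).mul (ih k))
    rcases k with _ | k
    · simp
    · simpa only [coeff_X_mul] using ih k

theorem tendsto_coeff_charFactor {A : ℕ} (s : ℂ) (α c : Fin A → ℂ) (k : ℕ) :
    Tendsto (fun n => (charFactor s α c n).coeff k) atTop (𝓝 ((charFactor s α 0 0).coeff k)) := by
  refine tendsto_coeff_prod _ _ _ (fun i => ?_) k
  have h1 : Tendsto (fun n : ℕ => c i / (n : ℂ)) atTop (𝓝 0) :=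
    tendsto_const_div_atTop_nhds_zero_nat (c i)
  simpa using h1.const_add (s + α i)

/-! ### Exceptional points -/

theorem charFactor_zero_eq_comp {A : ℕ} (s : ℂ) (α : Fin A → ℂ) :
    charFactor s α 0 0 = (charFactor 0 α 0 0).comp (X + C s) := by
  simp only [charFactor, prod_comp]
  refine Finset.prod_congr rfl fun i _ => ?_
  simp
  ring

theorem coeff_zero_charFactor {A : ℕ} (s : ℂ) (α : Fin A → ℂ) :
    (charFactor s α 0 0).coeff 0 = ∏ i, (s + α i) := by
  rw [coeff_zero_eq_eval_zero, charFactor, eval_prod]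
  simp

theorem coeff_zero_charFactor_eq_eval {A : ℕ} (s : ℂ) (α : Fin A → ℂ) :
    (charFactor s α 0 0).coeff 0 = (charFactor 0 α 0 0).eval s := by
  rw [charFactor_zero_eq_comp, coeff_zero_eq_eval_zero, eval_comp]; simp

theorem coeff_one_charFactor_eq_eval {A : ℕ} (s : ℂ) (α : Fin A → ℂ) :
    (charFactor s α 0 0).coeff 1 = (charFactor 0 α 0 0).derivative.eval s := by
  have h : ∀ P : ℂ[X], P.coeff 1 = P.derivative.eval 0 := fun P => by
    rw [← coeff_zero_eq_eval_zero, coeff_derivative]; simp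
  rw [h, charFactor_zero_eq_comp, derivative_comp, eval_mul, eval_comp]
  simp

theorem coeff_zeroMult_charFactor_ne_zero {A : ℕ} (s : ℂ) (α : Fin A → ℂ) :
    (charFactor s α 0 0).coeff (zeroMult s α) ≠ 0 := by
  classical
  have h1 : charFactor s α 0 0 = X ^ zeroMult s α *
      ∏ i ∈ Finset.univ.filter (fun i => ¬ s + α i = 0), (X + C (s + α i)) := by
    rw [charFactor, ← Finset.prod_filter_mul_prod_filter_not Finset.univ (fun i => s + α i = 0)]
    congr 1
    · rw [zeroMult, ← Finset.prod_const]
      refine Finset.prod_congr rfl fun i hi => ?_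
      simp only [Finset.mem_filter, Finset.mem_univ, true_and] at hi
      simp [hi]
    · simp
  rw [h1, coeff_X_pow_mul', if_pos le_rfl, Nat.sub_self, coeff_zero_eq_eval_zero, eval_prod]
  refine Finset.prod_ne_zero_iff.2 fun i hi => ?_
  simpa using hi

/-- `p' q ≠ q' p` when `p` does not vanish at `0` and `q ≠ 0` does. -/
theorem wronskian_ne_zero {p q : ℂ[X]} (hp : p.eval 0 ≠ 0) (hq : q ≠ 0) (hq0 : q.eval 0 = 0) :
    p.derivative * q - q.derivative * p ≠ 0 := by
  intro h
  have hq' : q.derivative ≠ 0 := by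
    intro h0
    have := derivative_eq_zero.1 h0
    rw [eq_C_of_natDegree_eq_zero this] at hq0 hq
    simp at hq0
    exact hq (by simp [hq0])
  have hp0 : p ≠ 0 := by rintro rfl; simp at hp
  have h1 : q.derivative.rootMultiplicity 0 = q.rootMultiplicity 0 - 1 :=
    derivative_rootMultiplicity_of_root hq0
  have h2 : 0 < q.rootMultiplicity 0 := (rootMultiplicity_pos hq).2 hq0
  have h3 : p.rootMultiplicity 0 = 0 := rootMultiplicity_eq_zero hp
  have h4 : (X - C 0) ^ q.rootMultiplicity 0 ∣ q.derivative * p := by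
    rw [← sub_eq_zero.1 h]
    exact Dvd.dvd.mul_left (pow_rootMultiplicity_dvd q 0) _
  have h5 := (le_rootMultiplicity_iff (mul_ne_zero hq' hp0)).2 h4
  rw [rootMultiplicity_mul (mul_ne_zero hq' hp0), h1, h3] at h5
  omega

/-- Away from finitely many points `z`, every zero `s` of the characteristic polynomial
`z ∏ (s + α i) - ∏ (s + β j)` is either simple, or a common zero of both products whose
multiplicity in the characteristic polynomial is the smaller of its multiplicities there. -/
theorem exists_finite_exceptional {A : ℕ} {α β : Fin A → ℂ} (hα : ∀ i, α i ≠ 0)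
    (hβ : ∃ j, β j = 0) : ∃ E : Set ℂ, E.Finite ∧ ∀ z ∉ E, ∀ s : ℂ,
      z * (charFactor s α 0 0).coeff 0 - (charFactor s β 0 0).coeff 0 = 0 →
      z * (charFactor s α 0 0).coeff 1 - (charFactor s β 0 0).coeff 1 ≠ 0 ∨
      (z * (charFactor s α 0 0).coeff (min (zeroMult s α) (zeroMult s β)) -
        (charFactor s β 0 0).coeff (min (zeroMult s α) (zeroMult s β)) ≠ 0) := by
  classical
  set P := charFactor 0 α 0 0 with hP
  set Q := charFactor 0 β 0 0 with hQ
  have hP0 : P.eval 0 ≠ 0 := by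
    rw [hP, charFactor, eval_prod]
    simpa [Finset.prod_ne_zero_iff] using hα
  have hQ0 : Q.eval 0 = 0 := by
    obtain ⟨j, hj⟩ := hβ
    rw [hQ, charFactor, eval_prod]
    exact Finset.prod_eq_zero (Finset.mem_univ j) (by simp [hj])
  have hQne : Q ≠ 0 := (monic_prod_of_monic _ _ fun i _ => monic_X_add_C _).ne_zero
  set W := P.derivative * Q - Q.derivative * P with hW
  have hWne : W ≠ 0 := wronskian_ne_zero hP0 hQne hQ0
  set m : ℂ → ℕ := fun s => min (zeroMult s α) (zeroMult s β) with hm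
  refine ⟨((fun s => (charFactor s β 0 0).coeff (m s) / (charFactor s α 0 0).coeff (m s)) ''
      (Set.range fun i => -α i)) ∪ ((fun s => Q.eval s / P.eval s) '' W.roots.toFinset),
    ((Set.finite_range _).image _).union ((Finset.finite_toSet _).image _), ?_⟩
  intro z hz s hs
  simp only [Set.mem_union, not_or] at hz
  by_contra hcon
  rw [not_or, not_not, not_not] at hcon
  obtain ⟨h1, h2⟩ := hcon
  have hboth : (charFactor s α 0 0).coeff (m s) ≠ 0 := by
    intro h0
    have h3 : (charFactor s β 0 0).coeff (m s) = 0 := by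
      have h2' : z * (charFactor s α 0 0).coeff (m s) - (charFactor s β 0 0).coeff (m s) = 0 := h2
      rw [h0] at h2'
      linear_combination -h2'
    rcases min_choice (zeroMult s α) (zeroMult s β) with h4 | h4
    · exact coeff_zeroMult_charFactor_ne_zero s α (by rw [← h4]; exact h0)
    · exact coeff_zeroMult_charFactor_ne_zero s β (by rw [← h4]; exact h3)
  have hzm : z = (charFactor s β 0 0).coeff (m s) / (charFactor s α 0 0).coeff (m s) := by
    rw [eq_div_iff hboth]
    linear_combination h2
  by_cases hms : m s = 0
  · rw [hms] at hboth hzm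
    rw [coeff_one_charFactor_eq_eval, coeff_one_charFactor_eq_eval] at h1
    rw [coeff_zero_charFactor_eq_eval] at hboth
    rw [coeff_zero_charFactor_eq_eval, coeff_zero_charFactor_eq_eval] at hs hzm
    refine hz.2 ⟨s, ?_, hzm.symm⟩
    simp only [Finset.mem_coe, Multiset.mem_toFinset]
    rw [mem_roots hWne, IsRoot, hW, eval_sub, eval_mul, eval_mul]
    linear_combination -P.derivative.eval s * hs + P.eval s * h1
  · refine hz.1 ⟨s, ?_, hzm.symm⟩
    have h3 : 0 < zeroMult s α := by
      have := min_le_left (zeroMult s α) (zeroMult s β)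
      have h4 : m s ≤ zeroMult s α := this
      omega
    obtain ⟨i, hi⟩ := Finset.card_pos.1 h3
    simp only [Finset.mem_filter, Finset.mem_univ, true_and] at hi
    exact ⟨i, by linear_combination -hi⟩

/-! ### Local analysis at a Lebesgue point -/

theorem hyperP_ne_zero {B : ℕ} (α c : Fin (B + 1) → ℂ) (β d : Fin B → ℂ) (n : ℕ) :
    hyperP α c β d n ≠ 0 := hypergeomPoly_ne_zero _ _ _

theorem natDegree_hyperP_le {B : ℕ} (α c : Fin (B + 1) → ℂ) (β d : Fin B → ℂ) (n : ℕ) :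
    (hyperP α c β d n).natDegree ≤ n := natDegree_hypergeomPoly_le _ _ _

/-- `p_n(z₀ exp t) exp (-n s t)` and its derivatives in `t`. -/
noncomputable def hyperExp {B : ℕ} (α c : Fin (B + 1) → ℂ) (β d : Fin B → ℂ) (n : ℕ) (z₀ s : ℂ) :
    ℕ → ℂ → ℂ :=
  expSum (hypergeomCoeff (fun i => α i * n + c i) (fun j => β j * n + d j + 1)) n z₀ (n * s)

theorem hyperExp_zero {B : ℕ} (α c : Fin (B + 1) → ℂ) (β d : Fin B → ℂ) (n : ℕ) (z₀ s t : ℂ) :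
    hyperExp α c β d n z₀ s 0 t =
      (hyperP α c β d n).eval (z₀ * Complex.exp t) * Complex.exp (-(n * s * t)) :=
  expSum_zero_eq _ _ _ _ _ _

theorem hasDerivAt_hyperExp {B : ℕ} (α c : Fin (B + 1) → ℂ) (β d : Fin B → ℂ) (n : ℕ) (z₀ s : ℂ)
    (j : ℕ) (t : ℂ) :
    HasDerivAt (hyperExp α c β d n z₀ s j) (hyperExp α c β d n z₀ s (j + 1) t) t :=
  hasDerivAt_expSum _ _ _ _ _ _

theorem hyperExp_one_zero {B : ℕ} (α c : Fin (B + 1) → ℂ) (β d : Fin B → ℂ) (n : ℕ) (z₀ s : ℂ) :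
    hyperExp α c β d n z₀ s 1 0 = z₀ * (hyperP α c β d n).derivative.eval z₀ -
      n * s * (hyperP α c β d n).eval z₀ := by
  refine (hasDerivAt_hyperExp α c β d n z₀ s 0 0).unique ?_
  have h0 : hyperExp α c β d n z₀ s 0 = fun t =>
      (hyperP α c β d n).eval (z₀ * Complex.exp t) * Complex.exp (-(n * s * t)) :=
    funext fun t => hyperExp_zero α c β d n z₀ s t
  rw [h0]
  have h1 : HasDerivAt (fun t => z₀ * Complex.exp t) (z₀ * Complex.exp 0) 0 :=
    (Complex.hasDerivAt_exp 0).const_mul z₀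
  have h2 := ((hyperP α c β d n).hasDerivAt (z₀ * Complex.exp 0)).comp (0 : ℂ) h1
  have h3 : HasDerivAt (fun t : ℂ => -(n * s * t)) (-(n * s * 1)) 0 :=
    ((hasDerivAt_id (0 : ℂ)).const_mul (n * s : ℂ)).neg
  refine (h2.mul h3.cexp).congr_deriv ?_
  simp
  ring

/-- The function `t ↦ p_n(z₀ exp t) exp (-n s t)` does not vanish identically near the origin. -/
theorem exists_hyperExp_ne_zero {B : ℕ} (α c : Fin (B + 1) → ℂ) (β d : Fin B → ℂ) (n : ℕ)
    {z₀ : ℂ} (hz₀ : z₀ ≠ 0) (s : ℂ) {r : ℝ} (hr : 0 < r) :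
    ∃ t : ℂ, ‖t‖ ≤ r ∧ hyperExp α c β d n z₀ s 0 t ≠ 0 := by
  by_contra! hcon
  have hinj : Set.InjOn (fun x : ℝ => z₀ * Complex.exp x) (Set.Icc 0 r) := by
    intro x _ y _ hxy
    have h1 := mul_left_cancel₀ hz₀ hxy
    rw [← Complex.ofReal_exp, ← Complex.ofReal_exp] at h1
    exact Real.exp_injective (Complex.ofReal_injective h1)
  refine (Set.infinite_of_injOn_mapsTo hinj (t := (hyperP α c β d n).roots.toFinset) ?_
    (Set.Icc_infinite hr)) (Finset.finite_toSet _)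
  intro x hx
  have h1 := hcon x (by rw [Complex.norm_real, Real.norm_of_nonneg hx.1]; exact hx.2)
  rw [hyperExp_zero] at h1
  simp only [Finset.mem_coe, Multiset.mem_toFinset]
  exact (mem_roots (hyperP_ne_zero α c β d n)).2
    ((mul_eq_zero.1 h1).resolve_right (Complex.exp_ne_zero _))

/-- The limit, as `n → ∞`, of the coefficient of order `m` of the equation at `z = z₀`. -/
noncomputable def limitCoeff {B : ℕ} (α : Fin (B + 1) → ℂ) (β : Fin B → ℂ) (z₀ s : ℂ) (m : ℕ) : ℂ :=
  z₀ * (charFactor s α 0 0).coeff m -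
    (charFactor s (Fin.cons 0 β : Fin (B + 1) → ℂ) 0 0).coeff m

/-- The coefficient of order `j` of the equation at `z = z₀ exp t`, without the factor `n ^ (-j)`. -/
noncomputable def odeCoeff {B : ℕ} (α c : Fin (B + 1) → ℂ) (β d : Fin B → ℂ) (z₀ s : ℂ) (n j : ℕ)
    (t : ℂ) : ℂ :=
  z₀ * Complex.exp t * (charFactor s α c n).coeff j -
    (charFactor s (Fin.cons 0 β : Fin (B + 1) → ℂ) (Fin.cons 0 d) n).coeff j

theorem exists_norm_odeCoeff_le {B : ℕ} (α c : Fin (B + 1) → ℂ) (β d : Fin B → ℂ) (z₀ s : ℂ)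
    {m : ℕ} (hm : m ≤ zeroMult s α) (hm' : m ≤ zeroMult s (Fin.cons 0 β : Fin (B + 1) → ℂ)) :
    ∃ U, 0 ≤ U ∧ ∀ n : ℕ, n ≠ 0 → ∀ t : ℂ, ‖t‖ ≤ 1 → ∀ j,
      (n : ℝ) ^ (m - j) * ‖odeCoeff α c β d z₀ s n j t‖ ≤ U := by
  obtain ⟨U₁, hU₁⟩ := exists_bound_coeff_charFactor s α c
  obtain ⟨U₂, hU₂⟩ := exists_bound_coeff_charFactor s (Fin.cons 0 β : Fin (B + 1) → ℂ)
    (Fin.cons 0 d)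
  have hU₁0 : 0 ≤ U₁ := le_trans (by positivity) (hU₁ 1 one_ne_zero 0 (Nat.zero_le _) 0)
  have hU₂0 : 0 ≤ U₂ := le_trans (by positivity) (hU₂ 1 one_ne_zero 0 (Nat.zero_le _) 0)
  refine ⟨‖z₀‖ * 3 * U₁ + U₂, by positivity, fun n hn t ht j => ?_⟩
  have hexp : ‖Complex.exp t‖ ≤ 3 := by
    rw [Complex.norm_exp]
    calc Real.exp t.re ≤ Real.exp 1 := by
          gcongr; exact (Complex.re_le_norm t).trans ht
      _ ≤ 3 := by linarith [Real.exp_one_lt_d9]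
  have h1 : ‖odeCoeff α c β d z₀ s n j t‖ ≤ ‖z₀‖ * 3 * ‖(charFactor s α c n).coeff j‖ +
      ‖(charFactor s (Fin.cons 0 β : Fin (B + 1) → ℂ) (Fin.cons 0 d) n).coeff j‖ := by
    refine (norm_sub_le _ _).trans ?_
    rw [norm_mul, norm_mul]
    gcongr
  calc (n : ℝ) ^ (m - j) * ‖odeCoeff α c β d z₀ s n j t‖
      ≤ (n : ℝ) ^ (m - j) * (‖z₀‖ * 3 * ‖(charFactor s α c n).coeff j‖ +
        ‖(charFactor s (Fin.cons 0 β : Fin (B + 1) → ℂ) (Fin.cons 0 d) n).coeff j‖) := by gcongr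
    _ = ‖z₀‖ * 3 * ((n : ℝ) ^ (m - j) * ‖(charFactor s α c n).coeff j‖) + (n : ℝ) ^ (m - j) *
        ‖(charFactor s (Fin.cons 0 β : Fin (B + 1) → ℂ) (Fin.cons 0 d) n).coeff j‖ := by ring
    _ ≤ _ := by
      gcongr
      · exact hU₁ n hn m hm j
      · exact hU₂ n hn m hm' j

/-- Near `t = 0` and for large `n`, the coefficients of the equation are close to their limits, at
most `D * R` away on a disc of radius `R`. -/
theorem exists_norm_odeCoeff_sub_le {B : ℕ} (α c : Fin (B + 1) → ℂ) (β d : Fin B → ℂ) (z₀ s : ℂ)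
    (j : ℕ) : ∃ D, 0 ≤ D ∧ ∀ R, 0 < R → R ≤ 1 → ∀ᶠ n : ℕ in atTop, ∀ t : ℂ, ‖t‖ ≤ R →
      ‖odeCoeff α c β d z₀ s n j t - limitCoeff α β z₀ s j‖ ≤ D * R := by
  obtain ⟨U, hU⟩ := exists_bound_coeff_charFactor s α c
  have hU0 : 0 ≤ U := le_trans (by positivity) (hU 1 one_ne_zero 0 (Nat.zero_le _) 0)
  refine ⟨‖z₀‖ * 2 * U + 1, by positivity, fun R hR hR1 => ?_⟩
  have hlim : Tendsto (fun n => odeCoeff α c β d z₀ s n j 0) atTop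
      (𝓝 (limitCoeff α β z₀ s j)) := by
    have h1 := ((tendsto_coeff_charFactor s α c j).const_mul (z₀ * Complex.exp 0)).sub
      (tendsto_coeff_charFactor s (Fin.cons 0 β : Fin (B + 1) → ℂ) (Fin.cons 0 d) j)
    simpa [odeCoeff, limitCoeff] using h1
  filter_upwards [Metric.tendsto_nhds.1 hlim R hR, eventually_ne_atTop 0] with n hn hn0 t ht
  rw [dist_eq_norm] at hn
  have h1 : odeCoeff α c β d z₀ s n j t - limitCoeff α β z₀ s j =
      z₀ * (Complex.exp t - 1) * (charFactor s α c n).coeff j +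
      (odeCoeff α c β d z₀ s n j 0 - limitCoeff α β z₀ s j) := by
    simp only [odeCoeff, Complex.exp_zero]; ring
  have h2 : ‖(charFactor s α c n).coeff j‖ ≤ U := by
    simpa using hU n hn0 0 (Nat.zero_le _) j
  have h3 : ‖Complex.exp t - 1‖ ≤ 2 * R :=
    (Complex.norm_exp_sub_one_le (ht.trans hR1)).trans (by linarith)
  rw [h1]
  refine (norm_add_le _ _).trans ?_
  rw [norm_mul, norm_mul]
  calc ‖z₀‖ * ‖Complex.exp t - 1‖ * ‖(charFactor s α c n).coeff j‖ + _
      ≤ ‖z₀‖ * (2 * R) * U + R := by gcongr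
    _ = _ := by ring

/-- The weighted estimate for `t ↦ p_n(z₀ exp t) exp (-n s t)` at a Lebesgue point `z₀` of the
limiting Cauchy transform, with `s = z₀ C_μ(z₀)`, in case the coefficient of order `m` of the
limiting equation does not vanish. -/
theorem exists_hyperExp_jet_bound {B : ℕ} {α c : Fin (B + 1) → ℂ} {β d : Fin B → ℂ}
    (hα₀ : α 0 = -1) (hc₀ : c 0 = 0) {φ : ℕ → ℕ} (hφ : StrictMono φ)
    (hdef : ∀ k, IsDefinedAt β d (φ k)) {μ : Measure ℂ} [IsFiniteMeasure μ]
    (hw : ConvergesWeakly (fun k => rootMeasure (φ k) (hyperP α c β d (φ k))) μ) {z₀ : ℂ}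
    (hz0 : z₀ ≠ 0) (hz₀ : IsLebesguePoint (cauchyTransform μ) z₀) {m : ℕ} (hm : m ≤ B + 1)
    (hlim : limitCoeff α β z₀ (z₀ * cauchyTransform μ z₀) m ≠ 0) (D : ℝ) :
    ∃ κ > 0, ∃ L ≥ 1, ∃ C, ∃ R₀ > 0, ∀ R, 0 < R → R ≤ R₀ → ∀ᶠ k in atTop, ∀ l : ℝ, 1 ≤ l →
      L * l ≤ κ * φ k →
      (∀ t : ℂ, ‖t‖ ≤ R → ∀ j < m, (φ k : ℝ) ^ (m - j) *
        ‖odeCoeff α c β d z₀ (z₀ * cauchyTransform μ z₀) (φ k) j t‖ ≤ D * l ^ (m - j)) →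
      (∀ t, ‖t‖ ≤ R / 2 → ‖hyperExp α c β d (φ k) z₀ (z₀ * cauchyTransform μ z₀) 0 t‖ ≤
        2 * (∑ j ∈ Finset.range m,
          ‖hyperExp α c β d (φ k) z₀ (z₀ * cauchyTransform μ z₀) j 0‖ / l ^ j) *
          Real.exp (L * l * ‖t‖)) ∧
      (m = 1 → ‖hyperExp α c β d (φ k) z₀ (z₀ * cauchyTransform μ z₀) 1 0‖ ≤
        C * l * ‖hyperExp α c β d (φ k) z₀ (z₀ * cauchyTransform μ z₀) 0 0‖) := by
  set s := z₀ * cauchyTransform μ z₀ with hs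
  have hφt := hφ.tendsto_atTop
  obtain ⟨U, hU0, hU⟩ := exists_norm_odeCoeff_le α c β d z₀ s (m := 0) (Nat.zero_le _)
    (Nat.zero_le _)
  obtain ⟨D', hD'0, hD'⟩ := exists_norm_odeCoeff_sub_le α c β d z₀ s m
  set γ := ‖limitCoeff α β z₀ s m‖ / 2 with hγ
  have hγ0 : 0 < γ := by have := norm_pos_iff.2 hlim; positivity
  set C := max 1 (max (D / γ) (U / γ)) with hC
  have hC1 : 1 ≤ C := le_max_left _ _
  have hC2 : D ≤ C * γ := by
    rw [← div_le_iff₀ hγ0]; exact (le_max_left _ _).trans (le_max_right _ _)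
  have hC3 : U ≤ C * γ := by
    rw [← div_le_iff₀ hγ0]; exact (le_max_right _ _).trans (le_max_right _ _)
  obtain ⟨κ, hκ, L, hL, hkey⟩ := weighted_jet_bound (B + 1) C hC1
  obtain ⟨R₁, hR₁, hslow⟩ := hw.exists_slow_growth_log hφt (fun k => hyperP_ne_zero α c β d (φ k))
    (fun k => natDegree_hyperP_le α c β d (φ k)) hz0 hz₀ hκ
  refine ⟨κ, hκ, L, hL, 2 * (2 * C + 1), min 1 (min R₁ (γ / (D' + 1))), by positivity,
    fun R hR hRle => ?_⟩
  have hRa : R ≤ 1 := hRle.trans (min_le_left _ _)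
  have hRb : R ≤ R₁ := hRle.trans ((min_le_right _ _).trans (min_le_left _ _))
  have hRc : R ≤ γ / (D' + 1) := hRle.trans ((min_le_right _ _).trans (min_le_right _ _))
  rw [le_div_iff₀ (by positivity)] at hRc
  obtain ⟨n₀, hn₀⟩ := hkey R hR hRa
  have hge : ∀ᶠ k in atTop, n₀ ≤ (φ k : ℝ) :=
    (tendsto_natCast_atTop_atTop.comp hφt).eventually_ge_atTop n₀
  filter_upwards [hslow R hR hRb, hge, hφt.eventually (hD' R hR hRa), hφt.eventually_ge_atTop 1]
    with k ⟨M, t₁, hM, ht₁, hMt₁⟩ hk hDk hk1 l hl hLl hlow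
  set n := φ k with hn
  have hn0 : n ≠ 0 := by omega
  have hn1 : (1 : ℝ) ≤ n := by exact_mod_cast hk1
  have hn' : (0 : ℝ) < n := by linarith
  have hnC : (n : ℂ) ≠ 0 := by exact_mod_cast hn0
  set G := hyperExp α c β d n z₀ s with hG
  -- the equation is multiplied by `n ^ m / γ`, so that its term of order `m` dominates
  set q : ℕ → ℂ → ℂ := fun j t => (n : ℂ) ^ m / γ * (odeCoeff α c β d z₀ s n j t / n ^ j) with hq
  have hqn : ∀ j t, ‖q j t‖ = (n : ℝ) ^ m / γ * (‖odeCoeff α c β d z₀ s n j t‖ / n ^ j) := by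
    intro j t
    simp only [hq, norm_mul, norm_div, norm_pow, Complex.norm_natCast, Complex.norm_real]
    rw [Real.norm_of_nonneg hγ0.le]
  refine hn₀ n hk l hl hLl m hm G q (hasDerivAt_hyperExp α c β d n z₀ s) ?_ ?_ ?_ ?_ M t₁ ?_ ht₁ ?_
  · intro t _
    have h1 := hyperP_ode (β := β) (d := d) hα₀ hc₀ hn0 (hdef k) z₀ s t
    calc ∑ j ∈ Finset.range (B + 1 + 1), q j t * G j t = (n : ℂ) ^ m / γ *
          ∑ j ∈ Finset.range (B + 2), odeCoeff α c β d z₀ s n j t / n ^ j * G j t := by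
          rw [Finset.mul_sum]
          refine Finset.sum_congr rfl fun j _ => ?_
          simp only [hq]; ring
      _ = 0 := by
          have h2 : ∑ j ∈ Finset.range (B + 2), odeCoeff α c β d z₀ s n j t / n ^ j * G j t = 0 := h1
          rw [h2, mul_zero]
  · intro t ht j hj
    rw [hqn]
    have h1 : (n : ℝ) ^ m = (n : ℝ) ^ (m - j) * n ^ j := by
      rw [← pow_add, Nat.sub_add_cancel hj.le]
    have h2 := hlow t ht j hj
    calc (n : ℝ) ^ m / γ * (‖odeCoeff α c β d z₀ s n j t‖ / n ^ j)
        = (n : ℝ) ^ (m - j) * ‖odeCoeff α c β d z₀ s n j t‖ / γ := by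
          rw [h1]; field_simp
      _ ≤ D * l ^ (m - j) / γ := by gcongr
      _ ≤ C * γ * l ^ (m - j) / γ := by gcongr
      _ = C * l ^ (m - j) := by field_simp
  · intro t ht
    rw [hqn]
    have h1 := hDk t ht
    have h2 : γ ≤ ‖odeCoeff α c β d z₀ s n m t‖ := by
      have h3 := norm_sub_norm_le (limitCoeff α β z₀ s m) (odeCoeff α c β d z₀ s n m t)
      rw [norm_sub_rev] at h3
      have h4 : ‖limitCoeff α β z₀ s m‖ = 2 * γ := by rw [hγ]; ring
      have h5 : D' * R ≤ γ := by linarith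
      linarith
    have h6 : (n : ℝ) ^ m / γ * (‖odeCoeff α c β d z₀ s n m t‖ / n ^ m) =
        ‖odeCoeff α c β d z₀ s n m t‖ / γ := by field_simp
    rw [h6, le_div_iff₀ hγ0, one_mul]
    exact h2
  · intro t ht j hj _
    rw [hqn]
    have h1 : (n : ℝ) ^ j = (n : ℝ) ^ (j - m) * n ^ m := by
      rw [← pow_add, Nat.sub_add_cancel hj.le]
    have h2 : ‖odeCoeff α c β d z₀ s n j t‖ ≤ U := by
      simpa using hU n hn0 t (ht.trans hRa) j
    calc (n : ℝ) ^ m / γ * (‖odeCoeff α c β d z₀ s n j t‖ / n ^ j)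
        = ‖odeCoeff α c β d z₀ s n j t‖ / γ / n ^ (j - m) := by
          rw [h1]; field_simp
      _ ≤ (C * γ) / γ / n ^ (j - m) := by gcongr; exact h2.trans hC3
      _ = C / n ^ (j - m) := by field_simp
  · intro t ht
    rw [hG, hyperExp_zero]
    exact hM t ht
  · rw [hG, hyperExp_zero]
    exact hMt₁

/-- At a Lebesgue point `z₀` the number `s = z₀ C_μ(z₀)` solves the limiting characteristic
equation: otherwise the weighted estimate, with no term on the right, would make `p_n` vanish
on a disc. -/
theorem limitCoeff_zero_eq_zero {B : ℕ} {α c : Fin (B + 1) → ℂ} {β d : Fin B → ℂ}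
    (hα₀ : α 0 = -1) (hc₀ : c 0 = 0) {φ : ℕ → ℕ} (hφ : StrictMono φ)
    (hdef : ∀ k, IsDefinedAt β d (φ k)) {μ : Measure ℂ} [IsFiniteMeasure μ]
    (hw : ConvergesWeakly (fun k => rootMeasure (φ k) (hyperP α c β d (φ k))) μ) {z₀ : ℂ}
    (hz0 : z₀ ≠ 0) (hz₀ : IsLebesguePoint (cauchyTransform μ) z₀) :
    limitCoeff α β z₀ (z₀ * cauchyTransform μ z₀) 0 = 0 := by
  by_contra hne
  obtain ⟨κ, hκ, L, hL, C, R₀, hR₀, H⟩ := exists_hyperExp_jet_bound hα₀ hc₀ hφ hdef hw hz0 hz₀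
    (Nat.zero_le _) hne 0
  have hev : ∀ᶠ k in atTop, L / κ ≤ (φ k : ℝ) :=
    (tendsto_natCast_atTop_atTop.comp hφ.tendsto_atTop).eventually_ge_atTop _
  obtain ⟨k, hk, hk'⟩ := ((H R₀ hR₀ le_rfl).and hev).exists
  rw [div_le_iff₀ hκ] at hk'
  have h1 := (hk 1 le_rfl (by linarith) (by simp)).1
  obtain ⟨t, ht, hne'⟩ := exists_hyperExp_ne_zero α c β d (φ k) hz0
    (z₀ * cauchyTransform μ z₀) (r := R₀ / 2) (by positivity)
  have h2 := h1 t ht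
  simp at h2
  exact hne' h2

/-- Convergence at a Lebesgue point where `s = z₀ C_μ(z₀)` is a simple zero of the characteristic
polynomial. -/
theorem tendsto_cauchyTransform_of_simple {B : ℕ} {α c : Fin (B + 1) → ℂ} {β d : Fin B → ℂ}
    (hα₀ : α 0 = -1) (hc₀ : c 0 = 0) {φ : ℕ → ℕ} (hφ : StrictMono φ)
    (hdef : ∀ k, IsDefinedAt β d (φ k)) {μ : Measure ℂ} [IsFiniteMeasure μ]
    (hw : ConvergesWeakly (fun k => rootMeasure (φ k) (hyperP α c β d (φ k))) μ) {z₀ : ℂ}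
    (hz0 : z₀ ≠ 0) (hz₀ : IsLebesguePoint (cauchyTransform μ) z₀)
    (hsimple : limitCoeff α β z₀ (z₀ * cauchyTransform μ z₀) 1 ≠ 0) :
    Tendsto (fun k => cauchyTransform (rootMeasure (φ k) (hyperP α c β d (φ k))) z₀) atTop
      (𝓝 (cauchyTransform μ z₀)) := by
  have hzero := limitCoeff_zero_eq_zero hα₀ hc₀ hφ hdef hw hz0 hz₀
  set s := z₀ * cauchyTransform μ z₀ with hs
  obtain ⟨D, hD0, hD⟩ := exists_norm_odeCoeff_sub_le α c β d z₀ s 0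
  obtain ⟨κ, hκ, L, hL, C, R₀, hR₀, H⟩ := exists_hyperExp_jet_bound hα₀ hc₀ hφ hdef hw hz0 hz₀
    (Nat.le_add_left 1 B) hsimple D
  have hz0' : 0 < ‖z₀‖ := norm_pos_iff.2 hz0
  rw [Metric.tendsto_atTop']
  intro ε hε
  set R := min 1 (min R₀ (min (κ / L) (ε * ‖z₀‖ / (2 * (|C| + 1))))) with hR
  have hRpos : 0 < R := by positivity
  have hR1 : R ≤ 1 := min_le_left _ _
  have hR2 : R ≤ R₀ := (min_le_right _ _).trans (min_le_left _ _)
  have hR3 : R ≤ κ / L := (min_le_right _ _).trans ((min_le_right _ _).trans (min_le_left _ _))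
  have hR4 : R ≤ ε * ‖z₀‖ / (2 * (|C| + 1)) :=
    (min_le_right _ _).trans ((min_le_right _ _).trans (min_le_right _ _))
  rw [le_div_iff₀ (by linarith)] at hR3
  rw [le_div_iff₀ (by positivity)] at hR4
  have hev : ∀ᶠ k in atTop, 1 / R ≤ (φ k : ℝ) :=
    (tendsto_natCast_atTop_atTop.comp hφ.tendsto_atTop).eventually_ge_atTop _
  have hall : ∀ᶠ k in atTop, dist (cauchyTransform (rootMeasure (φ k) (hyperP α c β d (φ k))) z₀)
      (cauchyTransform μ z₀) < ε := by
    filter_upwards [H R hRpos hR2, hev, hφ.tendsto_atTop.eventually (hD R hRpos hR1),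
      hφ.tendsto_atTop.eventually_ge_atTop 1] with k hk hkR hkD hk1
    set n := φ k with hn
    have hn0 : n ≠ 0 := by omega
    have hn' : (0 : ℝ) < n := by exact_mod_cast hk1
    have hnC : (n : ℂ) ≠ 0 := by exact_mod_cast hn0
    rw [div_le_iff₀ hRpos] at hkR
    -- The coefficient of order `0` tends to `0` and is at most `D R` on the disc, so the estimate
    -- may be used with `l = R n`; the resulting bound for `g'(0) / g(0)` is then `C R n`.
    obtain ⟨h1, h2⟩ := hk (R * n) (by linarith) (by
      calc L * (R * n) = R * L * n := by ring
        _ ≤ κ * n := by gcongr) (by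
      intro t ht j hj
      obtain rfl : j = 0 := by omega
      have := hkD t ht
      rw [hzero, sub_zero] at this
      calc (n : ℝ) ^ (1 - 0) * ‖odeCoeff α c β d z₀ s n 0 t‖ ≤ (n : ℝ) ^ (1 - 0) * (D * R) := by
            gcongr
        _ = D * (R * n) ^ (1 - 0) := by simp; ring)
    have h3 := h2 rfl
    set p := hyperP α c β d n with hp
    have hpz : p.eval z₀ ≠ 0 := by
      intro h0
      obtain ⟨t, ht, hne⟩ := exists_hyperExp_ne_zero α c β d n hz0 s (r := R / 2) (by positivity)
      have h4 := h1 t ht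
      have h00 : hyperExp α c β d n z₀ s 0 0 = 0 := by rw [hyperExp_zero]; simp [← hp, h0]
      rw [Finset.sum_range_one, h00] at h4
      simp at h4
      exact hne h4
    rw [hyperExp_one_zero, hyperExp_zero, ← hp, eval_derivative_eq_cauchyTransform_mul hn0 hpz] at h3
    simp only [Complex.exp_zero, mul_one, mul_zero, neg_zero] at h3
    have h5 : z₀ * (n * cauchyTransform (rootMeasure n p) z₀ * p.eval z₀) - n * s * p.eval z₀ =
        n * (z₀ * (cauchyTransform (rootMeasure n p) z₀ - cauchyTransform μ z₀)) * p.eval z₀ := by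
      rw [hs]; ring
    rw [h5, norm_mul, norm_mul, norm_mul, Complex.norm_natCast] at h3
    have h6 := le_of_mul_le_mul_right h3 (norm_pos_iff.2 hpz)
    rw [dist_eq_norm]
    set e := ‖cauchyTransform (rootMeasure n p) z₀ - cauchyTransform μ z₀‖ with he
    have h7 : n * (‖z₀‖ * e) ≤ n * (C * R) := by
      refine h6.trans (le_of_eq ?_); ring
    have h8 : ‖z₀‖ * e ≤ C * R := le_of_mul_le_mul_left h7 hn'
    have h9 : C * R ≤ |C| * R := by gcongr; exact le_abs_self C
    have h10 : |C| * R < ‖z₀‖ * ε := by nlinarith [abs_nonneg C]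
    exact lt_of_mul_lt_mul_left (h8.trans_lt (h9.trans_lt h10)) hz0'.le
  obtain ⟨N, hN⟩ := eventually_atTop.1 hall
  exact ⟨N, fun k hk => hN k hk.le⟩

theorem norm_multiset_prod_map {ι : Type*} (S : Multiset ι) (f : ι → ℂ) :
    ‖(S.map f).prod‖ = (S.map fun i => ‖f i‖).prod := by
  induction S using Multiset.induction_on with
  | empty => simp
  | cons a S ih => simp [ih]

/-- The zero count behind Jensen's inequality: if `p(z₀ exp t) exp (-v t)` is at most `K₁` times as
large on the circle `‖t‖ = r` as its maximum on a small disc, then `p` has boundedly many zeros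
near `z₀`. The function is divided by its factors `z₀ exp t - ζ`, which are twice as large on the
circle as on the small disc. -/
theorem two_pow_card_roots_le {p : ℂ[X]} {z₀ v : ℂ} (hz0 : z₀ ≠ 0) {r K₁ : ℝ} (hr : 0 < r)
    (hr1 : r ≤ 1 / 2) {u : ℂ} (hu : ‖u‖ ≤ r / 16)
    (hne : p.eval (z₀ * Complex.exp u) * Complex.exp (-(v * u)) ≠ 0)
    (hK : ∀ t : ℂ, ‖t‖ = r → ‖p.eval (z₀ * Complex.exp t) * Complex.exp (-(v * t))‖ ≤
      K₁ * ‖p.eval (z₀ * Complex.exp u) * Complex.exp (-(v * u))‖) :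
    (2 : ℝ) ^ (p.roots.filter fun ζ => ‖ζ - z₀‖ ≤ ‖z₀‖ * (r / 24)).card ≤ K₁ := by
  classical
  have hz0' : 0 < ‖z₀‖ := norm_pos_iff.2 hz0
  set S := p.roots.filter fun ζ => ‖ζ - z₀‖ ≤ ‖z₀‖ * (r / 24) with hS
  set T := p.roots.filter fun ζ => ¬ ‖ζ - z₀‖ ≤ ‖z₀‖ * (r / 24) with hT
  have hprod : ∀ z, p.eval z = p.leadingCoeff * (T.map fun ζ => z - ζ).prod *
      (S.map fun ζ => z - ζ).prod := by
    intro z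
    rw [(IsAlgClosed.splits p).eval_eq_prod_roots, mul_assoc, ← Multiset.prod_add,
      ← Multiset.map_add, add_comm T S, hS, hT, Multiset.filter_add_not]
  set h : ℂ → ℂ := fun t => p.leadingCoeff * (T.map fun ζ => z₀ * Complex.exp t - ζ).prod *
    Complex.exp (-(v * t)) with hh
  set N : ℂ → ℂ := fun t => (S.map fun ζ => z₀ * Complex.exp t - ζ).prod with hN
  have hfac : ∀ t, p.eval (z₀ * Complex.exp t) * Complex.exp (-(v * t)) = h t * N t := by
    intro t
    rw [hprod]; simp only [hh, hN]; ring
  have hdiff : Differentiable ℂ h := by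
    have h1 : Differentiable ℂ fun t => (T.map fun ζ => z₀ * Complex.exp t - ζ).prod := by
      have : (fun t => (T.map fun ζ => z₀ * Complex.exp t - ζ).prod) =
          fun t => ((T.map fun ζ => X - C ζ).prod).eval (z₀ * Complex.exp t) := by
        funext t
        rw [eval_multiset_prod, Multiset.map_map]
        simp
      rw [this]
      exact (Polynomial.differentiable (𝕜 := ℂ) ((T.map fun ζ => X - C ζ).prod)).comp
        (Complex.differentiable_exp.const_mul z₀)
    exact (h1.const_mul _).mul (by fun_prop)
  set x := ‖z₀‖ * (r / 6) with hx
  have hx0 : 0 < x := by positivity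
  have hup : ‖N u‖ ≤ x ^ S.card := by
    simp only [hN]
    rw [norm_multiset_prod_map, ← Multiset.prod_replicate, ← Multiset.map_const']
    refine Multiset.prod_map_le_prod_map₀ _ _ (fun _ _ => norm_nonneg _) ?_
    intro ζ hζ
    have h2 := (Multiset.mem_filter.1 hζ).2
    have h3 : ‖Complex.exp u - 1‖ ≤ 2 * ‖u‖ := Complex.norm_exp_sub_one_le (by linarith)
    have h4 : z₀ * Complex.exp u - ζ = z₀ * (Complex.exp u - 1) - (ζ - z₀) := by ring
    rw [h4]
    refine (norm_sub_le _ _).trans ?_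
    rw [norm_mul]
    calc ‖z₀‖ * ‖Complex.exp u - 1‖ + ‖ζ - z₀‖ ≤ ‖z₀‖ * (2 * (r / 16)) + ‖z₀‖ * (r / 24) := by
          gcongr; linarith
      _ = x := by rw [hx]; ring
  have hlow : ∀ t : ℂ, ‖t‖ = r → (2 * x) ^ S.card ≤ ‖N t‖ := by
    intro t ht
    simp only [hN]
    rw [norm_multiset_prod_map, ← Multiset.prod_replicate, ← Multiset.map_const']
    refine Multiset.prod_map_le_prod_map₀ _ _ (fun _ _ => by positivity) ?_
    intro ζ hζ
    have h2 := (Multiset.mem_filter.1 hζ).2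
    have h3 : ‖Complex.exp t - 1 - t‖ ≤ ‖t‖ ^ 2 :=
      Complex.norm_exp_sub_one_sub_id_le (by linarith)
    have h4 : r / 2 ≤ ‖Complex.exp t - 1‖ := by
      have h5 := norm_sub_norm_le t (t - (Complex.exp t - 1))
      rw [sub_sub_cancel, ← norm_neg (t - _), neg_sub] at h5
      rw [ht] at h3 h5
      nlinarith
    have h6 : z₀ * (Complex.exp t - 1) = (z₀ * Complex.exp t - ζ) + (ζ - z₀) := by ring
    have h7 := norm_add_le (z₀ * Complex.exp t - ζ) (ζ - z₀)
    rw [← h6, norm_mul] at h7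
    have h8 : ‖z₀‖ * (r / 2) ≤ ‖z₀‖ * ‖Complex.exp t - 1‖ := by gcongr
    rw [hx]
    nlinarith
  set g := ‖p.eval (z₀ * Complex.exp u) * Complex.exp (-(v * u))‖ with hg
  have hg0 : 0 < g := norm_pos_iff.2 hne
  have hmax : ‖h u‖ ≤ K₁ * g / (2 * x) ^ S.card := by
    refine Complex.norm_le_of_forall_mem_frontier_norm_le (U := Metric.ball 0 r)
      Metric.isBounded_ball hdiff.diffContOnCl ?_ ?_
    · intro t ht
      rw [frontier_ball _ hr.ne'] at ht
      have ht' : ‖t‖ = r := by simpa using ht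
      rw [le_div_iff₀ (by positivity)]
      have h1 := hK t ht'
      rw [hfac t, norm_mul] at h1
      exact (mul_le_mul_of_nonneg_left (hlow t ht') (norm_nonneg _)).trans h1
    · rw [closure_ball _ hr.ne', mem_closedBall_zero_iff]
      linarith
  have h1 : g ≤ K₁ * g / (2 * x) ^ S.card * x ^ S.card := by
    calc g = ‖h u‖ * ‖N u‖ := by rw [hg, hfac u, norm_mul]
      _ ≤ _ := mul_le_mul hmax hup (norm_nonneg _) ((norm_nonneg _).trans hmax)
  rw [mul_pow] at h1
  have h2 : K₁ * g / (2 ^ S.card * x ^ S.card) * x ^ S.card = K₁ / 2 ^ S.card * g := by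
    field_simp
  rw [h2] at h1
  have h3 : 1 * g ≤ K₁ / 2 ^ S.card * g := by rw [one_mul]; exact h1
  have h4 := le_of_mul_le_mul_right h3 hg0
  rwa [le_div_iff₀ (by positivity), one_mul] at h4

/-- Near a Lebesgue point where `s = z₀ C_μ(z₀)` is a common zero of the two characteristic factors,
the number of zeros of `p_n` is bounded in `n`. -/
theorem exists_card_roots_le_of_common_zero {B : ℕ} {α c : Fin (B + 1) → ℂ} {β d : Fin B → ℂ}
    (hα₀ : α 0 = -1) (hc₀ : c 0 = 0) {φ : ℕ → ℕ} (hφ : StrictMono φ)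
    (hdef : ∀ k, IsDefinedAt β d (φ k)) {μ : Measure ℂ} [IsFiniteMeasure μ]
    (hw : ConvergesWeakly (fun k => rootMeasure (φ k) (hyperP α c β d (φ k))) μ) {z₀ : ℂ}
    (hz0 : z₀ ≠ 0) (hz₀ : IsLebesguePoint (cauchyTransform μ) z₀) {m : ℕ}
    (hm : m ≤ zeroMult (z₀ * cauchyTransform μ z₀) α)
    (hm' : m ≤ zeroMult (z₀ * cauchyTransform μ z₀) (Fin.cons 0 β : Fin (B + 1) → ℂ))
    (hlim : limitCoeff α β z₀ (z₀ * cauchyTransform μ z₀) m ≠ 0) :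
    ∃ δ > 0, ∃ K : ℕ, ∀ᶠ k in atTop,
      ((hyperP α c β d (φ k)).roots.filter fun ζ => ‖ζ - z₀‖ ≤ δ).card ≤ K := by
  set s := z₀ * cauchyTransform μ z₀ with hs
  obtain ⟨U, hU0, hU⟩ := exists_norm_odeCoeff_le α c β d z₀ s hm hm'
  obtain ⟨κ, hκ, L, hL, C, R₀, hR₀, H⟩ := exists_hyperExp_jet_bound hα₀ hc₀ hφ hdef hw hz0 hz₀
    (hm.trans (zeroMult_le _ _)) hlim U
  set R := min 1 R₀ with hR
  have hRpos : 0 < R := by positivity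
  have hR1 : R ≤ 1 := min_le_left _ _
  set r := R / 2 with hr
  have hrpos : 0 < r := by positivity
  set K₁ : ℝ := 2 * (∑ j ∈ Finset.range m, (j.factorial : ℝ) / (r / 16) ^ j) *
    Real.exp (L * r) with hK₁
  refine ⟨‖z₀‖ * (r / 24), mul_pos (norm_pos_iff.2 hz0) (by positivity), ⌊K₁⌋₊, ?_⟩
  have hev : ∀ᶠ k in atTop, L / κ ≤ (φ k : ℝ) :=
    (tendsto_natCast_atTop_atTop.comp hφ.tendsto_atTop).eventually_ge_atTop _
  filter_upwards [H R hRpos (min_le_right _ _), hev, hφ.tendsto_atTop.eventually_ge_atTop 1]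
    with k hk hkκ hk1
  set n := φ k with hn
  have hn0 : n ≠ 0 := by omega
  rw [div_le_iff₀ hκ] at hkκ
  -- All coefficients of order `j < m` are of size `n ^ (j - m)`, so `l = 1` is allowed, which makes
  -- the growth bound independent of `n`.
  have h1 := (hk 1 le_rfl (by linarith) (fun t ht j _ => by
    rw [one_pow, mul_one]
    exact hU n hn0 t (ht.trans hR1) j)).1
  set G := hyperExp α c β d n z₀ s with hG
  have hGd := hasDerivAt_hyperExp α c β d n z₀ s
  have hGc : Continuous (G 0) := continuous_iff_continuousAt.2 fun t => (hGd 0 t).continuousAt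
  obtain ⟨u, hu, hmax⟩ := (isCompact_closedBall (0 : ℂ) (r / 16)).exists_isMaxOn
    ⟨0, by simp; positivity⟩ (f := fun t => ‖G 0 t‖) (by fun_prop)
  have hu' : ‖u‖ ≤ r / 16 := by simpa using hu
  have hle : ∀ t : ℂ, ‖t‖ ≤ r / 16 → ‖G 0 t‖ ≤ ‖G 0 u‖ := fun t ht =>
    hmax (by simpa using ht)
  have hGu : G 0 u ≠ 0 := by
    obtain ⟨t, ht, hne⟩ := exists_hyperExp_ne_zero α c β d n hz0 s (r := r / 16) (by positivity)
    intro h0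
    have := hle t ht
    rw [h0, norm_zero] at this
    exact hne (norm_le_zero_iff.1 this)
  -- the derivatives at the centre are bounded by the maximum over the small disc
  have hjet : ∀ j, ‖G j 0‖ ≤ (j.factorial : ℝ) / (r / 16) ^ j * ‖G 0 u‖ := by
    intro j
    have := norm_derivSeq_le_of_sphere hGd 0 j (t := 0) (ρ := r / 16) (S := ‖G 0 u‖)
      (by positivity) (fun w hw => hle w (by rw [sub_zero] at hw; exact hw.le))
    rw [zero_add] at this
    refine this.trans (le_of_eq ?_)
    ring
  have hcirc : ∀ t : ℂ, ‖t‖ = r → ‖G 0 t‖ ≤ K₁ * ‖G 0 u‖ := by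
    intro t ht
    refine (h1 t ht.le).trans ?_
    rw [ht, mul_one, hK₁]
    have h2 : ∑ j ∈ Finset.range m, ‖G j 0‖ / 1 ^ j ≤
        (∑ j ∈ Finset.range m, (j.factorial : ℝ) / (r / 16) ^ j) * ‖G 0 u‖ := by
      rw [Finset.sum_mul]
      refine Finset.sum_le_sum fun j _ => ?_
      rw [one_pow, div_one]
      exact hjet j
    calc 2 * (∑ j ∈ Finset.range m, ‖G j 0‖ / 1 ^ j) * Real.exp (L * r)
        ≤ 2 * ((∑ j ∈ Finset.range m, (j.factorial : ℝ) / (r / 16) ^ j) * ‖G 0 u‖) *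
          Real.exp (L * r) := by gcongr
      _ = _ := by ring
  have h3 := two_pow_card_roots_le (p := hyperP α c β d n) (v := n * s) hz0 (K₁ := K₁) hrpos
    (by linarith) hu' (by rw [← hyperExp_zero]; exact hGu) (fun t ht => by
      rw [← hyperExp_zero, ← hyperExp_zero]; exact hcirc t ht)
  refine Nat.le_floor (le_trans ?_ h3)
  exact_mod_cast Nat.lt_two_pow_self.le

/-! ### Neighbourhoods with boundedly many zeros -/

theorem norm_multiset_sum_map_le {ι : Type*} (S : Multiset ι) (f : ι → ℂ) {b : ℝ}
    (h : ∀ i ∈ S, ‖f i‖ ≤ b) : ‖(S.map f).sum‖ ≤ S.card * b := by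
  induction S using Multiset.induction_on with
  | empty => simp
  | cons a S ih =>
    rw [Multiset.map_cons, Multiset.sum_cons, Multiset.card_cons]
    refine (norm_add_le _ _).trans ?_
    have h1 := h a (Multiset.mem_cons_self a S)
    have h2 := ih fun i hi => h i (Multiset.mem_cons_of_mem hi)
    push_cast
    linarith

/-- Removing the singularity of the Cauchy kernel changes the Cauchy transform of a root-counting
measure only through the zeros close to `z`. -/
theorem norm_cauchyTransform_sub_truncTransform_le (n : ℕ) (p : ℂ[X]) {z z₀ : ℂ} {δ ρ r : ℝ}
    (hρ : 0 < ρ) (hr : 0 < r) (hz : ‖z - z₀‖ + ρ ≤ δ)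
    (hfar : ∀ ζ ∈ p.roots.filter fun ζ => ‖ζ - z₀‖ ≤ δ, r ≤ ‖z - ζ‖) :
    ‖cauchyTransform (rootMeasure n p) z - ∫ ζ, truncKernel ρ (z - ζ) ∂(rootMeasure n p)‖ ≤
      (n : ℝ)⁻¹ * ((p.roots.filter fun ζ => ‖ζ - z₀‖ ≤ δ).card * (2 / r)) := by
  classical
  rw [cauchyTransform_rootMeasure, integral_rootMeasure, ← mul_sub, ← Multiset.sum_map_sub, norm_mul,
    norm_inv, Complex.norm_natCast]
  gcongr
  have h1 : ((p.roots.filter fun ζ => ¬ ‖ζ - z₀‖ ≤ δ).map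
      fun ζ => (z - ζ)⁻¹ - truncKernel ρ (z - ζ)).sum = 0 := by
    refine Multiset.sum_eq_zero fun y hy => ?_
    obtain ⟨ζ, hζ, rfl⟩ := Multiset.mem_map.1 hy
    have h2 := (Multiset.mem_filter.1 hζ).2
    rw [truncKernel_eq_inv, sub_self]
    by_contra! h3
    have h4 := norm_sub_le_norm_sub_add_norm_sub ζ z z₀
    rw [norm_sub_rev ζ z] at h4
    linarith
  rw [← Multiset.filter_add_not (fun ζ => ‖ζ - z₀‖ ≤ δ) p.roots, Multiset.map_add,
    Multiset.sum_add, h1, add_zero, Multiset.filter_add_not]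
  refine norm_multiset_sum_map_le _ _ fun ζ hζ => ?_
  have h2 := hfar ζ hζ
  refine (norm_sub_le _ _).trans ?_
  have h3 : ‖(z - ζ)⁻¹‖ ≤ r⁻¹ := by
    rw [norm_inv]; gcongr
  have h4 := norm_truncKernel_le_inv hρ (z - ζ)
  rw [div_eq_mul_inv]
  linarith

theorem tendsto_truncTransform_cauchyTransform {μ : Measure ℂ} [IsFiniteMeasure μ] {z : ℂ}
    (hz : Integrable (fun ζ : ℂ => (z - ζ)⁻¹) μ) :
    Tendsto (fun j : ℕ => ∫ ζ, truncKernel (1 / ((j : ℝ) + 1)) (z - ζ) ∂μ) atTop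
      (𝓝 (cauchyTransform μ z)) := by
  refine tendsto_integral_of_dominated_convergence (fun ζ => ‖(z - ζ)⁻¹‖) (fun j => ?_) hz.norm
    (fun j => Eventually.of_forall fun ζ => norm_truncKernel_le_inv (by positivity) _)
    (Eventually.of_forall fun ζ => ?_)
  · exact (integrable_truncKernel (by positivity) μ z).aestronglyMeasurable
  · rcases eq_or_ne (z - ζ) 0 with h | h
    · simp [h, truncKernel]
    · have h1 : ∀ᶠ j : ℕ in atTop, 1 / ((j : ℝ) + 1) < ‖z - ζ‖ :=
        tendsto_one_div_add_atTop_nhds_zero_nat.eventually_lt_const (norm_pos_iff.2 h)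
      refine tendsto_const_nhds.congr' ?_
      filter_upwards [h1] with j hj
      exact (truncKernel_eq_inv hj.le).symm

theorem volume_near_roots_le (S : Multiset ℂ) (r : ℝ) :
    volume {z : ℂ | ∃ ζ ∈ S, ‖z - ζ‖ < r} ≤ S.card * (ENNReal.ofReal r ^ 2 * NNReal.pi) := by
  classical
  have h1 : {z : ℂ | ∃ ζ ∈ S, ‖z - ζ‖ < r} ⊆ ⋃ ζ ∈ S.toFinset, Metric.ball ζ r := by
    rintro z ⟨ζ, hζ, hz⟩
    simp only [Set.mem_iUnion, Multiset.mem_toFinset]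
    exact ⟨ζ, hζ, by rwa [mem_ball_iff_norm]⟩
  refine (measure_mono h1).trans ((measure_biUnion_finset_le _ _).trans ?_)
  simp only [Complex.volume_ball, Finset.sum_const, nsmul_eq_mul]
  gcongr
  exact Multiset.toFinset_card_le S

/-- Boundedly many zeros near `z₀` do not disturb the convergence of the Cauchy transforms: by the
Borel–Cantelli lemma almost every point has, for large `k`, distance at least `(k + 1) ^ (-3/4)` from them. -/
theorem ConvergesWeakly.ae_tendsto_cauchyTransform_of_card_le {φ : ℕ → ℕ} (hφ : StrictMono φ)
    {p : ℕ → ℂ[X]} (hdeg : ∀ k, (p k).natDegree ≤ φ k) {μ : Measure ℂ} [IsFiniteMeasure μ]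
    (hw : ConvergesWeakly (fun k => rootMeasure (φ k) (p k)) μ) {z₀ : ℂ} {δ : ℝ} (hδ : 0 < δ)
    {K : ℕ} (hK : ∀ᶠ k in atTop, ((p k).roots.filter fun ζ => ‖ζ - z₀‖ ≤ δ).card ≤ K) :
    ∀ᵐ z : ℂ, z ∈ Metric.ball z₀ (δ / 2) →
      Tendsto (fun k => cauchyTransform (rootMeasure (φ k) (p k)) z) atTop
        (𝓝 (cauchyTransform μ z)) := by
  set S : ℕ → Multiset ℂ := fun k => (p k).roots.filter fun ζ => ‖ζ - z₀‖ ≤ δ with hS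
  -- The exponent lies between `1 / 2`, so that the areas are summable, and `1`, so that a zero at
  -- distance `r k` contributes `o(1)` to the Cauchy transform.
  set r : ℕ → ℝ := fun k => ((k : ℝ) + 1) ^ (-(3 / 4) : ℝ) with hr
  have hrpos : ∀ k, 0 < r k := fun k => by positivity
  set s : ℕ → Set ℂ := fun k => {z | (S k).card ≤ K ∧ ∃ ζ ∈ S k, ‖z - ζ‖ < r k} with hs
  have hsum : Summable fun k => (r k) ^ 2 := by
    have h1 := (summable_nat_add_iff 1).2 (Real.summable_nat_rpow.2 (by norm_num : (-(3 / 2) : ℝ) < -1))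
    refine h1.congr fun k => ?_
    rw [hr, ← Real.rpow_natCast, ← Real.rpow_mul (by positivity)]
    push_cast
    norm_num
  have hs1 : ∀ k, volume (s k) ≤ ENNReal.ofReal (r k ^ 2) * (K * NNReal.pi) := by
    intro k
    by_cases hk : (S k).card ≤ K
    · calc volume (s k) ≤ volume {z : ℂ | ∃ ζ ∈ S k, ‖z - ζ‖ < r k} := measure_mono fun z hz => hz.2
        _ ≤ (S k).card * (ENNReal.ofReal (r k) ^ 2 * NNReal.pi) := volume_near_roots_le _ _
        _ ≤ K * (ENNReal.ofReal (r k) ^ 2 * NNReal.pi) := by gcongr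
        _ = _ := by rw [ENNReal.ofReal_pow (hrpos k).le]; ring
    · have : s k = ∅ := by
        ext z; simp [hs, hk]
      rw [this]; simp
  have hs2 : ∑' k, volume (s k) ≠ ∞ := by
    refine ne_top_of_le_ne_top ?_ (ENNReal.tsum_le_tsum hs1)
    rw [ENNReal.tsum_mul_right]
    exact ENNReal.mul_ne_top hsum.tsum_ofReal_ne_top
      (ENNReal.mul_ne_top (ENNReal.natCast_ne_top K) ENNReal.coe_ne_top)
  filter_upwards [ae_eventually_notMem hs2, ae_integrable_cauchyKernel μ] with z hz hint hball
  rw [Metric.tendsto_nhds]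
  intro ε hε
  have h1 := tendsto_truncTransform_cauchyTransform hint
  have h2 : ∀ᶠ j : ℕ in atTop, 1 / ((j : ℝ) + 1) < δ / 2 :=
    tendsto_one_div_add_atTop_nhds_zero_nat.eventually_lt_const (by positivity)
  obtain ⟨j, hj, hjδ⟩ := (((Metric.tendsto_nhds.1 h1) (ε / 3) (by positivity)).and h2).exists
  set ρ : ℝ := 1 / ((j : ℝ) + 1) with hρ
  have hρ0 : 0 < ρ := by positivity
  have h3 := (Metric.tendsto_nhds.1 (hw.tendsto_truncTransform
    (fun k => rootMeasure_univ_le_one (hdeg k)) hρ0 z)) (ε / 3) (by positivity)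
  have h4 : Tendsto (fun k : ℕ => (2 * K : ℝ) * (2 * ((k : ℝ) + 1) ^ (-(1 / 4) : ℝ))) atTop
      (𝓝 ((2 * K : ℝ) * (2 * 0))) := by
    refine ((Tendsto.comp (tendsto_rpow_neg_atTop (by norm_num)) ?_).const_mul _).const_mul _
    exact tendsto_atTop_add_const_right _ _ tendsto_natCast_atTop_atTop
  rw [mul_zero, mul_zero] at h4
  filter_upwards [h3, hz, hK, h4.eventually_lt_const (by positivity : 0 < ε / 3),
    eventually_ge_atTop 1] with k h3k hzk hKk h4k hk1
  have hfar : ∀ ζ ∈ S k, r k ≤ ‖z - ζ‖ := by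
    intro ζ hζ
    by_contra! h
    exact hzk ⟨hKk, ζ, hζ, h⟩
  have h5 := norm_cauchyTransform_sub_truncTransform_le (φ k) (p k) (z₀ := z₀) (δ := δ) hρ0 (hrpos k)
    (by rw [mem_ball_iff_norm] at hball; linarith) hfar
  have hk0 : (0 : ℝ) < k := by exact_mod_cast hk1
  have h6 : (φ k : ℝ)⁻¹ * ((S k).card * (2 / r k)) ≤
      (2 * K : ℝ) * (2 * ((k : ℝ) + 1) ^ (-(1 / 4) : ℝ)) := by
    have hφk : (k : ℝ) ≤ φ k := by exact_mod_cast hφ.id_le k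
    have hk2 : (φ k : ℝ)⁻¹ ≤ 2 * ((k : ℝ) + 1)⁻¹ := by
      rw [← div_eq_mul_inv, le_div_iff₀ (by positivity), inv_mul_le_iff₀ (by linarith)]
      have : (1 : ℝ) ≤ k := by exact_mod_cast hk1
      linarith
    have hr1 : ((k : ℝ) + 1)⁻¹ * (2 / r k) = 2 * ((k : ℝ) + 1) ^ (-(1 / 4) : ℝ) := by
      rw [hr, div_eq_mul_inv, ← Real.rpow_neg (by positivity), ← Real.rpow_neg_one]
      rw [show (-(1 / 4) : ℝ) = -1 + - -(3 / 4) by norm_num, Real.rpow_add (by positivity)]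
      ring
    calc (φ k : ℝ)⁻¹ * ((S k).card * (2 / r k))
        ≤ 2 * ((k : ℝ) + 1)⁻¹ * (K * (2 / r k)) := by
          have := hrpos k
          gcongr
      _ = (2 * K : ℝ) * (((k : ℝ) + 1)⁻¹ * (2 / r k)) := by ring
      _ = _ := by rw [hr1]
  rw [← dist_eq_norm] at h5
  calc dist (cauchyTransform (rootMeasure (φ k) (p k)) z) (cauchyTransform μ z)
      ≤ dist (cauchyTransform (rootMeasure (φ k) (p k)) z)
          (∫ ζ, truncKernel ρ (z - ζ) ∂(rootMeasure (φ k) (p k))) +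
        dist (∫ ζ, truncKernel ρ (z - ζ) ∂(rootMeasure (φ k) (p k)))
          (∫ ζ, truncKernel ρ (z - ζ) ∂μ) +
        dist (∫ ζ, truncKernel ρ (z - ζ) ∂μ) (cauchyTransform μ z) := dist_triangle4 _ _ _ _
    _ < ε / 3 + ε / 3 + ε / 3 := by gcongr; exact h5.trans_lt (h6.trans_lt h4k)
    _ = ε := by ring

/-! ### Convergence almost everywhere -/

theorem limitCoeff_zero_eq {B : ℕ} (α : Fin (B + 1) → ℂ) (β : Fin B → ℂ) (z w : ℂ) :
    limitCoeff α β z (z * w) 0 =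
      z * ((∏ i, (z * w + α i)) - w * ∏ j, (z * w + β j)) := by
  rw [limitCoeff, coeff_zero_charFactor, coeff_zero_charFactor, Fin.prod_univ_succ (n := B)
    (f := fun i => z * w + (Fin.cons 0 β : Fin (B + 1) → ℂ) i)]
  simp only [Fin.cons_zero, Fin.cons_succ, add_zero]
  ring

/-- At a Lebesgue point outside the exceptional set either the Cauchy transforms converge, or they
converge almost everywhere in a neighbourhood; so the Lebesgue points without convergence form a
locally null set. -/
theorem ae_tendsto_cauchyTransform_hyperP {B : ℕ} {α c : Fin (B + 1) → ℂ} {β d : Fin B → ℂ}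
    (hα₀ : α 0 = -1) (hc₀ : c 0 = 0) (hα : ∀ i, α i ≠ 0) {φ : ℕ → ℕ} (hφ : StrictMono φ)
    (hdef : ∀ k, IsDefinedAt β d (φ k)) {μ : Measure ℂ} [IsFiniteMeasure μ]
    (hw : ConvergesWeakly (fun k => rootMeasure (φ k) (hyperP α c β d (φ k))) μ) :
    ∀ᵐ z : ℂ, Tendsto (fun k => cauchyTransform (rootMeasure (φ k) (hyperP α c β d (φ k))) z)
      atTop (𝓝 (cauchyTransform μ z)) := by
  obtain ⟨E, hEfin, hE⟩ := exists_finite_exceptional (α := α) (β := (Fin.cons 0 β : Fin (B + 1) → ℂ))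
    hα ⟨0, by simp⟩
  set N : Set ℂ := {z | ¬ Tendsto (fun k => cauchyTransform (rootMeasure (φ k) (hyperP α c β d (φ k))) z)
      atTop (𝓝 (cauchyTransform μ z))} with hN
  set A : Set ℂ := {z | z ≠ 0 ∧ z ∉ E ∧ IsLebesguePoint (cauchyTransform μ) z} with hA
  have hAae : ∀ᵐ z : ℂ, z ∈ A := by
    have h0 : ∀ᵐ z : ℂ, z ≠ 0 := by
      simp [ae_iff]
    have h1 : ∀ᵐ z : ℂ, z ∉ E := by
      rw [ae_iff]; simpa using hEfin.measure_zero volume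
    filter_upwards [h0, h1, ae_isLebesguePoint (locallyIntegrable_cauchyTransform μ)]
      with z a b e using ⟨a, b, e⟩
  have hloc : volume (N ∩ A) = 0 := by
    refine measure_null_of_locally_null _ fun z₀ hz₀ => ?_
    obtain ⟨hzN, hz0, hzE, hzL⟩ := hz₀
    have hz2 := limitCoeff_zero_eq_zero hα₀ hc₀ hφ hdef hw hz0 hzL
    rcases hE z₀ hzE (z₀ * cauchyTransform μ z₀) hz2 with h1 | hm
    · exact absurd (tendsto_cauchyTransform_of_simple hα₀ hc₀ hφ hdef hw hz0 hzL h1) hzN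
    · obtain ⟨δ, hδ, K, hK⟩ := exists_card_roots_le_of_common_zero hα₀ hc₀ hφ hdef hw hz0 hzL
        (min_le_left _ _) (min_le_right _ _) hm
      have h2 := hw.ae_tendsto_cauchyTransform_of_card_le hφ
        (fun k => natDegree_hyperP_le α c β d (φ k)) hδ hK
      refine ⟨(N ∩ A) ∩ Metric.ball z₀ (δ / 2), inter_mem_nhdsWithin _
        (Metric.ball_mem_nhds z₀ (by positivity)), ?_⟩
      refine measure_mono_null ?_ (ae_iff.1 h2)
      rintro z ⟨⟨hzN, -⟩, hzb⟩ h
      exact hzN (h hzb)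
  have h3 : ∀ᵐ z : ℂ, z ∉ N ∩ A := measure_eq_zero_iff_ae_notMem.1 hloc
  filter_upwards [h3, hAae] with z hz hzA
  by_contra h
  exact hz ⟨h, hzA⟩

theorem ae_cauchyTransform_algebraic {B : ℕ} {α c : Fin (B + 1) → ℂ} {β d : Fin B → ℂ}
    (hα₀ : α 0 = -1) (hc₀ : c 0 = 0) {φ : ℕ → ℕ} (hφ : StrictMono φ)
    (hdef : ∀ k, IsDefinedAt β d (φ k)) {μ : Measure ℂ} [IsFiniteMeasure μ]
    (hw : ConvergesWeakly (fun k => rootMeasure (φ k) (hyperP α c β d (φ k))) μ) :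
    ∀ᵐ z : ℂ, (∏ i, (z * cauchyTransform μ z + α i)) -
      cauchyTransform μ z * ∏ j, (z * cauchyTransform μ z + β j) = 0 := by
  have h0 : ∀ᵐ z : ℂ, z ≠ 0 := by simp [ae_iff]
  filter_upwards [h0, ae_isLebesguePoint (locallyIntegrable_cauchyTransform μ)] with z hz hzL
  have h1 := limitCoeff_zero_eq_zero hα₀ hc₀ hφ hdef hw hz hzL
  rw [limitCoeff_zero_eq] at h1
  exact (mul_eq_zero.1 h1).resolve_left hz

/-! ### Schur–Szegő composition -/

/-- The polynomial `∑ m ≤ N, C(N, m) u_m X ^ m`, in which sequences act as multipliers on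
`(1 + X) ^ N`. -/
noncomputable def binomPoly (u : ℕ → ℂ) (N : ℕ) : ℂ[X] :=
  ∑ m ∈ Finset.range (N + 1), C ((N.choose m : ℂ) * u m) * X ^ m

theorem eval_binomPoly (u : ℕ → ℂ) (N : ℕ) (y : ℂ) :
    (binomPoly u N).eval y = ∑ m ∈ Finset.range (N + 1), (N.choose m : ℂ) * u m * y ^ m := by
  simp [binomPoly, eval_finsetSum]

theorem coeff_binomPoly (u : ℕ → ℂ) (N m : ℕ) :
    (binomPoly u N).coeff m = (N.choose m : ℂ) * u m := by
  simp only [binomPoly, finsetSum_coeff, coeff_C_mul_X_pow]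
  rw [Finset.sum_ite_eq]
  split_ifs with h
  · rfl
  · rw [Nat.choose_eq_zero_of_lt (by simpa using h)]; simp

theorem natDegree_binomPoly_le (u : ℕ → ℂ) (N : ℕ) : (binomPoly u N).natDegree ≤ N := by
  refine natDegree_le_iff_coeff_eq_zero.2 fun m hm => ?_
  rw [coeff_binomPoly, Nat.choose_eq_zero_of_lt hm]; simp

theorem binomPoly_succ (u : ℕ → ℂ) (N : ℕ) :
    binomPoly u (N + 1) = binomPoly u N + X * binomPoly (fun m => u (m + 1)) N := by
  ext m
  cases m with
  | zero => simp [coeff_binomPoly]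
  | succ m =>
    rw [coeff_add, coeff_X_mul, coeff_binomPoly, coeff_binomPoly, coeff_binomPoly,
      Nat.choose_succ_succ]
    push_cast
    ring

theorem derivative_binomPoly_succ (u : ℕ → ℂ) (N : ℕ) :
    (binomPoly u (N + 1)).derivative =
      C ((N : ℂ) + 1) * binomPoly (fun m => u (m + 1)) N := by
  ext m
  rw [coeff_derivative, coeff_C_mul, coeff_binomPoly, coeff_binomPoly]
  have h : ((N + 1 : ℕ) : ℂ) * (N.choose m : ℂ) = ((N + 1).choose (m + 1) : ℂ) * ((m + 1 : ℕ) : ℂ) := by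
    exact_mod_cast Nat.add_one_mul_choose_eq N m
  push_cast at h
  linear_combination (-u (m + 1)) * h

theorem laguerre_identity (ξ e y : ℂ) (ρ : ℝ) :
    2 * ((ξ + e) * (starRingEnd ℂ) (ξ - y) * (starRingEnd ℂ) ((ρ : ℂ) ^ 2 + e * (starRingEnd ℂ) y)).re =
      ‖ξ + e‖ ^ 2 * (ρ ^ 2 - ‖y‖ ^ 2) + ‖ξ - y‖ ^ 2 * (ρ ^ 2 - ‖e‖ ^ 2) +
        (‖ξ‖ ^ 2 - ρ ^ 2) * ‖e + y‖ ^ 2 := by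
  simp only [← Complex.normSq_eq_norm_sq, Complex.normSq_apply, ← Complex.ofReal_pow, Complex.mul_re,
    Complex.mul_im, Complex.conj_re, Complex.conj_im, Complex.add_re, Complex.add_im,
    Complex.sub_re, Complex.sub_im, Complex.ofReal_re, Complex.ofReal_im]
  ring

/-- **Laguerre's theorem** on polar derivatives, for a disc: if `p` has degree at most `N` and no
zero in the disc of radius `ρ`, neither does its polar derivative with respect to a point `-e` of
the disc. After division by `p`, each zero `ξ` contributes `(ξ + e) / (ξ - y)`, and these numbers lie
in the open half-plane `Re (x * conj (ρ² + e conj y)) > 0`. -/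
theorem laguerre_polar_ne_zero {p : ℂ[X]} {N : ℕ} (hN : 1 ≤ N) (hdeg : p.natDegree ≤ N) {ρ : ℝ}
    (hp : ∀ y : ℂ, ‖y‖ < ρ → p.eval y ≠ 0) {y e : ℂ} (hy : ‖y‖ < ρ) (he : ‖e‖ < ρ) :
    N * p.eval y - (y + e) * p.derivative.eval y ≠ 0 := by
  have hpy := hp y hy
  set c : ℂ := (starRingEnd ℂ) ((ρ : ℂ) ^ 2 + e * (starRingEnd ℂ) y) with hc
  have hρ : 0 < ρ := (norm_nonneg y).trans_lt hy
  have hcpos : 0 < c.re := by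
    have h1 : |(e * (starRingEnd ℂ) y).re| ≤ ‖e‖ * ‖y‖ := by
      refine (Complex.abs_re_le_norm _).trans ?_
      rw [norm_mul, RCLike.norm_conj]
    have h2 : ‖e‖ * ‖y‖ < ρ * ρ := mul_lt_mul'' he hy (norm_nonneg _) (norm_nonneg _)
    have h3 : c.re = ρ ^ 2 + (e * (starRingEnd ℂ) y).re := by
      rw [hc, Complex.conj_re, Complex.add_re, ← Complex.ofReal_pow, Complex.ofReal_re]
    rw [h3]
    have := neg_le_of_abs_le h1
    nlinarith
  have hterm : ∀ ξ ∈ p.roots, 0 < (c * ((ξ + e) / (ξ - y))).re := by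
    intro ξ hξ
    have hξρ : ρ ≤ ‖ξ‖ := by
      by_contra! h
      exact hp ξ h (isRoot_of_mem_roots hξ)
    have hne : ξ - y ≠ 0 := by
      intro h
      rw [sub_eq_zero.1 h] at hξρ
      linarith
    have h1 := laguerre_identity ξ e y ρ
    rw [← hc] at h1
    have h2 : c * ((ξ + e) / (ξ - y)) = ((ξ + e) * (starRingEnd ℂ) (ξ - y) * c) *
        (((‖ξ - y‖ ^ 2)⁻¹ : ℝ) : ℂ) := by
      rw [div_eq_mul_inv, Complex.inv_def (ξ - y), Complex.normSq_eq_norm_sq]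
      push_cast
      ring
    rw [h2, Complex.re_mul_ofReal]
    have h3 : 0 < ‖ξ - y‖ := norm_pos_iff.2 hne
    have h4 : ‖e‖ ^ 2 < ρ ^ 2 := by gcongr
    have h5 : ‖y‖ ^ 2 < ρ ^ 2 := by gcongr
    have h6 : ρ ^ 2 ≤ ‖ξ‖ ^ 2 := by gcongr
    have h7 : 0 < ‖ξ - y‖ ^ 2 * (ρ ^ 2 - ‖e‖ ^ 2) := mul_pos (by positivity) (by linarith)
    have h8 : 0 ≤ ‖ξ + e‖ ^ 2 * (ρ ^ 2 - ‖y‖ ^ 2) := mul_nonneg (by positivity) (by linarith)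
    have h9 : 0 ≤ (‖ξ‖ ^ 2 - ρ ^ 2) * ‖e + y‖ ^ 2 := mul_nonneg (by linarith) (by positivity)
    refine mul_pos ?_ (by positivity)
    linarith
  have hsum : c * (N * p.eval y - (y + e) * p.derivative.eval y) =
      p.eval y * ((p.roots.map fun ξ => c * ((ξ + e) / (ξ - y))).sum +
        ((N - p.natDegree : ℕ) : ℂ) * c) := by
    rw [(IsAlgClosed.splits p).eval_derivative_eq_eval_mul_sum hpy, Multiset.sum_map_mul_left]
    have h1 : (p.roots.map fun ξ => (ξ + e) / (ξ - y)).sum =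
        p.natDegree - (y + e) * (p.roots.map fun ξ => 1 / (y - ξ)).sum := by
      rw [(IsAlgClosed.splits p).natDegree_eq_card_roots, ← Multiset.sum_map_mul_left]
      have h2 : (p.roots.card : ℂ) = (p.roots.map fun _ => (1 : ℂ)).sum := by simp
      rw [h2, ← Multiset.sum_map_sub]
      refine congrArg _ (Multiset.map_congr rfl fun ξ hξ => ?_)
      have hne : y - ξ ≠ 0 := by
        intro h
        exact hpy (by rw [sub_eq_zero.1 h]; exact isRoot_of_mem_roots hξ)
      have hne' : ξ - y ≠ 0 := by rwa [← neg_ne_zero, neg_sub]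
      field_simp
      ring
    rw [h1, Nat.cast_sub hdeg]
    ring
  have hre : 0 < ((p.roots.map fun ξ => c * ((ξ + e) / (ξ - y))).sum +
        ((N - p.natDegree : ℕ) : ℂ) * c).re := by
    have h1 : ((p.roots.map fun ξ => c * ((ξ + e) / (ξ - y))).sum).re =
        (p.roots.map fun ξ => (c * ((ξ + e) / (ξ - y))).re).sum := by
      have := map_multiset_sum Complex.reAddGroupHom (p.roots.map fun ξ => c * ((ξ + e) / (ξ - y)))
      rw [Multiset.map_map] at this
      exact this
    rw [Complex.add_re, h1, ← Complex.ofReal_natCast, Complex.re_ofReal_mul]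
    rcases hdeg.lt_or_eq with h | h
    · refine add_pos_of_nonneg_of_pos (Multiset.sum_nonneg ?_) (mul_pos ?_ hcpos)
      · intro x hx
        obtain ⟨ξ, hξ, rfl⟩ := Multiset.mem_map.1 hx
        exact (hterm ξ hξ).le
      · exact_mod_cast Nat.sub_pos_of_lt h
    · refine add_pos_of_pos_of_nonneg ?_ (by positivity)
      have h2 : p.roots ≠ 0 := by
        intro h0
        have := (IsAlgClosed.splits p).natDegree_eq_card_roots
        rw [h0, h] at this
        simp at this
        omega
      obtain ⟨ξ, hξ⟩ := Multiset.exists_mem_of_ne_zero h2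
      obtain ⟨S, hS⟩ := Multiset.exists_cons_of_mem hξ
      rw [hS, Multiset.map_cons, Multiset.sum_cons]
      refine add_pos_of_pos_of_nonneg (hterm ξ hξ) (Multiset.sum_nonneg ?_)
      intro x hx
      obtain ⟨ξ', hξ', rfl⟩ := Multiset.mem_map.1 hx
      exact (hterm ξ' (by rw [hS]; exact Multiset.mem_cons_of_mem hξ')).le
  intro h0
  rw [h0, mul_zero] at hsum
  have h1 := (mul_eq_zero.1 hsum.symm).resolve_left hpy
  rw [h1] at hre
  simp at hre

/-- A polynomial without zeros in the disc of radius `ρ` splits off a factor `1 - η X` with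
`|η| ρ ≤ 1`, where `η = 0` stands for a zero at infinity. -/
theorem exists_eq_one_sub_mul {q : ℂ[X]} {N : ℕ} (hdeg : q.natDegree ≤ N + 1) {ρ : ℝ} (hρ : 0 < ρ)
    (hq : ∀ y : ℂ, ‖y‖ < ρ → q.eval y ≠ 0) :
    ∃ (η : ℂ) (q' : ℂ[X]), q = (1 - C η * X) * q' ∧ q'.natDegree ≤ N ∧ ‖η‖ * ρ ≤ 1 := by
  rcases hdeg.lt_or_eq with h | h
  · exact ⟨0, q, by simp, by omega, by simp⟩
  · obtain ⟨ζ, hζ⟩ := IsAlgClosed.exists_root q (by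
      intro h0
      have : q.natDegree = 0 := natDegree_eq_of_degree_eq_some h0
      omega)
    have hζρ : ρ ≤ ‖ζ‖ := by
      by_contra! h1
      exact hq ζ h1 hζ
    have hζ0 : ζ ≠ 0 := norm_pos_iff.1 (hρ.trans_le hζρ)
    obtain ⟨q', hq'⟩ := dvd_iff_isRoot.2 hζ
    have hq0 : q' ≠ 0 := by
      rintro rfl
      rw [mul_zero] at hq'
      rw [hq'] at h
      simp at h
    refine ⟨ζ⁻¹, C (-ζ) * q', ?_, ?_, ?_⟩
    · rw [hq', ← mul_assoc]
      congr 1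
      have h2 : C ζ⁻¹ * C ζ = (1 : ℂ[X]) := by rw [← C_mul, inv_mul_cancel₀ hζ0, C_1]
      rw [C_neg]
      linear_combination (-X) * h2
    · have h2 : q.natDegree = 1 + q'.natDegree := by
        conv_lhs => rw [hq']
        rw [natDegree_mul (X_sub_C_ne_zero ζ) hq0, natDegree_X_sub_C]
      exact (natDegree_C_mul_le _ _).trans (by omega)
    · rw [norm_inv, inv_mul_le_iff₀ (norm_pos_iff.2 hζ0), mul_one]
      exact hζρ

/-- Schur–Szegő composition, by induction on the degree: splitting a factor `1 - η X` off `q` turns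
the other polynomial into a polar derivative. -/
theorem sum_mul_coeff_ne_zero {ρ₁ ρ₂ : ℝ} (hρ₁ : 0 < ρ₁) (hρ₂ : 0 < ρ₂) (N : ℕ) {x : ℂ}
    (hx : ‖x‖ < ρ₁ * ρ₂) : ∀ (u : ℕ → ℂ) (q : ℂ[X]),
    (∀ y : ℂ, ‖y‖ < ρ₁ → (binomPoly u N).eval y ≠ 0) → q.natDegree ≤ N →
    (∀ y : ℂ, ‖y‖ < ρ₂ → q.eval y ≠ 0) →
    ∑ m ∈ Finset.range (N + 1), u m * q.coeff m * x ^ m ≠ 0 := by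
  induction N with
  | zero =>
    intro u q hu hdeg hq
    have h1 := hu 0 (by simpa using hρ₁)
    have h2 := hq 0 (by simpa using hρ₂)
    rw [← coeff_zero_eq_eval_zero] at h1 h2
    rw [coeff_binomPoly] at h1
    simpa using ⟨by simpa using h1, h2⟩
  | succ N ih =>
    intro u q hu hdeg hq
    obtain ⟨η, q', hqq', hdeg', hη⟩ := exists_eq_one_sub_mul hdeg hρ₂ hq
    have he : ‖η * x‖ < ρ₁ := by
      rw [norm_mul]
      rcases (norm_nonneg η).eq_or_lt with h | h
      · rw [← h, zero_mul]; exact hρ₁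
      · calc ‖η‖ * ‖x‖ < ‖η‖ * (ρ₁ * ρ₂) := by gcongr
          _ = ρ₁ * (‖η‖ * ρ₂) := by ring
          _ ≤ ρ₁ * 1 := by gcongr
          _ = ρ₁ := mul_one _
    have h1 := ih (fun m => u m - η * x * u (m + 1)) q' (fun y hy => by
      have h2 := laguerre_polar_ne_zero (N := N + 1) (by omega) (natDegree_binomPoly_le u (N + 1)) hu hy he
      have h3 : (binomPoly (fun m => u m - η * x * u (m + 1)) N).eval y =
          (binomPoly u N).eval y - η * x * (binomPoly (fun m => u (m + 1)) N).eval y := by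
        rw [eval_binomPoly, eval_binomPoly, eval_binomPoly, Finset.mul_sum, ← Finset.sum_sub_distrib]
        exact Finset.sum_congr rfl fun m _ => by ring
      rw [derivative_binomPoly_succ, binomPoly_succ] at h2
      simp only [eval_add, eval_mul, eval_X, eval_C] at h2
      intro h4
      rw [h3] at h4
      apply h2
      push_cast
      linear_combination ((N : ℂ) + 1) * h4) hdeg' (fun y hy h2 => by
        apply hq y hy
        rw [hqq', eval_mul, h2, mul_zero])
    have h4 : q'.coeff (N + 1) = 0 := coeff_eq_zero_of_natDegree_lt (by omega)
    have h5 : ∀ m, q.coeff (m + 1) = q'.coeff (m + 1) - η * q'.coeff m := by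
      intro m
      rw [hqq', sub_mul, one_mul, coeff_sub, mul_assoc, coeff_C_mul, coeff_X_mul]
    have h6 : q.coeff 0 = q'.coeff 0 := by
      rw [hqq', sub_mul, one_mul, coeff_sub, mul_assoc, coeff_C_mul]
      simp
    convert h1 using 1
    rw [Finset.sum_range_succ']
    simp only [h5, h6]
    have h7 : ∑ m ∈ Finset.range (N + 1), u (m + 1) * q'.coeff (m + 1) * x ^ (m + 1) +
        u 0 * q'.coeff 0 * x ^ 0 = ∑ m ∈ Finset.range (N + 1), u m * q'.coeff m * x ^ m := by
      rw [← Finset.sum_range_succ' (fun m => u m * q'.coeff m * x ^ m), Finset.sum_range_succ, h4]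
      simp
    have h8 : ∑ m ∈ Finset.range (N + 1), (u m - η * x * u (m + 1)) * q'.coeff m * x ^ m =
        ∑ m ∈ Finset.range (N + 1), u m * q'.coeff m * x ^ m -
          ∑ m ∈ Finset.range (N + 1), u (m + 1) * (η * q'.coeff m) * x ^ (m + 1) := by
      rw [← Finset.sum_sub_distrib]
      exact Finset.sum_congr rfl fun m _ => by ring
    rw [h8, ← h7, ← Finset.sum_congr rfl fun m _ => (show u (m + 1) * q'.coeff (m + 1) * x ^ (m + 1) -
      u (m + 1) * (η * q'.coeff m) * x ^ (m + 1) = u (m + 1) * (q'.coeff (m + 1) - η * q'.coeff m) *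
        x ^ (m + 1) by ring), Finset.sum_sub_distrib]
    ring

/-- The **Schur–Szegő composition theorem** for discs centred at `0`. -/
theorem eval_binomPoly_mul_ne_zero {ρ₁ ρ₂ : ℝ} (hρ₁ : 0 < ρ₁) (hρ₂ : 0 < ρ₂) {N : ℕ} {u v : ℕ → ℂ}
    (hu : ∀ y : ℂ, ‖y‖ < ρ₁ → (binomPoly u N).eval y ≠ 0)
    (hv : ∀ y : ℂ, ‖y‖ < ρ₂ → (binomPoly v N).eval y ≠ 0) {x : ℂ} (hx : ‖x‖ < ρ₁ * ρ₂) :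
    (binomPoly (fun m => u m * v m) N).eval x ≠ 0 := by
  have h := sum_mul_coeff_ne_zero hρ₁ hρ₂ N hx u (binomPoly v N) hu (natDegree_binomPoly_le v N) hv
  rw [eval_binomPoly]
  convert h using 2 with m
  rw [coeff_binomPoly]
  ring

theorem eval_binomPoly_prod_ne_zero {ι : Type*} (s : Finset ι) {ρ : ι → ℝ} (hρ : ∀ i, 0 < ρ i)
    {N : ℕ} {u : ι → ℕ → ℂ}
    (hu : ∀ i ∈ s, ∀ y : ℂ, ‖y‖ < ρ i → (binomPoly (u i) N).eval y ≠ 0) :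
    ∀ x : ℂ, ‖x‖ < ∏ i ∈ s, ρ i → (binomPoly (fun m => ∏ i ∈ s, u i m) N).eval x ≠ 0 := by
  classical
  induction s using Finset.induction_on with
  | empty =>
    intro x hx
    have h1 : (binomPoly (fun _ => 1) N).eval x = (x + 1) ^ N := by
      rw [eval_binomPoly, add_pow]
      exact Finset.sum_congr rfl fun m _ => by simp; ring
    simp only [Finset.prod_empty] at hx ⊢
    rw [h1]
    refine pow_ne_zero _ fun h => ?_
    rw [eq_neg_of_add_eq_zero_left h] at hx
    simp at hx
  | insert i s his ih =>
    intro x hx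
    rw [Finset.prod_insert his] at hx
    simp only [Finset.prod_insert his]
    exact eval_binomPoly_mul_ne_zero (hρ i) (Finset.prod_pos fun j _ => hρ j)
      (hu i (Finset.mem_insert_self i s)) (ih fun j hj => hu j (Finset.mem_insert_of_mem hj)) hx

/-! ### Multipliers given by falling factorials -/

/-- The falling factorial `x (x - 1) ⋯ (x - m + 1)`. -/
def fallingFactorial (x : ℂ) (m : ℕ) : ℂ := ∏ l ∈ Finset.range m, (x - l)

theorem fallingFactorial_zero (x : ℂ) : fallingFactorial x 0 = 1 := by simp [fallingFactorial]

theorem fallingFactorial_succ (x : ℂ) (m : ℕ) :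
    fallingFactorial x (m + 1) = fallingFactorial x m * (x - m) := by
  rw [fallingFactorial, Finset.prod_range_succ, ← fallingFactorial]

theorem fallingFactorial_succ' (x : ℂ) (m : ℕ) :
    fallingFactorial x (m + 1) = x * fallingFactorial (x - 1) m := by
  rw [fallingFactorial, Finset.prod_range_succ', fallingFactorial, mul_comm]
  congr 1
  · simp
  · exact Finset.prod_congr rfl fun l _ => by push_cast; ring

theorem fallingFactorial_ne_zero {x : ℂ} {m : ℕ} (h : ∀ l < m, x - (l : ℂ) ≠ 0) :
    fallingFactorial x m ≠ 0 :=
  Finset.prod_ne_zero_iff.2 fun l hl => h l (Finset.mem_range.1 hl)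

theorem eval_binomPoly_succ (u : ℕ → ℂ) (N : ℕ) (y : ℂ) :
    (binomPoly u (N + 1)).eval y =
      (binomPoly u N).eval y + y * (binomPoly (fun m => u (m + 1)) N).eval y := by
  rw [binomPoly_succ, eval_add, eval_mul, eval_X]

theorem eval_binomPoly_natCast_mul (u : ℕ → ℂ) (N : ℕ) (y : ℂ) :
    (binomPoly (fun m => m * u m) (N + 1)).eval y =
      (N + 1) * y * (binomPoly (fun m => u (m + 1)) N).eval y := by
  rw [eval_binomPoly, Finset.sum_range_succ', eval_binomPoly, Finset.mul_sum]
  simp only [Nat.cast_zero, zero_mul, mul_zero, add_zero]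
  refine Finset.sum_congr rfl fun m _ => ?_
  have h : ((N + 1 : ℕ) : ℂ) * (N.choose m : ℂ) = ((N + 1).choose (m + 1) : ℂ) * ((m + 1 : ℕ) : ℂ) := by
    exact_mod_cast Nat.add_one_mul_choose_eq N m
  push_cast at h ⊢
  linear_combination (-u (m + 1) * y ^ (m + 1)) * h

theorem eval_binomPoly_congr {u v : ℕ → ℂ} {N : ℕ} (h : ∀ m ≤ N, u m = v m) (y : ℂ) :
    (binomPoly u N).eval y = (binomPoly v N).eval y := by
  rw [eval_binomPoly, eval_binomPoly]
  exact Finset.sum_congr rfl fun m hm => by rw [h m (by simpa [Nat.lt_succ_iff] using hm)]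

/-- `∑ C(N, m) (b)(b-1)⋯(b-m+1) h ^ m` does not vanish for small `h`: these sums satisfy
`V_{N+2} = (1 + h b - h (N+1)) V_{N+1} + (N+1) h V_N`, so that consecutive ones are comparable. -/
theorem eval_binomPoly_fallingFactorial_ne_zero {b h : ℂ} {M : ℝ} (hb : ‖h‖ * ‖b‖ ≤ 1 / 8)
    (hM : ‖h‖ * M ≤ 1 / 8) {N : ℕ} (hN : (N : ℝ) ≤ M) :
    (binomPoly (fallingFactorial b) N).eval h ≠ 0 := by
  have key : ∀ K : ℕ, ((K + 1 : ℕ) : ℝ) ≤ M → (binomPoly (fallingFactorial b) K).eval h ≠ 0 ∧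
      ‖(binomPoly (fallingFactorial b) K).eval h‖ ≤
        2 * ‖(binomPoly (fallingFactorial b) (K + 1)).eval h‖ := by
    have hrec : ∀ K : ℕ, (binomPoly (fallingFactorial b) (K + 1)).eval h =
        (1 + h * b) * (binomPoly (fallingFactorial b) K).eval h -
          h * (binomPoly (fun m => m * fallingFactorial b m) K).eval h := by
      intro K
      rw [eval_binomPoly_succ, eval_binomPoly, eval_binomPoly, eval_binomPoly, Finset.mul_sum,
        Finset.mul_sum, Finset.mul_sum, ← Finset.sum_add_distrib, ← Finset.sum_sub_distrib]
      refine Finset.sum_congr rfl fun m _ => ?_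
      rw [fallingFactorial_succ]
      ring
    have h0 : (binomPoly (fallingFactorial b) 0).eval h = 1 := by
      simp [eval_binomPoly, fallingFactorial_zero]
    intro K
    induction K with
    | zero =>
      intro hK
      refine ⟨by rw [h0]; exact one_ne_zero, ?_⟩
      rw [hrec, h0]
      have h1 : (binomPoly (fun m => m * fallingFactorial b m) 0).eval h = 0 := by
        simp [eval_binomPoly]
      rw [h1, norm_one]
      have h2 : ‖h * b‖ ≤ 1 / 8 := by rwa [norm_mul]
      have h3 := norm_sub_le ((1 + h * b) * 1 - h * 0) (h * b)
      rw [show (1 + h * b) * 1 - h * 0 - h * b = 1 by ring, norm_one] at h3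
      linarith
    | succ K ih =>
      intro hK
      obtain ⟨ih0, ih1⟩ := ih (le_trans (by push_cast; linarith) hK)
      set V := (binomPoly (fallingFactorial b) K).eval h
      set V' := (binomPoly (fallingFactorial b) (K + 1)).eval h with hV'
      have hV'0 : 0 < ‖V'‖ := by
        have := norm_pos_iff.2 ih0
        linarith
      refine ⟨norm_pos_iff.1 hV'0, ?_⟩
      have h1 : (binomPoly (fallingFactorial b) (K + 1 + 1)).eval h =
          V' + (h * b * V' - h * (K + 1) * (V' - V)) := by
        rw [hrec (K + 1), eval_binomPoly_natCast_mul]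
        have h2 := eval_binomPoly_succ (fallingFactorial b) K h
        rw [← hV'] at h2 ⊢
        linear_combination (h * (K + 1)) * h2
      rw [h1]
      have h2 : ‖h‖ * ((K : ℝ) + 1) ≤ 1 / 8 := by
        refine le_trans ?_ hM
        gcongr
        push_cast at hK
        linarith
      have h3 : ‖h * b * V' - h * (K + 1) * (V' - V)‖ ≤ 1 / 2 * ‖V'‖ := by
        have e1 : ‖h * b * V'‖ ≤ 1 / 8 * ‖V'‖ := by
          rw [norm_mul, norm_mul]; gcongr
        have e2 : ‖h * ((K : ℂ) + 1) * (V' - V)‖ ≤ 1 / 8 * (3 * ‖V'‖) := by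
          rw [norm_mul, norm_mul]
          have e3 : ‖(K : ℂ) + 1‖ = (K : ℝ) + 1 := by
            rw [← Nat.cast_succ, Complex.norm_natCast]; push_cast; ring
          rw [e3]
          have e4 := norm_sub_le V' V
          gcongr
          linarith
        have := norm_sub_le (h * b * V') (h * (K + 1) * (V' - V))
        linarith
      have h4 := norm_sub_le (V' + (h * b * V' - h * (K + 1) * (V' - V)))
        (h * b * V' - h * (K + 1) * (V' - V))
      rw [add_sub_cancel_right] at h4
      linarith
  rcases N with _ | N
  · simp [eval_binomPoly, fallingFactorial_zero]
  · obtain ⟨h1, h2⟩ := key N hN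
    rw [← norm_pos_iff] at h1 ⊢
    linarith

/-- `∑ C(N, m) h ^ m / (a (a-1)⋯(a-m+1))` does not vanish if `a` keeps a distance comparable to `N`
from `0, …, N` and `h` is small: two contiguity relations compare the sums for `a` and `a - 1`. -/
theorem eval_binomPoly_inv_fallingFactorial_ne_zero {h : ℂ} {D : ℝ} (hD : 0 < D) {M : ℝ}
    (h1 : ‖h‖ ≤ D / 4) (h2 : M * ‖h‖ ≤ D ^ 2 / 8) (N : ℕ) : ∀ a : ℂ, (N : ℝ) ≤ M →
    (∀ l ≤ N, D ≤ ‖a - (l : ℂ)‖) →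
    (binomPoly (fun m => (fallingFactorial a m)⁻¹) N).eval h ≠ 0 ∧
      ‖(binomPoly (fun m => (fallingFactorial (a - 1) m)⁻¹) N).eval h‖ ≤
        2 * ‖(binomPoly (fun m => (fallingFactorial a m)⁻¹) N).eval h‖ := by
  induction N with
  | zero => intro a _ _; simp [eval_binomPoly, fallingFactorial_zero]
  | succ N ih =>
    intro a hNM ha
    obtain ⟨ih0, ih1⟩ := ih (a - 1) (le_trans (by push_cast; linarith) hNM) (fun l hl => by
      have := ha (l + 1) (by omega)
      rwa [sub_sub, add_comm (1 : ℂ), ← Nat.cast_succ])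
    set x := (binomPoly (fun m => (fallingFactorial (a - 1) m)⁻¹) N).eval h with hx
    set y := (binomPoly (fun m => (fallingFactorial (a - 1 - 1) m)⁻¹) N).eval h with hy
    set T := (binomPoly (fun m => (fallingFactorial (a - 1) m)⁻¹) (N + 1)).eval h with hT
    have ha0 : D ≤ ‖a‖ := by simpa using ha 0 (by omega)
    have ha1 : D ≤ ‖a - 1‖ := by simpa using ha 1 (by omega)
    have hpascal : T = x + h * (a - 1)⁻¹ * y := by
      rw [hT, eval_binomPoly_succ, mul_assoc]
      congr 2
      rw [hy, eval_binomPoly, eval_binomPoly, Finset.mul_sum]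
      refine Finset.sum_congr rfl fun m _ => ?_
      rw [fallingFactorial_succ', mul_inv]
      ring
    have hcont : (binomPoly (fun m => (fallingFactorial a m)⁻¹) (N + 1)).eval h =
        T - (N + 1) * h * (a⁻¹ * (a - 1)⁻¹) * y := by
      have e1 : ∀ m ≤ N + 1, (fallingFactorial a m)⁻¹ = (fallingFactorial (a - 1) m)⁻¹ -
          m * (a⁻¹ * (fallingFactorial (a - 1) m)⁻¹) := by
        intro m hm
        have f1 := fallingFactorial_succ a m
        have f2 := fallingFactorial_succ' a m
        have hane : a ≠ 0 := norm_pos_iff.1 (hD.trans_le ha0)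
        have hA : fallingFactorial a m ≠ 0 := fallingFactorial_ne_zero fun l hl =>
          norm_pos_iff.1 (hD.trans_le (ha l (by omega)))
        have hA' : fallingFactorial (a - 1) m ≠ 0 := by
          have : fallingFactorial a (m + 1) ≠ 0 := by
            rw [f1]
            exact mul_ne_zero hA (norm_pos_iff.1 (hD.trans_le (ha m hm)))
          rw [f2] at this
          exact right_ne_zero_of_mul this
        rw [f1] at f2
        field_simp
        linear_combination -f2
      rw [eval_binomPoly_congr e1, hT]
      have e2 : (N + 1) * h * (a⁻¹ * (a - 1)⁻¹) * y =
          (binomPoly (fun m => m * (a⁻¹ * (fallingFactorial (a - 1) m)⁻¹)) (N + 1)).eval h := by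
        rw [eval_binomPoly_natCast_mul, hy, eval_binomPoly, eval_binomPoly, Finset.mul_sum,
          Finset.mul_sum]
        refine Finset.sum_congr rfl fun m _ => ?_
        rw [fallingFactorial_succ', mul_inv]
        ring
      rw [e2, eval_binomPoly, eval_binomPoly, eval_binomPoly, ← Finset.sum_sub_distrib]
      exact Finset.sum_congr rfl fun m _ => by ring
    have n1 : ‖h * (a - 1)⁻¹‖ ≤ 1 / 4 := by
      rw [norm_mul, norm_inv, ← div_eq_mul_inv, div_le_iff₀ (by linarith)]
      linarith
    have n2 : ‖((N : ℂ) + 1) * h * (a⁻¹ * (a - 1)⁻¹)‖ ≤ 1 / 8 := by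
      have e3 : ‖(N : ℂ) + 1‖ = (N : ℝ) + 1 := by
        rw [← Nat.cast_succ, Complex.norm_natCast]; push_cast; ring
      rw [norm_mul, norm_mul, norm_mul, norm_inv, norm_inv, ← mul_inv, ← div_eq_mul_inv, e3,
        div_le_iff₀ (by nlinarith)]
      push_cast at hNM
      have e4 : D ^ 2 ≤ ‖a‖ * ‖a - 1‖ := by rw [pow_two]; gcongr
      have e5 : ((N : ℝ) + 1) * ‖h‖ ≤ M * ‖h‖ := by gcongr
      linarith
    have hx0 := norm_pos_iff.2 ih0
    clear_value x y T
    generalize (binomPoly (fun m => (fallingFactorial a m)⁻¹) (N + 1)).eval h = W at hcont ⊢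
    have t1 : ‖x‖ ≤ ‖T‖ + 1 / 4 * ‖y‖ := by
      have e6 : ‖h * (a - 1)⁻¹ * y‖ ≤ 1 / 4 * ‖y‖ := by
        rw [norm_mul]
        exact mul_le_mul_of_nonneg_right n1 (norm_nonneg y)
      have e7 : x = T - h * (a - 1)⁻¹ * y := by rw [hpascal]; ring
      have e8 := norm_sub_le T (h * (a - 1)⁻¹ * y)
      rw [← e7] at e8
      linarith
    have t2 : ‖T‖ ≤ ‖W‖ + 1 / 8 * ‖y‖ := by
      have e6 : ‖((N : ℂ) + 1) * h * (a⁻¹ * (a - 1)⁻¹) * y‖ ≤ 1 / 8 * ‖y‖ := by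
        rw [norm_mul _ y]
        exact mul_le_mul_of_nonneg_right n2 (norm_nonneg y)
      have e7 : T = W + (N + 1) * h * (a⁻¹ * (a - 1)⁻¹) * y := by rw [hcont]; ring
      have e8 := norm_add_le W ((N + 1) * h * (a⁻¹ * (a - 1)⁻¹) * y)
      rw [← e7] at e8
      linarith
    refine ⟨norm_pos_iff.1 ?_, ?_⟩ <;> linarith

/-! ### A uniform bound for the zeros -/

theorem eval_ascPochhammer_add (x : ℂ) (k m : ℕ) :
    (ascPochhammer ℂ (k + m)).eval x =
      (ascPochhammer ℂ k).eval x * fallingFactorial (x + ((k + m : ℕ) : ℂ) - 1) m := by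
  induction m with
  | zero => simp [fallingFactorial_zero]
  | succ m ih =>
    rw [← add_assoc, ascPochhammer_succ_eval, ih, fallingFactorial_succ']
    have h1 : x + ((k + m + 1 : ℕ) : ℂ) - 1 = x + ((k + m : ℕ) : ℂ) := by push_cast; ring
    rw [h1]
    ring

theorem eval_ascPochhammer_neg_natCast (n k : ℕ) :
    (ascPochhammer ℂ k).eval (-(n : ℂ)) = (-1) ^ k * (k.factorial * n.choose k) := by
  rw [ascPochhammer_eval_neg_eq_descPochhammer, descPochhammer_eval_eq_descFactorial,
    Nat.descFactorial_eq_factorial_mul_choose]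
  push_cast
  ring

/-- The multipliers of the reversed polynomial: up to a constant, the coefficient of `z ^ (n - m)` in
`p_n` is `(-1) ^ m C(n, m)` times the `m`-th multiplier, see `hypergeomCoeff_eq_reversedSeq`. The parameter
`a 0 = -n` accounts for the binomial coefficient. -/
noncomputable def reversedSeq {B : ℕ} (a : Fin (B + 1) → ℂ) (b : Fin B → ℂ) (n m : ℕ) : ℂ :=
  ∏ j, (fallingFactorial (b j + n - 1) m * (fallingFactorial (a j.succ + n - 1) m)⁻¹)

/-- Read from the top coefficient downwards, the hypergeometric coefficients are falling
factorials. -/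
theorem hypergeomCoeff_eq_reversedSeq {B : ℕ} {a : Fin (B + 1) → ℂ} {b : Fin B → ℂ} {n : ℕ}
    (ha0 : a 0 = -(n : ℂ)) (hb : ∀ j, (ascPochhammer ℂ n).eval (b j) ≠ 0) {k m : ℕ} (hkm : k + m = n)
    (ha : ∀ j : Fin B, fallingFactorial (a j.succ + n - 1) m ≠ 0) :
    hypergeomCoeff a b k = (-1) ^ n * ((∏ j : Fin B, (ascPochhammer ℂ n).eval (a j.succ)) /
      ∏ j, (ascPochhammer ℂ n).eval (b j)) * (n.choose m * reversedSeq a b n m * (-1) ^ m) := by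
  subst hkm
  have hfac : (k.factorial : ℂ) ≠ 0 := by exact_mod_cast k.factorial_ne_zero
  have hb1 : ∀ j, (ascPochhammer ℂ k).eval (b j) ≠ 0 := fun j h => by
    apply hb j
    rw [eval_ascPochhammer_add, h, zero_mul]
  have hb2 : ∀ j, fallingFactorial (b j + ((k + m : ℕ) : ℂ) - 1) m ≠ 0 := fun j h => by
    apply hb j
    rw [eval_ascPochhammer_add, h, mul_zero]
  have h1 : ∏ j : Fin B, (ascPochhammer ℂ (k + m)).eval (a j.succ) =
      (∏ j : Fin B, (ascPochhammer ℂ k).eval (a j.succ)) *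
        ∏ j : Fin B, fallingFactorial (a j.succ + ((k + m : ℕ) : ℂ) - 1) m := by
    rw [← Finset.prod_mul_distrib]
    exact Finset.prod_congr rfl fun j _ => eval_ascPochhammer_add _ _ _
  have h2 : ∏ j, (ascPochhammer ℂ (k + m)).eval (b j) = (∏ j, (ascPochhammer ℂ k).eval (b j)) *
        ∏ j, fallingFactorial (b j + ((k + m : ℕ) : ℂ) - 1) m := by
    rw [← Finset.prod_mul_distrib]
    exact Finset.prod_congr rfl fun j _ => eval_ascPochhammer_add _ _ _
  have h3 : (k + m).choose m = (k + m).choose k := by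
    rw [← Nat.choose_symm_of_eq_add rfl]
  have p1 : ∏ j, (ascPochhammer ℂ k).eval (b j) ≠ 0 := Finset.prod_ne_zero_iff.2 fun j _ => hb1 j
  have p2 : ∏ j, fallingFactorial (b j + ((k + m : ℕ) : ℂ) - 1) m ≠ 0 :=
    Finset.prod_ne_zero_iff.2 fun j _ => hb2 j
  have p3 : ∏ j : Fin B, fallingFactorial (a j.succ + ((k + m : ℕ) : ℂ) - 1) m ≠ 0 :=
    Finset.prod_ne_zero_iff.2 fun j _ => ha j
  rw [hypergeomCoeff, Fin.prod_univ_succ, ha0, eval_ascPochhammer_neg_natCast, h1, h2, h3, reversedSeq,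
    Finset.prod_mul_distrib, Finset.prod_inv_distrib]
  have h4 : ((-1 : ℂ)) ^ (k + m) * (-1) ^ m = (-1) ^ k := by
    rw [pow_add, mul_assoc, ← mul_pow]; simp
  generalize ∏ j, (ascPochhammer ℂ k).eval (b j) = u1 at *
  generalize ∏ j, fallingFactorial (b j + ((k + m : ℕ) : ℂ) - 1) m = u2 at *
  generalize ∏ j : Fin B, fallingFactorial (a j.succ + ((k + m : ℕ) : ℂ) - 1) m = u3 at *
  rw [← h4]
  field_simp

theorem eval_hypergeomPoly_eq_reversed {B : ℕ} {a : Fin (B + 1) → ℂ} {b : Fin B → ℂ} {n : ℕ}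
    (ha0 : a 0 = -(n : ℂ)) (hb : ∀ j, (ascPochhammer ℂ n).eval (b j) ≠ 0)
    (ha : ∀ j : Fin B, ∀ m ≤ n, fallingFactorial (a j.succ + n - 1) m ≠ 0) {z : ℂ} (hz : z ≠ 0) :
    (hypergeomPoly a b n).eval z = (-1) ^ n * ((∏ j : Fin B, (ascPochhammer ℂ n).eval (a j.succ)) /
      ∏ j, (ascPochhammer ℂ n).eval (b j)) * z ^ n * (binomPoly (reversedSeq a b n) n).eval (-z⁻¹) := by
  rw [eval_hypergeomPoly, eval_binomPoly, ← Finset.sum_range_reflect, Finset.mul_sum]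
  refine Finset.sum_congr rfl fun m hm => ?_
  have hm' : m ≤ n := by simpa [Nat.lt_succ_iff] using hm
  have e : n + 1 - 1 - m = n - m := by omega
  rw [e, hypergeomCoeff_eq_reversedSeq ha0 hb (Nat.sub_add_cancel hm') (fun j => ha j m hm')]
  have h1 : z ^ n * (z⁻¹) ^ m = z ^ (n - m) := by
    rw [← Nat.sub_add_cancel hm', pow_add, mul_assoc, ← mul_pow, mul_inv_cancel₀ hz]; simp
  rw [← h1, neg_pow z⁻¹ m]
  ring

/-- The number `a + n - 1` with `a = α n + c` is close to `(α + 1) n`, and `α + 1` does not lie in the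
interval `[0, 1]`, which contains the points `l / n`. -/
theorem exists_pos_le_norm_add_sub {α c : ℂ} (hα : ∀ t : ℝ, t ≤ 1 → -α ≠ (t : ℂ)) :
    ∃ δ > 0, ∀ᶠ n : ℕ in atTop, ∀ l : ℕ, l ≤ n → δ * n ≤ ‖α * n + c + n - 1 - l‖ := by
  have hcont : ContinuousOn (fun t : ℝ => ‖α + 1 - t‖) (Set.Icc 0 1) := by fun_prop
  obtain ⟨t₀, ht₀, hmin⟩ := isCompact_Icc.exists_isMinOn ⟨0, by simp⟩ hcont
  have hpos : 0 < ‖α + 1 - t₀‖ := by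
    rw [norm_pos_iff]
    intro h
    apply hα (1 - t₀) (by linarith [ht₀.1])
    push_cast
    linear_combination -h
  refine ⟨‖α + 1 - t₀‖ / 2, by positivity, ?_⟩
  filter_upwards [tendsto_natCast_atTop_atTop.eventually_ge_atTop (‖c - 1‖ / (‖α + 1 - t₀‖ / 2)),
    eventually_ge_atTop 1] with n hn hn1 l hl
  rw [div_le_iff₀ (by positivity)] at hn
  have hn0 : (0 : ℝ) < n := by exact_mod_cast hn1
  have hnC : (n : ℂ) ≠ 0 := by exact_mod_cast hn0.ne'
  have h1 : ‖α + 1 - t₀‖ ≤ ‖α + 1 - ((l / n : ℝ) : ℂ)‖ :=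
    hmin ⟨by positivity, by rw [div_le_one hn0]; exact_mod_cast hl⟩
  have h2 : α * n + c + n - 1 - l = n * (α + 1 - ((l / n : ℝ) : ℂ)) + (c - 1) := by
    push_cast
    field_simp
    ring
  have h3 := norm_sub_le (α * n + c + n - 1 - l) (c - 1)
  rw [h2, add_sub_cancel_right, norm_mul, Complex.norm_natCast, ← h2] at h3
  have h4 : n * ‖α + 1 - t₀‖ ≤ n * ‖α + 1 - ((l / n : ℝ) : ℂ)‖ := by gcongr
  linarith

theorem eval_ascPochhammer_ne_zero_of_isDefinedAt {B : ℕ} {β d : Fin B → ℂ} {n : ℕ}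
    (h : IsDefinedAt β d n) (j : Fin B) (k : ℕ) :
    (ascPochhammer ℂ k).eval (β j * n + d j + 1) ≠ 0 := by
  induction k with
  | zero => simp
  | succ k ih =>
    rw [ascPochhammer_succ_eval]
    exact mul_ne_zero ih fun h0 => h j k (eq_neg_of_add_eq_zero_left h0)

/-- The zeros of `p_n` are uniformly bounded for large `n`, and `p_n` has degree `n`. The reversed
polynomial is a Schur–Szegő composition of factors whose zeros have modulus at least of the order
`1 / n` (from the denominator parameters) and `n` (from the numerator parameters); there are equally
many of both kinds. -/
theorem exists_bound_roots_hyperP {B : ℕ} {α c : Fin (B + 1) → ℂ} {β d : Fin B → ℂ}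
    (hα₀ : α 0 = -1) (hc₀ : c 0 = 0) (hα : IsGeneralType α) :
    ∃ R : ℝ, ∀ᶠ n in atTop, IsDefinedAt β d n → (hyperP α c β d n).natDegree = n ∧
      ∀ z : ℂ, (hyperP α c β d n).eval z = 0 → ‖z‖ ≤ R := by
  choose δ hδ hδn using fun j : Fin B => exists_pos_le_norm_add_sub (α := α j.succ) (c := c j.succ)
    (hα.2 j.succ (Fin.succ_ne_zero j))
  set ε : Fin B → ℝ := fun j => min (δ j / 4) (δ j ^ 2 / 8) with hε
  have hε0 : ∀ j, 0 < ε j := fun j => lt_min (by have := hδ j; positivity) (by have := hδ j; positivity)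
  set M : Fin B → ℝ := fun j => ‖β j‖ + 1 + ‖d j‖ with hM
  have hM1 : ∀ j, 1 ≤ M j := fun j => by
    have := norm_nonneg (β j); have := norm_nonneg (d j); simp only [hM]; linarith
  have hM0 : ∀ j, 0 < M j := fun j => one_pos.trans_le (hM1 j)
  set ρ : Fin B → ℝ := fun j => ε j / (8 * M j) with hρ
  have hρ0 : ∀ j, 0 < ρ j := fun j => by have := hM0 j; have := hε0 j; positivity
  have hP : 0 < ∏ j, ρ j := Finset.prod_pos fun j _ => hρ0 j
  refine ⟨(∏ j, ρ j)⁻¹, ?_⟩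
  filter_upwards [eventually_all.2 hδn, eventually_ge_atTop 1] with n hn hn1 hdef
  have hn0 : (0 : ℝ) < n := by exact_mod_cast hn1
  set a : Fin (B + 1) → ℂ := fun i => α i * n + c i with ha
  set b : Fin B → ℂ := fun j => β j * n + d j + 1 with hb
  have ha0 : a 0 = -(n : ℂ) := by simp [ha, hα₀, hc₀]
  have hbne : ∀ j k, (ascPochhammer ℂ k).eval (b j) ≠ 0 :=
    eval_ascPochhammer_ne_zero_of_isDefinedAt hdef
  have hane : ∀ j : Fin B, ∀ m ≤ n, fallingFactorial (a j.succ + n - 1) m ≠ 0 := by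
    intro j m hm
    refine fallingFactorial_ne_zero fun l hl => norm_pos_iff.1 ?_
    exact (mul_pos (hδ j) hn0).trans_le (hn j l (by omega))
  have hane' : ∀ j : Fin B, (ascPochhammer ℂ n).eval (a j.succ) ≠ 0 := by
    intro j
    have h1 := eval_ascPochhammer_add (a j.succ) 0 n
    rw [zero_add] at h1
    rw [h1]
    simpa using hane j n le_rfl
  have hcomp : ∀ x : ℂ, ‖x‖ < ∏ j, ρ j → (binomPoly (reversedSeq a b n) n).eval x ≠ 0 := by
    refine eval_binomPoly_prod_ne_zero Finset.univ hρ0 fun j _ y hy => ?_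
    have hmulρ : 1 / (8 * M j * n) * (ε j * n) = ρ j := by
      have := (hM0 j).ne'
      simp only [hρ]
      field_simp
    have hε1 : ε j ≤ δ j / 4 := min_le_left _ _
    have hε2 : ε j ≤ δ j ^ 2 / 8 := min_le_right _ _
    refine eval_binomPoly_mul_ne_zero (ρ₁ := 1 / (8 * M j * n)) (ρ₂ := ε j * n)
      (by have := hM0 j; positivity) (mul_pos (hε0 j) hn0) (fun h hh => ?_) (fun h hh => ?_)
      (by rw [hmulρ]; exact hy)
    · have hh' : ‖h‖ * (M j * n) ≤ 1 / 8 := by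
        rw [lt_div_iff₀ (by have := hM0 j; positivity)] at hh
        linarith
      refine eval_binomPoly_fallingFactorial_ne_zero (M := n) ?_ ?_ le_rfl
      · refine le_trans ?_ hh'
        gcongr
        have e : b j + n - 1 = (β j + 1) * n + d j := by simp only [hb]; ring
        rw [e]
        refine (norm_add_le _ _).trans ?_
        rw [norm_mul, Complex.norm_natCast]
        have e1 : ‖β j + 1‖ ≤ ‖β j‖ + 1 := (norm_add_le _ _).trans (by rw [norm_one])
        have e2 : ‖d j‖ ≤ ‖d j‖ * n := le_mul_of_one_le_right (norm_nonneg _) (by exact_mod_cast hn1)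
        have e3 : ‖β j + 1‖ * n ≤ (‖β j‖ + 1) * n := by gcongr
        simp only [hM]
        linarith
      · refine le_trans ?_ hh'
        gcongr
        exact le_mul_of_one_le_left hn0.le (hM1 j)
    · refine (eval_binomPoly_inv_fallingFactorial_ne_zero (D := δ j * n) (M := n)
        (mul_pos (hδ j) hn0) ?_ ?_ n _ le_rfl fun l hl => hn j l hl).1
      · refine hh.le.trans ?_
        rw [mul_div_right_comm]
        gcongr
      · calc (n : ℝ) * ‖h‖ ≤ n * (δ j ^ 2 / 8 * n) := by
              gcongr
              exact hh.le.trans (by gcongr)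
          _ = (δ j * n) ^ 2 / 8 := by ring
  constructor
  · refine le_antisymm (natDegree_hyperP_le α c β d n) (le_natDegree_of_ne_zero ?_)
    have h1 : (hyperP α c β d n).coeff n = hypergeomCoeff a b n := by
      rw [hyperP, hypergeomPoly, finsetSum_coeff]
      simp only [coeff_C_mul_X_pow]
      rw [Finset.sum_ite_eq]
      simp [ha, hb]
    rw [h1, hypergeomCoeff, Fin.prod_univ_succ, ha0, eval_ascPochhammer_neg_natCast, Nat.choose_self]
    have hfac : (n.factorial : ℂ) ≠ 0 := by exact_mod_cast n.factorial_ne_zero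
    have p1 : ∏ j : Fin B, (ascPochhammer ℂ n).eval (a j.succ) ≠ 0 :=
      Finset.prod_ne_zero_iff.2 fun j _ => hane' j
    have p2 : ∏ j, (ascPochhammer ℂ n).eval (b j) ≠ 0 :=
      Finset.prod_ne_zero_iff.2 fun j _ => hbne j n
    have p3 : ((-1 : ℂ)) ^ n ≠ 0 := by simp
    refine div_ne_zero (div_ne_zero (mul_ne_zero (mul_ne_zero p3 ?_) p1) p2) hfac
    simpa using hfac
  · intro z hz
    by_contra! hlt
    have hz0 : z ≠ 0 := by
      rintro rfl
      rw [norm_zero] at hlt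
      have := inv_pos.2 hP
      linarith
    rw [hyperP, eval_hypergeomPoly_eq_reversed ha0 (fun j => hbne j n) hane hz0] at hz
    have p1 : ∏ j : Fin B, (ascPochhammer ℂ n).eval (a j.succ) ≠ 0 :=
      Finset.prod_ne_zero_iff.2 fun j _ => hane' j
    have p2 : ∏ j, (ascPochhammer ℂ n).eval (b j) ≠ 0 :=
      Finset.prod_ne_zero_iff.2 fun j _ => hbne j n
    have h1 : ((-1 : ℂ)) ^ n * ((∏ j : Fin B, (ascPochhammer ℂ n).eval (a j.succ)) /
      ∏ j, (ascPochhammer ℂ n).eval (b j)) * z ^ n ≠ 0 :=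
      mul_ne_zero (mul_ne_zero (by simp) (div_ne_zero p1 p2)) (pow_ne_zero _ hz0)
    refine hcomp (-z⁻¹) ?_ ((mul_eq_zero.1 hz).resolve_left h1)
    rw [norm_neg, norm_inv]
    exact inv_lt_of_inv_lt₀ hP hlt

/-! ### Compactness of root-counting measures -/

theorem multiset_sum_dirac_compl_eq_zero {S : Multiset ℂ} {K : Set ℂ} (hK : MeasurableSet K)
    (h : ∀ ζ ∈ S, ζ ∈ K) : (S.map Measure.dirac).sum Kᶜ = 0 := by
  induction S using Multiset.induction_on with
  | empty => simp
  | cons a S ih =>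
    rw [Multiset.map_cons, Multiset.sum_cons, Measure.add_apply,
      ih fun ζ hζ => h ζ (Multiset.mem_cons_of_mem hζ), Measure.dirac_apply' _ hK.compl]
    simp [h a (Multiset.mem_cons_self a S)]

theorem rootMeasure_compl_eq_zero {n : ℕ} {p : ℂ[X]} {K : Set ℂ} (hK : MeasurableSet K)
    (h : ∀ z, p.eval z = 0 → z ∈ K) : rootMeasure n p Kᶜ = 0 := by
  rw [rootMeasure, Measure.smul_apply,
    multiset_sum_dirac_compl_eq_zero hK fun ζ hζ => h ζ (isRoot_of_mem_roots hζ), smul_zero]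

theorem isProbabilityMeasure_rootMeasure {n : ℕ} {p : ℂ[X]} (hn : n ≠ 0) (hp : p.natDegree = n) :
    IsProbabilityMeasure (rootMeasure n p) := by
  constructor
  rw [rootMeasure_univ, hp]
  exact ENNReal.inv_mul_cancel (by exact_mod_cast hn) (ENNReal.natCast_ne_top n)

/-- Sequential compactness of the probability measures carried by a compact set. -/
theorem exists_convergesNarrowly_subseq {K : Set ℂ} (hK : IsCompact K) (ν : ℕ → Measure ℂ)
    (hν : ∀ k, IsProbabilityMeasure (ν k)) (hνK : ∀ k, ν k Kᶜ = 0) :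
    ∃ ψ : ℕ → ℕ, StrictMono ψ ∧ ∃ μ : Measure ℂ, IsProbabilityMeasure μ ∧ μ Kᶜ = 0 ∧
      ConvergesNarrowly (fun k => ν (ψ k)) μ := by
  -- Prokhorov's theorem for a constant sequence of compact sets, with no mass outside
  have hcomp := isCompact_setOfPred_probabilityMeasure_mass_eq_compl_isCompact_le (E := ℂ)
    (u := fun _ => 0) (K := fun _ => K) tendsto_const_nhds (fun _ => hK) (Or.inr monotone_const)
  have hzero : ∀ m : ProbabilityMeasure ℂ, (m Kᶜ ≤ 0 ↔ (m : Measure ℂ) Kᶜ = 0) := by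
    intro m
    rw [nonpos_iff_eq_zero, ProbabilityMeasure.null_iff_toMeasure_null]
  obtain ⟨μ, hμ, ψ, hψ, hlim⟩ := hcomp.tendsto_subseq (x := fun k => ⟨ν k, hν k⟩)
    fun k _ => (hzero ⟨ν k, hν k⟩).2 (hνK k)
  refine ⟨ψ, hψ, μ, inferInstance, (hzero μ).1 (hμ 0), fun f => ?_⟩
  exact ProbabilityMeasure.tendsto_iff_forall_integral_tendsto.1 hlim f

theorem exists_isCompact_roots_hyperP {B : ℕ} {α c : Fin (B + 1) → ℂ} {β d : Fin B → ℂ}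
    (hα₀ : α 0 = -1) (hc₀ : c 0 = 0) (hα : IsGeneralType α) :
    ∃ K : Set ℂ, IsCompact K ∧
      (∀ n : ℕ, IsDefinedAt β d n → ∀ z : ℂ, (hyperP α c β d n).eval z = 0 → z ∈ K) ∧
      ∀ᶠ n in atTop, IsDefinedAt β d n → (hyperP α c β d n).natDegree = n := by
  obtain ⟨R, hR⟩ := exists_bound_roots_hyperP (β := β) (d := d) hα₀ hc₀ hα
  obtain ⟨n₀, hn₀⟩ := eventually_atTop.1 hR
  -- The finitely many indices below `n₀` add finitely many zeros.
  refine ⟨Metric.closedBall 0 R ∪ ⋃ n ∈ Finset.range n₀, {z | (hyperP α c β d n).IsRoot z},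
    (isCompact_closedBall 0 R).union ?_, fun n hdef z hz => ?_, hR.mono fun n h hdef => (h hdef).1⟩
  · exact (Finset.range n₀).isCompact_biUnion fun n _ =>
      (finite_setOfPred_isRoot (hyperP_ne_zero α c β d n)).isCompact
  · by_cases hn : n₀ ≤ n
    · exact Or.inl (by simpa using (hn₀ n hn hdef).2 z hz)
    · refine Or.inr (Set.mem_biUnion (Finset.mem_coe.2 (Finset.mem_range.2 (by omega))) hz)

theorem mainTheorem1 (B : ℕ) (α c : Fin (B + 1) → ℂ) (β d : Fin B → ℂ)
    (hα₀ : α 0 = -1) (hc₀ : c 0 = 0) (hα : ∀ i, α i ≠ 0) :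
    (∀ φ : ℕ → ℕ, StrictMono φ → (∀ k, IsDefinedAt β d (φ k)) →
      ∀ μ : Measure ℂ, IsFiniteMeasure μ →
        ConvergesWeakly (fun k => rootMeasure (φ k) (hyperP α c β d (φ k))) μ →
          (∀ᵐ z : ℂ, Integrable (fun ζ : ℂ => (z - ζ)⁻¹) μ ∧
            Tendsto (fun k => cauchyTransform (rootMeasure (φ k) (hyperP α c β d (φ k))) z)
              atTop (𝓝 (cauchyTransform μ z))) ∧
          (∀ᵐ z : ℂ,
            (∏ i, (z * cauchyTransform μ z + α i)) -
              cauchyTransform μ z * ∏ j, (z * cauchyTransform μ z + β j) = 0)) ∧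
    (IsGeneralType α →
      ∃ K : Set ℂ, IsCompact K ∧
        (∀ n : ℕ, IsDefinedAt β d n → ∀ z : ℂ, (hyperP α c β d n).eval z = 0 → z ∈ K) ∧
        ∀ φ : ℕ → ℕ, StrictMono φ → (∀ k, IsDefinedAt β d (φ k)) →
          ∃ ψ : ℕ → ℕ, StrictMono ψ ∧ ∃ μ : Measure ℂ, IsProbabilityMeasure μ ∧ μ Kᶜ = 0 ∧
            ConvergesNarrowly
              (fun k => rootMeasure (φ (ψ k)) (hyperP α c β d (φ (ψ k)))) μ) := by
  refine ⟨fun φ hφ hdef μ hμ hw => ⟨?_, ae_cauchyTransform_algebraic hα₀ hc₀ hφ hdef hw⟩, fun hg => ?_⟩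
  · filter_upwards [ae_integrable_cauchyKernel μ,
      ae_tendsto_cauchyTransform_hyperP hα₀ hc₀ hα hφ hdef hw] with z h1 h2 using ⟨h1, h2⟩
  · obtain ⟨K, hK, hroots, hdeg⟩ := exists_isCompact_roots_hyperP (β := β) (d := d) hα₀ hc₀ hg
    refine ⟨K, hK, hroots, fun φ hφ hdef => ?_⟩
    -- The total mass is `1` only once the degree is `n`, so the first terms are dropped.
    obtain ⟨n₀, hn₀⟩ := eventually_atTop.1 (hdeg.and (eventually_ne_atTop 0))
    have hge : ∀ k, n₀ ≤ φ (k + n₀) := fun k => (Nat.le_add_left n₀ k).trans (hφ.id_le (k + n₀))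
    obtain ⟨ψ, hψ, μ, h⟩ := exists_convergesNarrowly_subseq hK
      (fun k => rootMeasure (φ (k + n₀)) (hyperP α c β d (φ (k + n₀))))
      (fun k => isProbabilityMeasure_rootMeasure (hn₀ _ (hge k)).2 ((hn₀ _ (hge k)).1 (hdef _)))
      (fun k => rootMeasure_compl_eq_zero hK.measurableSet (hroots _ (hdef _)))
    exact ⟨fun k => ψ k + n₀, fun i j hij => by have := hψ hij; simp only; omega, μ, h⟩
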